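/- For every real $\varepsilon>0$ there exists $N=N(\varepsilon)$ such that the following holds for all integers $n\ge N$ divisible by $14$. Let $G$ be any $3$-regular simple graph of girth at least $5$ on $n$ vertices (not necessarily connected). Then for every integer $k>\varepsilon n$, $$ i_k(G)\le i_k(\mathit{HW}_n), $$ where $i_k(\cdot)$ denotes the number of independent sets of exactly $k$ vertices, $\mathit{HW}_n$ is the disjoint union of $n/14$ copies of the Heawood graph $\mathit{HW}$, and $\mathit{HW}$ is the graph on $\mathbb{Z}/14\mathbb{Z}$ whose edges are $\{i,i+1\}$ for all $i$ and $\{i,i+5\}$ for all even $i$ (the unique smallest $3$-regular graph of girth $6$). -/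

import Mathlib

namespace GirthSlices

/-- `i_k(G)`: the number of independent sets of size `k` in `G`. -/
noncomputable def indepCount {V : Type*} (G : SimpleGraph V) (k : ℕ) : ℕ :=
  {s : Finset V | G.IsNIndepSet k s}.ncard

/-- The Heawood graph: the Hamiltonian cycle `0, 1, …, 13` together with the seven chords
joining each even `i` to `i + 5` (arithmetic modulo `14`). -/
def heawood : SimpleGraph (Fin 14) :=
  SimpleGraph.fromRel fun i j => j = i + 1 ∨ (Even i.val ∧ j = i + 5)

/-- The disjoint union of `m` copies of `G`. -/
def disjointCopies {V : Type*} (m : ℕ) (G : SimpleGraph V) : SimpleGraph (Fin m × V) where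
  Adj x y := x.1 = y.1 ∧ G.Adj x.2 y.2
  symm := ⟨fun _ _ h => ⟨h.1.symm, h.2.symm⟩⟩
  loopless := ⟨fun _ h => G.irrefl h.2⟩

/-- `HW_n`: the disjoint union of `n / 14` copies of the Heawood graph
(meaningful when `14` divides `n`). -/
def heawoodUnion (n : ℕ) : SimpleGraph (Fin (n / 14) × Fin 14) :=
  disjointCopies (n / 14) heawood

end GirthSlices

/-! Let P be the independence polynomial of the Heawood graph, Z_G that of G, and n = 14M. Two
ingredients are balanced: an exponential gain in Z_G caused by the part of G that is not a union of
Heawood graphs, and a bound on how much is lost in passing from values of polynomials to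
coefficients.

Gain. At fugacity x the expected size of a random independent set is bounded by linear programming.
The number of neighbours of a vertex that are not covered by other vertices has the same law at a
random vertex and at a random neighbour of a random vertex, because G is regular. Dual variables for
this identity (`dualVar`) reduce the occupancy bound to nonnegativity of a local slack, conditioned
on the independent set outside a ball of radius two. Girth five leaves finitely many configurations
on the six second neighbours; `checkAll_eq_true` treats them coefficientwise in x, giving
`IsConfig.localSlack_ge`. Strictness of the slack away from Heawood configurations gives every
vertex with other surroundings a definite contribution (`gap_of_not_good`). Integrating the
occupancy gives `exists_gap`: Z ≤ P^r e^(-γr) for x ≥ ε if there are 14r vertices and none looks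
locally Heawood. A vertex that does look so lies in a Heawood component, and splitting these off
(`exists_heawood_factorization`) gives Z_G = P^m Z_G'.

Loss. By log-concavity every k ≤ 7M is the mode of P^M after weighting by powers of some x ≥ k/(14M)
> ε (`exists_weight_mode`). Passing from P^(m+1) to P^m, each normalised by its value at x, raises
the largest weighted coefficient by a factor at most e^c once m is large (`coeff_pow_le_exp_mul`):
otherwise P^m would have geometric tails at a fixed rate around its mode, which contradicts the
exponential growth in m of P^m(x/r) P^m(rx) / P^m(x)^2. With c = γ, the loss e^(γr) over r factors
cancels the gain exactly. If m is small then r is nearly M, and the gain beats the trivial loss 7M +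
1. -/

namespace GirthSlices

open Polynomial Finset

/-! ### Log-concavity of products and of powers of the Heawood polynomial -/

/-- Log-concavity without internal zeros, in the two-parameter form that is stable under
convolution. -/
def LogConcaveSeq (f : ℕ → ℝ) : Prop :=
  ∀ a d e, f a * f (a + d + e) ≤ f (a + d) * f (a + e)

/-- The lower triangular Toeplitz matrix of a sequence. -/
def toeplitz (f : ℕ → ℝ) (i s : ℕ) : ℝ := if s ≤ i then f (i - s) else 0

theorem toeplitz_nonneg {f : ℕ → ℝ} (hf : ∀ n, 0 ≤ f n) (i s : ℕ) : 0 ≤ toeplitz f i s := by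
  unfold toeplitz; split_ifs; exacts [hf _, le_rfl]

/-- For t ≤ i this is log-concavity based at i - t; for t > i the left product contains an entry
above the diagonal, which vanishes. -/
theorem toeplitz_minor {f : ℕ → ℝ} (hf : ∀ n, 0 ≤ f n) (h : LogConcaveSeq f) {i j s t : ℕ}
    (hij : i ≤ j) (hst : s ≤ t) :
    toeplitz f i t * toeplitz f j s ≤ toeplitz f i s * toeplitz f j t := by
  by_cases hti : t ≤ i
  · have := h (i - t) (t - s) (j - i)
    have e1 : i - t + (t - s) + (j - i) = j - s := by omega
    have e2 : i - t + (t - s) = i - s := by omega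
    have e3 : i - t + (j - i) = j - t := by omega
    rw [e1, e2, e3] at this
    simpa [toeplitz, hti, hst.trans hti, hst.trans (hti.trans hij), hti.trans hij] using this
  · rw [toeplitz, if_neg hti, zero_mul]
    exact mul_nonneg (toeplitz_nonneg hf _ _) (toeplitz_nonneg hf _ _)

/-- Symmetrising in s and t writes a 2×2 minor of a matrix product as half a sum of products of two
minors, and the two minors in each term have the same sign. -/
theorem cauchy_binet_nonneg {ι : Type*} [LinearOrder ι] (S : Finset ι) (A B C D : ι → ℝ)
    (hAB : ∀ s t, s ≤ t → A t * B s ≤ A s * B t)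
    (hCD : ∀ s t, s ≤ t → C t * D s ≤ C s * D t) :
    (∑ s ∈ S, A s * D s) * (∑ s ∈ S, B s * C s) ≤
      (∑ s ∈ S, A s * C s) * (∑ s ∈ S, B s * D s) := by
  have key : 0 ≤ ∑ s ∈ S, ∑ t ∈ S, (A s * B t - A t * B s) * (C s * D t - C t * D s) := by
    refine sum_nonneg fun s _ => sum_nonneg fun t _ => ?_
    rcases le_total s t with h | h
    · exact mul_nonneg (sub_nonneg.2 (hAB s t h)) (sub_nonneg.2 (hCD s t h))
    · exact mul_nonneg_of_nonpos_of_nonpos (sub_nonpos.2 (hAB t s h)) (sub_nonpos.2 (hCD t s h))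
  have e : ∑ s ∈ S, ∑ t ∈ S, (A s * B t - A t * B s) * (C s * D t - C t * D s) =
      2 * ((∑ s ∈ S, A s * C s) * (∑ s ∈ S, B s * D s) -
        (∑ s ∈ S, A s * D s) * (∑ s ∈ S, B s * C s)) := by
    have : ∀ s t, (A s * B t - A t * B s) * (C s * D t - C t * D s) =
        (A s * C s) * (B t * D t) - (A s * D s) * (B t * C t)
          - (B s * C s) * (A t * D t) + (B s * D s) * (A t * C t) := by intros; ring
    simp only [this, sum_add_distrib, sum_sub_distrib, ← mul_sum, ← sum_mul]
    ring
  rw [e] at key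
  linarith

/-- This is entry (a + d, d) of a product of Toeplitz matrices. The free shift d lets the four
coefficients of a log-concavity inequality occupy two common rows and two common columns. -/
theorem coeff_mul_toeplitz (p r : ℝ[X]) (a d N : ℕ) (hN : a + d < N) :
    (p * r).coeff a = ∑ s ∈ range N, toeplitz p.coeff (a + d) s * toeplitz r.coeff s d := by
  have h1 : (p * r).coeff a = (r * X ^ d * p).coeff (a + d) := by
    rw [show r * X ^ d * p = (p * r) * X ^ d by ring, coeff_mul_X_pow]
  rw [h1, coeff_mul, Finset.Nat.sum_antidiagonal_eq_sum_range_succ_mk]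
  have h2 : range (a + d).succ ⊆ range N := range_subset_range.2 hN
  rw [← sum_subset h2]
  · refine sum_congr rfl fun s hs => ?_
    have : s ≤ a + d := by simpa [Nat.lt_succ_iff] using hs
    rw [coeff_mul_X_pow', toeplitz, toeplitz, if_pos this, mul_comm]
  · intro s _ hs
    have : ¬ s ≤ a + d := by simpa [Nat.lt_succ_iff] using hs
    rw [toeplitz, if_neg this, zero_mul]

theorem LogConcaveSeq.mul {p r : ℝ[X]} (hp0 : ∀ n, 0 ≤ p.coeff n) (hr0 : ∀ n, 0 ≤ r.coeff n)
    (hp : LogConcaveSeq p.coeff) (hr : LogConcaveSeq r.coeff) :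
    LogConcaveSeq (p * r).coeff := by
  intro a d e
  rw [coeff_mul_toeplitz p r a d (a + d + e + 1) (by omega),
    coeff_mul_toeplitz p r (a + d + e) 0 (a + d + e + 1) (by omega),
    coeff_mul_toeplitz p r (a + d) 0 (a + d + e + 1) (by omega),
    coeff_mul_toeplitz p r (a + e) d (a + d + e + 1) (by omega)]
  simp only [add_zero]
  rw [show a + e + d = a + d + e by omega]
  refine cauchy_binet_nonneg _ _ _ _ _ (fun s t hst => toeplitz_minor hp0 hp (by omega) hst) ?_
  intro s t hst
  rw [mul_comm, mul_comm (toeplitz _ s 0)]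
  have := toeplitz_minor hr0 hr hst (Nat.zero_le d)
  linarith

theorem coeff_mul_nonneg {p r : ℝ[X]} (hp0 : ∀ n, 0 ≤ p.coeff n) (hr0 : ∀ n, 0 ≤ r.coeff n)
    (n : ℕ) : 0 ≤ (p * r).coeff n := by
  rw [coeff_mul]
  exact sum_nonneg fun x _ => mul_nonneg (hp0 _) (hr0 _)

theorem coeff_pow_nonneg {p : ℝ[X]} (hp0 : ∀ n, 0 ≤ p.coeff n) (m n : ℕ) :
    0 ≤ (p ^ m).coeff n := by
  induction m generalizing n with
  | zero => rw [pow_zero, coeff_one]; split_ifs <;> norm_num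
  | succ m ih => rw [pow_succ]; exact coeff_mul_nonneg ih hp0 n

theorem LogConcaveSeq.pow {p : ℝ[X]} (hp0 : ∀ n, 0 ≤ p.coeff n) (hp : LogConcaveSeq p.coeff)
    (m : ℕ) : LogConcaveSeq (p ^ m).coeff := by
  induction m with
  | zero =>
    intro a d e
    simp only [pow_zero, coeff_one]
    split_ifs <;> first | omega | norm_num
  | succ m ih => rw [pow_succ]; exact ih.mul (coeff_pow_nonneg hp0 m) hp0 hp

theorem LogConcaveSeq.mul_pow {f : ℕ → ℝ} (hf : LogConcaveSeq f) {x : ℝ} (hx : 0 ≤ x) :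
    LogConcaveSeq fun l => f l * x ^ l := by
  intro a d e
  have := mul_le_mul_of_nonneg_right (hf a d e) (pow_nonneg hx (a + (a + d + e)))
  calc _ = f a * f (a + d + e) * x ^ (a + (a + d + e)) := by rw [pow_add x a]; ring
    _ ≤ _ := this
    _ = _ := by
      rw [show a + (a + d + e) = (a + d) + (a + e) by ring, pow_add x (a + d)]; ring

/-- The coefficients of the independence polynomial of the Heawood graph. -/
def heawoodCoeff : ℕ → ℕ
  | 0 => 1 | 1 => 14 | 2 => 70 | 3 => 154 | 4 => 147 | 5 => 56 | 6 => 14 | 7 => 2 | _ => 0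

/-- The independence polynomial of the Heawood graph. -/
noncomputable def heawoodPoly : ℝ[X] :=
  1 + 14 * X + 70 * X ^ 2 + 154 * X ^ 3 + 147 * X ^ 4 + 56 * X ^ 5 + 14 * X ^ 6 + 2 * X ^ 7

theorem heawoodPoly_eq_sum :
    heawoodPoly = ∑ i ∈ range 8, C (heawoodCoeff i : ℝ) * X ^ i := by
  simp [sum_range_succ, heawoodCoeff, heawoodPoly]

theorem coeff_heawoodPoly (n : ℕ) : heawoodPoly.coeff n = heawoodCoeff n := by
  rw [heawoodPoly_eq_sum, finsetSum_coeff]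
  simp only [coeff_C_mul, coeff_X_pow, mul_ite, mul_one, mul_zero]
  rw [Finset.sum_ite_eq]
  split_ifs with h
  · rfl
  · rw [mem_range, not_lt] at h
    obtain ⟨m, rfl⟩ := Nat.exists_eq_add_of_le h
    rw [Nat.add_comm]; simp [heawoodCoeff]

theorem coeff_heawoodPoly_nonneg (n : ℕ) : 0 ≤ heawoodPoly.coeff n := by
  rw [coeff_heawoodPoly]; positivity

theorem heawoodCoeff_eq_zero {n : ℕ} (h : 8 ≤ n) : heawoodCoeff n = 0 := by
  obtain ⟨m, rfl⟩ := Nat.exists_eq_add_of_le h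
  rw [Nat.add_comm]; simp [heawoodCoeff]

theorem logConcaveSeq_heawoodPoly : LogConcaveSeq heawoodPoly.coeff := by
  have h : ∀ a < 8, ∀ d < 8, ∀ e < 8, heawoodCoeff a * heawoodCoeff (a + d + e) ≤
      heawoodCoeff (a + d) * heawoodCoeff (a + e) := by decide +kernel
  intro a d e
  simp only [coeff_heawoodPoly]
  norm_cast
  by_cases h' : a + d + e < 8
  · exact h a (by omega) d (by omega) e (by omega)
  · rw [heawoodCoeff_eq_zero (not_lt.1 h')]; simp

theorem eval_heawoodPoly (x : ℝ) : heawoodPoly.eval x =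
    1 + 14 * x + 70 * x ^ 2 + 154 * x ^ 3 + 147 * x ^ 4 + 56 * x ^ 5 + 14 * x ^ 6 + 2 * x ^ 7 := by
  simp [heawoodPoly]

theorem natDegree_heawoodPoly : heawoodPoly.natDegree = 7 := by
  unfold heawoodPoly; compute_degree!

theorem eval_heawoodPoly_pos {x : ℝ} (hx : 0 ≤ x) : 0 < heawoodPoly.eval x := by
  rw [eval_heawoodPoly]; positivity

end GirthSlices

/-! ### Geometric decay around a mode, and quantitative log-convexity -/

namespace GirthSlices

open Polynomial Finset

/-- Log-concavity carries the drop over the first seven steps to every later block of seven, which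
amounts to r² per step. The factor r^14 on the left pays for an incomplete block. -/
theorem LogConcaveSeq.decay_right {f : ℕ → ℝ} (hf0 : ∀ n, 0 ≤ f n) (hf : LogConcaveSeq f) {k : ℕ}
    (hk : ∀ l, f l ≤ f k) (hpos : 0 < f k) {r : ℝ} (hr0 : 0 < r) (hr1 : r ≤ 1)
    (h7 : f (k + 7) ≤ r ^ 14 * f k) (i : ℕ) : f (k + i) * r ^ 14 ≤ f k * r ^ (2 * i) := by
  induction i using Nat.strong_induction_on with
  | _ i ih =>
    by_cases hi : i < 7
    · exact mul_le_mul (hk _) (pow_le_pow_of_le_one hr0.le hr1 (by omega)) (by positivity) hpos.le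
    · obtain ⟨j, rfl⟩ := Nat.exists_eq_add_of_le (not_lt.1 hi)
      have h1 := hf k 7 j
      have h2 : f (k + 7 + j) ≤ r ^ 14 * f (k + j) := by
        refine le_of_mul_le_mul_left ?_ hpos
        calc _ ≤ _ := h1
          _ ≤ r ^ 14 * f k * f (k + j) := mul_le_mul_of_nonneg_right h7 (hf0 _)
          _ = _ := by ring
      calc f (k + (7 + j)) * r ^ 14 ≤ (r ^ 14 * f (k + j)) * r ^ 14 := by
            rw [← add_assoc]; gcongr
        _ = r ^ 14 * (f (k + j) * r ^ 14) := by ring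
        _ ≤ r ^ 14 * (f k * r ^ (2 * j)) := mul_le_mul_of_nonneg_left (ih j (by omega))
            (by positivity)
        _ = _ := by rw [show 2 * (7 + j) = 14 + 2 * j by ring, pow_add]; ring

theorem LogConcaveSeq.decay_left {f : ℕ → ℝ} (hf0 : ∀ n, 0 ≤ f n) (hf : LogConcaveSeq f) {k : ℕ}
    (hk : ∀ l, f l ≤ f k) (hpos : 0 < f k) {r : ℝ} (hr0 : 0 < r) (hr1 : r ≤ 1)
    (h7 : 7 ≤ k → f (k - 7) ≤ r ^ 14 * f k) (i : ℕ) (hik : i ≤ k) :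
    f (k - i) * r ^ 14 ≤ f k * r ^ (2 * i) := by
  induction i using Nat.strong_induction_on with
  | _ i ih =>
    by_cases hi : i < 7
    · exact mul_le_mul (hk _) (pow_le_pow_of_le_one hr0.le hr1 (by omega)) (by positivity) hpos.le
    · obtain ⟨j, rfl⟩ := Nat.exists_eq_add_of_le (not_lt.1 hi)
      have h1 := hf (k - (7 + j)) 7 j
      rw [show k - (7 + j) + 7 + j = k by omega, show k - (7 + j) + 7 = k - j by omega,
        show k - (7 + j) + j = k - 7 by omega] at h1
      have h2 : f (k - (7 + j)) ≤ r ^ 14 * f (k - j) := by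
        refine le_of_mul_le_mul_right ?_ hpos
        calc _ ≤ _ := h1
          _ ≤ f (k - j) * (r ^ 14 * f k) := mul_le_mul_of_nonneg_left (h7 (by omega)) (hf0 _)
          _ = _ := by ring
      calc f (k - (7 + j)) * r ^ 14 ≤ (r ^ 14 * f (k - j)) * r ^ 14 := by gcongr
        _ = r ^ 14 * (f (k - j) * r ^ 14) := by ring
        _ ≤ r ^ 14 * (f k * r ^ (2 * j)) :=
            mul_le_mul_of_nonneg_left (ih j (by omega) (by omega)) (by positivity)
        _ = _ := by rw [show 2 * (7 + j) = 14 + 2 * j by ring, pow_add]; ring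

theorem LogConcaveSeq.decay {f : ℕ → ℝ} (hf0 : ∀ n, 0 ≤ f n) (hf : LogConcaveSeq f) {k : ℕ}
    (hk : ∀ l, f l ≤ f k) (hpos : 0 < f k) {r : ℝ} (hr0 : 0 < r) (hr1 : r ≤ 1)
    (h7 : f (k + 7) ≤ r ^ 14 * f k) (h7' : 7 ≤ k → f (k - 7) ≤ r ^ 14 * f k) (l : ℕ) :
    f l * r ^ 14 ≤ f k * r ^ (2 * Nat.dist l k) := by
  rcases le_total k l with h | h
  · have := hf.decay_right hf0 hk hpos hr0 hr1 h7 (l - k)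
    rwa [Nat.add_sub_cancel' h, ← Nat.dist_eq_sub_of_le_right h] at this
  · have := hf.decay_left hf0 hk hpos hr0 hr1 h7' (k - l) (by omega)
    rwa [Nat.sub_sub_self h, ← Nat.dist_eq_sub_of_le h] at this

/-- Each distance occurs at most once on either side of k. -/
theorem sum_pow_dist_le {r : ℝ} (hr0 : 0 ≤ r) (hr1 : r < 1) (k N : ℕ) :
    ∑ l ∈ range N, r ^ Nat.dist l k ≤ 2 * (1 - r)⁻¹ := by
  have geo : ∀ n, ∑ i ∈ range n, r ^ i ≤ (1 - r)⁻¹ := fun n =>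
    (summable_geometric_of_lt_one hr0 hr1).sum_le_tsum _ (fun _ _ => by positivity) |>.trans_eq
      (tsum_geometric_of_lt_one hr0 hr1)
  have hinj : ∀ S : Finset ℕ, Set.InjOn (fun l => Nat.dist l k) S →
      ∑ l ∈ S, r ^ Nat.dist l k ≤ (1 - r)⁻¹ := by
    intro S hS
    rw [← sum_image (f := fun i => r ^ i) hS]
    obtain ⟨n, hn⟩ := (S.image fun l => Nat.dist l k).exists_nat_subset_range
    exact (sum_le_sum_of_subset_of_nonneg hn fun _ _ _ => by positivity).trans (geo n)
  rw [← sum_filter_add_sum_filter_not (range N) (fun l => l ≤ k), two_mul]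
  refine add_le_add (hinj _ ?_) (hinj _ ?_) <;>
  · intro a ha b hb hab
    simp only [coe_filter, Set.mem_ofPred_eq] at ha hb
    simp only [Nat.dist] at hab
    omega

theorem eval_mul_eq_sum {p : ℝ[X]} {N : ℕ} (hN : p.natDegree < N) (x s : ℝ) :
    p.eval (s * x) = ∑ l ∈ range N, p.coeff l * x ^ l * s ^ l := by
  rw [eval_eq_sum_range' hN]
  exact sum_congr rfl fun l _ => by rw [mul_pow]; ring

theorem coeff_mul_pow_le_eval {p : ℝ[X]} (hp : ∀ n, 0 ≤ p.coeff n) {x : ℝ} (hx : 0 ≤ x) (l : ℕ) :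
    p.coeff l * x ^ l ≤ p.eval x := by
  rw [eval_eq_sum_range' (n := max p.natDegree l + 1) (by omega)]
  exact single_le_sum (f := fun l => p.coeff l * x ^ l)
    (fun i _ => mul_nonneg (hp i) (pow_nonneg hx i)) (mem_range.2 (by omega))

/-- Geometric decay on both sides of the mode bounds the fluctuation of a polynomial. -/
theorem eval_mul_eval_le_of_decay {p : ℝ[X]} (hp : ∀ n, 0 ≤ p.coeff n) {x r : ℝ} (hx : 0 ≤ x)
    (hr0 : 0 < r) (hr1 : r < 1) {k : ℕ}
    (hdec : ∀ l, p.coeff l * x ^ l * r ^ 14 ≤ p.coeff k * x ^ k * r ^ (2 * Nat.dist l k)) :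
    p.eval (r⁻¹ * x) * p.eval (r * x) ≤
      ((r ^ 14)⁻¹ * (2 * (1 - r)⁻¹)) ^ 2 * (p.eval x) ^ 2 := by
  set a := p.coeff k * x ^ k with ha
  have ha0 : 0 ≤ a := mul_nonneg (hp _) (pow_nonneg hx _)
  have hr1' : 0 < 1 - r := by linarith
  -- One half of the decay r^(2 dist) absorbs the tilt s^l; the other half is summed as a geometric
  -- series. In the two uses, s = r⁻¹ and s = r, the factors s^k cancel.
  have main : ∀ s : ℝ, 0 < s → (∀ l, s ^ l * r ^ Nat.dist l k ≤ s ^ k) →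
      p.eval (s * x) ≤ a * (r ^ 14)⁻¹ * s ^ k * (2 * (1 - r)⁻¹) := by
    intro s hs hsl
    rw [eval_mul_eq_sum (Nat.lt_succ_self _) x s]
    calc _ ≤ ∑ l ∈ range (p.natDegree + 1), a * (r ^ 14)⁻¹ * s ^ k * r ^ Nat.dist l k := by
          refine sum_le_sum fun l _ => ?_
          have h1 : p.coeff l * x ^ l ≤ a * r ^ (2 * Nat.dist l k) * (r ^ 14)⁻¹ := by
            rw [← div_eq_mul_inv, le_div_iff₀ (by positivity)]; exact hdec l
          calc _ ≤ a * r ^ (2 * Nat.dist l k) * (r ^ 14)⁻¹ * s ^ l := by gcongr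
            _ = a * (r ^ 14)⁻¹ * r ^ Nat.dist l k * (s ^ l * r ^ Nat.dist l k) := by
              rw [two_mul, pow_add]; ring
            _ ≤ a * (r ^ 14)⁻¹ * r ^ Nat.dist l k * s ^ k := by gcongr; exact hsl l
            _ = _ := by ring
      _ = a * (r ^ 14)⁻¹ * s ^ k * ∑ l ∈ range (p.natDegree + 1), r ^ Nat.dist l k := by
          rw [mul_sum]
      _ ≤ _ := by gcongr; exact sum_pow_dist_le hr0.le hr1 _ _
  have h1 := main r⁻¹ (by positivity) (by
    intro l
    rw [inv_pow, inv_pow, inv_mul_le_iff₀ (by positivity), ← div_eq_mul_inv,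
      le_div_iff₀ (by positivity), ← pow_add]
    exact pow_le_pow_of_le_one hr0.le hr1.le (by simp only [Nat.dist]; omega))
  have h2 := main r hr0 (by
    intro l
    rw [← pow_add]
    exact pow_le_pow_of_le_one hr0.le hr1.le (by simp only [Nat.dist]; omega))
  have hax : a ≤ p.eval x := coeff_mul_pow_le_eval hp hx k
  have hnn : ∀ y : ℝ, 0 ≤ y → 0 ≤ p.eval y := fun y hy =>
    (mul_nonneg (hp 0) (pow_nonneg hy 0)).trans (coeff_mul_pow_le_eval hp hy 0)
  calc _ ≤ (a * (r ^ 14)⁻¹ * r⁻¹ ^ k * (2 * (1 - r)⁻¹)) *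
        (a * (r ^ 14)⁻¹ * r ^ k * (2 * (1 - r)⁻¹)) :=
        mul_le_mul h1 h2 (hnn _ (by positivity)) (by positivity)
    _ = ((r ^ 14)⁻¹ * (2 * (1 - r)⁻¹)) ^ 2 * a ^ 2 * (r⁻¹ ^ k * r ^ k) := by ring
    _ = ((r ^ 14)⁻¹ * (2 * (1 - r)⁻¹)) ^ 2 * a ^ 2 := by
        rw [← mul_pow r⁻¹ r, inv_mul_cancel₀ hr0.ne', one_pow, mul_one]
    _ ≤ _ := by gcongr

/-- Expanded over pairs, twice the difference has terms u_i u_j (r^(j-i) + r^(i-j) - 2) ≥ 0. Only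
the pair (0, 1) is kept as an explicit gain. -/
theorem sq_sum_add_le (u : ℕ → ℝ) (hu : ∀ n, 0 ≤ u n) {r : ℝ} (hr0 : 0 < r) (N : ℕ) (hN : 2 ≤ N) :
    (∑ i ∈ range N, u i) ^ 2 + u 0 * u 1 * (r + r⁻¹ - 2) / 2 ≤
      (∑ i ∈ range N, u i * r⁻¹ ^ i) * ∑ i ∈ range N, u i * r ^ i := by
  have hterm : ∀ i j, 0 ≤ r⁻¹ ^ i * r ^ j + r⁻¹ ^ j * r ^ i - 2 := by
    intro i j
    have h1 : (r⁻¹ ^ i * r ^ j) * (r⁻¹ ^ j * r ^ i) = 1 := by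
      have : r⁻¹ * r = 1 := inv_mul_cancel₀ hr0.ne'
      calc _ = (r⁻¹ * r) ^ i * (r⁻¹ * r) ^ j := by rw [mul_pow, mul_pow]; ring
        _ = 1 := by rw [this]; simp
    have h2 : 0 < r⁻¹ ^ i * r ^ j := by positivity
    nlinarith [sq_nonneg (r⁻¹ ^ i * r ^ j - r⁻¹ ^ j * r ^ i),
      sq_nonneg (r⁻¹ ^ i * r ^ j + r⁻¹ ^ j * r ^ i - 2), (by positivity : 0 < r⁻¹ ^ j * r ^ i)]
  set t : ℕ → ℕ → ℝ := fun i j => u i * u j * (r⁻¹ ^ i * r ^ j + r⁻¹ ^ j * r ^ i - 2) with ht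
  have ht0 : ∀ i j, 0 ≤ t i j := fun i j => mul_nonneg (mul_nonneg (hu i) (hu j)) (hterm i j)
  have h01 : t 0 1 ≤ ∑ i ∈ range N, ∑ j ∈ range N, t i j :=
    (single_le_sum (f := fun j => t 0 j) (fun j _ => ht0 0 j) (mem_range.2 (by omega))).trans
      (single_le_sum (f := fun i => ∑ j ∈ range N, t i j)
        (fun i _ => sum_nonneg fun j _ => ht0 i j) (mem_range.2 (by omega)))
  have hsum : ∑ i ∈ range N, ∑ j ∈ range N, t i j =
      2 * ((∑ i ∈ range N, u i * r⁻¹ ^ i) * ∑ i ∈ range N, u i * r ^ i)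
        - 2 * (∑ i ∈ range N, u i) ^ 2 := by
    have : ∀ i j, t i j = (u i * r⁻¹ ^ i) * (u j * r ^ j) + (u i * r ^ i) * (u j * r⁻¹ ^ j)
        - 2 * (u i * u j) := by intros; simp only [ht]; ring
    simp only [this, sum_add_distrib, sum_sub_distrib, ← mul_sum, ← sum_mul]
    ring
  have : t 0 1 = u 0 * u 1 * (r + r⁻¹ - 2) := by simp [ht]
  linarith

end GirthSlices

/-! ### Slow decrease of the largest weighted coefficient, and weights with a prescribed mode -/

namespace GirthSlices

open Polynomial Finset

theorem coeff_mul_heawoodPoly (p : ℝ[X]) (n : ℕ) : (p * heawoodPoly).coeff n =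
    ∑ j ∈ range 8, heawoodCoeff j * (if j ≤ n then p.coeff (n - j) else 0) := by
  rw [heawoodPoly_eq_sum, mul_sum, finsetSum_coeff]
  refine sum_congr rfl fun j _ => ?_
  rw [show p * (C (heawoodCoeff j : ℝ) * X ^ j) = C (heawoodCoeff j : ℝ) * (p * X ^ j) by ring,
    coeff_C_mul, coeff_mul_X_pow']

theorem eval_heawoodPoly_eq_sum (x : ℝ) :
    heawoodPoly.eval x = ∑ j ∈ range 8, heawoodCoeff j * x ^ j := by
  simp [heawoodPoly_eq_sum, eval_finsetSum]

/-- If `p` is at least `b` (after weighting) on a window of length `7` ending at `n`, then so is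
the product with the normalised Heawood polynomial at `n`. -/
theorem mul_eval_le_coeff_mul {p : ℝ[X]} {x b : ℝ} (hx : 0 < x) {n : ℕ} (hn : 7 ≤ n)
    (h : ∀ j ≤ 7, b ≤ p.coeff (n - j) * x ^ (n - j)) :
    b * heawoodPoly.eval x ≤ (p * heawoodPoly).coeff n * x ^ n := by
  rw [coeff_mul_heawoodPoly, eval_heawoodPoly_eq_sum, mul_sum, sum_mul]
  refine sum_le_sum fun j hj => ?_
  have hj : j ≤ 7 := by have := mem_range.1 hj; omega
  rw [if_pos (hj.trans hn)]
  calc b * (heawoodCoeff j * x ^ j) = (heawoodCoeff j * x ^ j) * b := by ring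
    _ ≤ (heawoodCoeff j * x ^ j) * (p.coeff (n - j) * x ^ (n - j)) := by gcongr; exact h j hj
    _ = heawoodCoeff j * p.coeff (n - j) * (x ^ j * x ^ (n - j)) := by ring
    _ = _ := by rw [← pow_add, Nat.add_sub_cancel' (hj.trans hn)]

theorem eval_heawoodPoly_mono {x y : ℝ} (hx : 0 ≤ x) (hxy : x ≤ y) :
    heawoodPoly.eval x ≤ heawoodPoly.eval y := by
  simp only [eval_heawoodPoly]; gcongr

/-- The coefficients below the leading one, 2, sum to 456, so the relative error of the leading term
is at most 228 / x. -/
theorem eval_heawoodPoly_le_of_large {c x : ℝ} (hx1 : 1 ≤ x) (hx : 228 / c ≤ x) (hc : 0 < c) :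
    heawoodPoly.eval x ≤ Real.exp c * (2 * x ^ 7) := by
  have h1 : 228 ≤ c * x := by rwa [div_le_iff₀' hc] at hx
  have h2 : heawoodPoly.eval x ≤ 2 * x ^ 7 + 456 * x ^ 6 := by
    rw [eval_heawoodPoly]
    have a0 : (1 : ℝ) ≤ x ^ 6 := one_le_pow₀ hx1
    have a : ∀ i, i ≤ 6 → x ^ i ≤ x ^ 6 := fun i hi => pow_le_pow_right₀ hx1 hi
    have a1 := a 1 (by norm_num)
    have a2 := a 2 (by norm_num)
    have a3 := a 3 (by norm_num)
    have a4 := a 4 (by norm_num)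
    have a5 := a 5 (by norm_num)
    rw [pow_one] at a1
    linarith
  have h3 : c + 1 ≤ Real.exp c := Real.add_one_le_exp c
  have h4 : 456 * x ^ 6 ≤ 2 * (c * x) * x ^ 6 := by gcongr; linarith
  calc _ ≤ _ := h2
    _ ≤ (c + 1) * (2 * x ^ 7) := by nlinarith
    _ ≤ _ := by gcongr

/-- The largest weighted coefficient of the powers of the Heawood polynomial decreases slowly. -/
theorem coeff_pow_le_exp_mul (c ε : ℝ) (hc : 0 < c) (hε : 0 < ε) :
    ∃ m₀ : ℕ, ∀ m ≥ m₀, ∀ x ≥ ε, ∀ B : ℝ,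
      (∀ l, (heawoodPoly ^ (m + 1)).coeff l * x ^ l ≤ B * heawoodPoly.eval x) →
      ∀ l, (heawoodPoly ^ m).coeff l * x ^ l ≤ Real.exp c * B := by
  set x₁ : ℝ := max 1 (228 / c)
  -- Chosen so that a drop by e^(-c) over seven steps is a drop by r² per step.
  set r : ℝ := Real.exp (-(c / 14)) with hr
  have hr0 : 0 < r := Real.exp_pos _
  have hr1 : r < 1 := Real.exp_lt_one_iff.2 (by linarith [div_pos hc (by norm_num : (0:ℝ) < 14)])
  have hr14 : r ^ 14 * Real.exp c = 1 := by
    rw [hr, ← Real.exp_nat_mul, ← Real.exp_add, Real.exp_eq_one_iff]; push_cast; ring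
  set K : ℝ := ((r ^ 14)⁻¹ * (2 * (1 - r)⁻¹)) ^ 2
  set η : ℝ := 7 * ε * (r + r⁻¹ - 2) / heawoodPoly.eval x₁ ^ 2 with hη
  have hx₁ : 0 ≤ x₁ := zero_le_one.trans (le_max_left _ _)
  have hgap : 0 < r + r⁻¹ - 2 := by
    have : r + r⁻¹ - 2 = (1 - r) ^ 2 / r := by field_simp; ring
    rw [this]
    have : 0 < 1 - r := by linarith
    positivity
  have hη0 : 0 < η := by
    have := eval_heawoodPoly_pos hx₁
    positivity
  -- Geometric tails would bound the tilted ratio of P^m by K, uniformly in m, whereas it is at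
  -- least (1 + η)^m.
  obtain ⟨m₀, hm₀⟩ := pow_unbounded_of_one_lt K (show 1 < 1 + η by linarith)
  refine ⟨m₀, fun m hm x hx B hB l₀ => ?_⟩
  have hx0 : 0 < x := hε.trans_le hx
  have hp0 := coeff_pow_nonneg coeff_heawoodPoly_nonneg m
  have hQ := eval_heawoodPoly_pos hx0.le
  -- For large x the top term of P alone suffices: it moves position l₀ to l₀ + 7 and is P up to the
  -- factor e^c.
  by_cases hlarge : x₁ ≤ x
  · have h1 := hB (l₀ + 7)
    have h2 : 2 * (heawoodPoly ^ m).coeff l₀ ≤ (heawoodPoly ^ (m + 1)).coeff (l₀ + 7) := by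
      rw [pow_succ, coeff_mul_heawoodPoly]
      refine le_trans (le_of_eq ?_) (single_le_sum (f := fun j => (heawoodCoeff j : ℝ) *
        (if j ≤ l₀ + 7 then (heawoodPoly ^ m).coeff (l₀ + 7 - j) else 0)) (fun j _ => ?_)
        (mem_range.2 (show 7 < 8 by norm_num)))
      · simp [heawoodCoeff]
      · exact mul_nonneg (by positivity) (by split_ifs; exacts [hp0 _, le_rfl])
    have h3 := eval_heawoodPoly_le_of_large ((le_max_left _ _).trans hlarge)
      ((le_max_right _ _).trans hlarge) hc
    have h4 : 0 ≤ B := by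
      have := (mul_nonneg (coeff_pow_nonneg coeff_heawoodPoly_nonneg (m + 1) 0)
        (pow_nonneg hx0.le 0)).trans (hB 0)
      exact nonneg_of_mul_nonneg_left this hQ
    have h5 : 2 * x ^ 7 * ((heawoodPoly ^ m).coeff l₀ * x ^ l₀) ≤
        2 * x ^ 7 * (Real.exp c * B) := by
      calc _ = 2 * (heawoodPoly ^ m).coeff l₀ * x ^ (l₀ + 7) := by rw [pow_add]; ring
        _ ≤ (heawoodPoly ^ (m + 1)).coeff (l₀ + 7) * x ^ (l₀ + 7) := by gcongr
        _ ≤ B * heawoodPoly.eval x := h1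
        _ ≤ B * (Real.exp c * (2 * x ^ 7)) := by gcongr
        _ = _ := by ring
    exact le_of_mul_le_mul_left h5 (by positivity)
  · push Not at hlarge
    by_contra! hcon
    set f : ℕ → ℝ := fun l => (heawoodPoly ^ m).coeff l * x ^ l with hf
    have hf0 : ∀ l, 0 ≤ f l := fun l => mul_nonneg (hp0 l) (by positivity)
    have hlc : LogConcaveSeq f :=
      (logConcaveSeq_heawoodPoly.pow coeff_heawoodPoly_nonneg m).mul_pow hx0.le
    obtain ⟨k, -, hk'⟩ := exists_max_image (range (7 * m + 1)) f ⟨0, by simp⟩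
    have hk : ∀ l, f l ≤ f k := by
      intro l
      by_cases hl : l < 7 * m + 1
      · exact hk' l (mem_range.2 hl)
      · have : (heawoodPoly ^ m).coeff l = 0 := by
          refine coeff_eq_zero_of_natDegree_lt (natDegree_pow_le.trans_lt ?_)
          rw [natDegree_heawoodPoly]; omega
        simp only [hf, this, zero_mul]
        exact hf0 k
    have hB0 : 0 ≤ B := by
      have := (mul_nonneg (coeff_pow_nonneg coeff_heawoodPoly_nonneg (m + 1) 0)
        (pow_nonneg hx0.le 0)).trans (hB 0)
      exact nonneg_of_mul_nonneg_left this hQ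
    have hBk : Real.exp c * B < f k := hcon.trans_le (hk l₀)
    have hpos : 0 < f k := lt_of_le_of_lt (by positivity) hBk
    have hBr : B ≤ r ^ 14 * f k := by
      calc B = r ^ 14 * Real.exp c * B := by rw [hr14, one_mul]
        _ = r ^ 14 * (Real.exp c * B) := by ring
        _ ≤ _ := by gcongr
    -- A coefficient of P^(m+1), divided by P(x), is an average of f over a window, so f cannot
    -- exceed B throughout a window.
    have hwin : ∀ (b : ℝ) (n : ℕ), 7 ≤ n → (∀ j ≤ 7, b ≤ f (n - j)) → b ≤ B := by
      intro b n hn h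
      have h' := hB n
      rw [pow_succ] at h'
      have := (mul_eval_le_coeff_mul hx0 hn h).trans h'
      exact le_of_mul_le_mul_right this hQ
    -- On the window from the mode k to k + 7, log-concavity puts the minimum at the far end; that
    -- end is therefore at most B.
    have h7 : f (k + 7) ≤ r ^ 14 * f k := by
      refine (hwin _ (k + 7) (by omega) fun j hj => ?_).trans hBr
      have h1 := hlc k j (7 - j)
      rw [show k + j + (7 - j) = k + 7 by omega, show k + (7 - j) = k + 7 - j by omega] at h1
      refine le_of_mul_le_mul_left (h1.trans ?_) hpos
      exact mul_le_mul_of_nonneg_right (hk _) (hf0 _)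
    have h7' : 7 ≤ k → f (k - 7) ≤ r ^ 14 * f k := by
      intro hk7
      refine (hwin _ k hk7 fun j hj => ?_).trans hBr
      have h1 := hlc (k - 7) (7 - j) j
      rw [show k - 7 + (7 - j) + j = k by omega, show k - 7 + (7 - j) = k - j by omega] at h1
      refine le_of_mul_le_mul_right (h1.trans ?_) hpos
      exact mul_le_mul_of_nonneg_left (hk _) (hf0 _)
    have hdec := hlc.decay hf0 hk hpos hr0 hr1.le h7 h7'
    have hfin := eval_mul_eval_le_of_decay hp0 hx0.le hr0 hr1 hdec
    simp only [eval_pow] at hfin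
    have hsq := sq_sum_add_le (fun j => (heawoodCoeff j : ℝ) * x ^ j) (fun j => by positivity)
      hr0 8 (by norm_num)
    have e : ∀ s : ℝ, ∑ i ∈ range 8, (heawoodCoeff i : ℝ) * x ^ i * s ^ i =
        heawoodPoly.eval (s * x) := fun s => by
      rw [eval_heawoodPoly_eq_sum]
      exact sum_congr rfl fun i _ => by rw [mul_pow]; ring
    rw [e, e, ← eval_heawoodPoly_eq_sum] at hsq
    -- The gain comes from the terms 1 and 14x of P; half of 14x gives the 7 in η.
    have hη' : (1 + η) * heawoodPoly.eval x ^ 2 ≤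
        heawoodPoly.eval (r⁻¹ * x) * heawoodPoly.eval (r * x) := by
      have h1 : η * heawoodPoly.eval x ^ 2 ≤ 7 * ε * (r + r⁻¹ - 2) := by
        rw [hη, div_mul_eq_mul_div, div_le_iff₀ (by have := eval_heawoodPoly_pos hx₁; positivity)]
        have := eval_heawoodPoly_mono hx0.le hlarge.le
        gcongr
      have h2 : 7 * ε * (r + r⁻¹ - 2) ≤ 7 * x * (r + r⁻¹ - 2) := by gcongr
      simp [heawoodCoeff] at hsq
      nlinarith
    have hη'' : (1 + η) ^ m * (heawoodPoly.eval x ^ m) ^ 2 ≤ K * (heawoodPoly.eval x ^ m) ^ 2 := by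
      refine le_trans ?_ hfin
      rw [← mul_pow, ← pow_mul, mul_comm m 2, pow_mul, ← mul_pow]
      gcongr
    have := le_of_mul_le_mul_right hη'' (by positivity)
    have hmono : (1 + η) ^ m₀ ≤ (1 + η) ^ m := pow_le_pow_right₀ (by linarith) hm
    linarith

theorem coeff_pow_le_exp_mul_iterate (c ε : ℝ) (hc : 0 < c) (hε : 0 < ε) :
    ∃ m₀ : ℕ, ∀ m ≥ m₀, ∀ x ≥ ε, ∀ (r : ℕ) (B : ℝ),
      (∀ l, (heawoodPoly ^ (m + r)).coeff l * x ^ l ≤ B) →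
      ∀ l, (heawoodPoly ^ m).coeff l * x ^ l * heawoodPoly.eval x ^ r ≤ Real.exp (c * r) * B := by
  obtain ⟨m₀, h⟩ := coeff_pow_le_exp_mul c ε hc hε
  refine ⟨m₀, fun m hm x hx r => ?_⟩
  have hQ := eval_heawoodPoly_pos (hε.le.trans hx)
  induction r with
  | zero => intro B hB l; simpa using hB l
  | succ r ih =>
    intro B hB l
    have h1 := h (m + r) (by omega) x hx (B / heawoodPoly.eval x) (by
      intro l; rw [div_mul_cancel₀ _ hQ.ne']; exact hB l)
    have h2 := ih _ h1 l
    calc _ = (heawoodPoly ^ m).coeff l * x ^ l * heawoodPoly.eval x ^ r * heawoodPoly.eval x := by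
          rw [pow_succ]; ring
      _ ≤ Real.exp (c * r) * (Real.exp c * (B / heawoodPoly.eval x)) * heawoodPoly.eval x := by
          gcongr
      _ = Real.exp (c * r) * Real.exp c * B := by field_simp
      _ = _ := by rw [← Real.exp_add]; push_cast; ring_nf

theorem coeff_heawoodPoly_pow_pos {M k : ℕ} (hk : k ≤ 7 * M) : 0 < (heawoodPoly ^ M).coeff k := by
  induction M generalizing k with
  | zero => simp [show k = 0 by omega]
  | succ M ih =>
    rw [pow_succ, coeff_mul_heawoodPoly]
    have hp := coeff_pow_nonneg coeff_heawoodPoly_nonneg M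
    have key : ∀ j ≤ 7, j ≤ k → k - j ≤ 7 * M → 0 < ∑ j ∈ range 8, (heawoodCoeff j : ℝ) *
        (if j ≤ k then (heawoodPoly ^ M).coeff (k - j) else 0) := by
      intro j hj hjk h
      refine sum_pos' (fun i _ => mul_nonneg (by positivity) (by split_ifs; exacts [hp _, le_rfl]))
        ⟨j, mem_range.2 (by omega), ?_⟩
      rw [if_pos hjk]
      refine mul_pos ?_ (ih h)
      interval_cases j <;> norm_num [heawoodCoeff]
    by_cases h : k ≤ 7
    · exact key k h le_rfl (by omega)
    · exact key 7 le_rfl (by omega) (by omega)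

/-- Combinatorially, an independent set among 14M vertices has at most 14M one-point extensions.
Algebraically, P' ≤ 14 P coefficientwise. -/
theorem nat_mul_coeff_le {M k : ℕ} :
    ((k + 1 : ℕ) : ℝ) * (heawoodPoly ^ M).coeff (k + 1) ≤ 14 * M * (heawoodPoly ^ M).coeff k := by
  have h1 : (derivative (heawoodPoly ^ M)).coeff k =
      (heawoodPoly ^ M).coeff (k + 1) * (k + 1) := by rw [coeff_derivative]
  rcases M with _ | M
  · simp [coeff_one]
  rw [derivative_pow_succ] at h1
  have h2 : ∀ n, (derivative heawoodPoly).coeff n ≤ 14 * heawoodPoly.coeff n := by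
    intro n
    rw [coeff_derivative, coeff_heawoodPoly, coeff_heawoodPoly]
    by_cases hn : n < 8
    · interval_cases n <;> norm_num [heawoodCoeff]
    · rw [heawoodCoeff_eq_zero (by omega), heawoodCoeff_eq_zero (by omega)]; simp
  have h3 : (heawoodPoly ^ M * derivative heawoodPoly).coeff k ≤
      14 * (heawoodPoly ^ (M + 1)).coeff k := by
    rw [pow_succ, coeff_mul, coeff_mul, mul_sum]
    refine sum_le_sum fun x _ => ?_
    have := mul_le_mul_of_nonneg_left (h2 x.2) (coeff_pow_nonneg coeff_heawoodPoly_nonneg M x.1)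
    linarith
  have h4 : (((M + 1 : ℕ) : ℝ)) * (heawoodPoly ^ M * derivative heawoodPoly).coeff k =
      (heawoodPoly ^ (M + 1)).coeff (k + 1) * (k + 1) := by
    rw [← h1, ← coeff_C_mul]; congr 1; push_cast; simp; ring
  have h5 := mul_le_mul_of_nonneg_left h3 (Nat.cast_nonneg (α := ℝ) (M + 1))
  push_cast at *
  linarith

/-- Every coefficient of a power of the Heawood polynomial is the largest one after reweighting. -/
theorem exists_weight_mode {M k : ℕ} (hk0 : 0 < k) (hk : k ≤ 7 * M) :
    ∃ x : ℝ, (k : ℝ) / (14 * M) ≤ x ∧ 0 < x ∧ ∀ l, (heawoodPoly ^ M).coeff l * x ^ l ≤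
      (heawoodPoly ^ M).coeff k * x ^ k := by
  obtain ⟨k, rfl⟩ : ∃ j, k = j + 1 := ⟨k - 1, by omega⟩
  set f := (heawoodPoly ^ M).coeff with hf
  have hp := coeff_pow_nonneg coeff_heawoodPoly_nonneg M
  have h1 : 0 < f (k + 1) := coeff_heawoodPoly_pow_pos hk
  have h0 : 0 < f k := coeff_heawoodPoly_pow_pos (by omega)
  have hM : 0 < (14 * M : ℝ) := by
    have : 0 < M := by omega
    positivity
  have hx : 0 < f k / f (k + 1) := div_pos h0 h1
  -- This weight makes two adjacent positive terms equal; log-concavity then makes both of them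
  -- maximal.
  refine ⟨f k / f (k + 1), ?_, hx, ?_⟩
  · rw [div_le_div_iff₀ hM h1]
    have := nat_mul_coeff_le (M := M) (k := k)
    linarith
  · set x := f k / f (k + 1)
    set g : ℕ → ℝ := fun l => f l * x ^ l with hg
    have hlc : LogConcaveSeq g :=
      (logConcaveSeq_heawoodPoly.pow coeff_heawoodPoly_nonneg M).mul_pow hx.le
    have hg0 : ∀ l, 0 ≤ g l := fun l => mul_nonneg (hp l) (by positivity)
    have heq : g k = g (k + 1) := by
      simp only [hg, pow_succ]
      have : f (k + 1) * x = f k := by simp only [x]; field_simp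
      linear_combination (-x ^ k) * this
    have hgpos : 0 < g k := mul_pos h0 (by positivity)
    have up : ∀ i, g (k + 1 + i) ≤ g (k + 1) := by
      intro i
      induction i with
      | zero => rfl
      | succ i ih =>
        have := hlc k 1 (i + 1)
        rw [← heq] at this ih
        have h' : g (k + 1 + (i + 1)) ≤ g (k + (i + 1)) := le_of_mul_le_mul_left this hgpos
        rw [← heq]
        refine h'.trans ?_
        rw [show k + (i + 1) = k + 1 + i by omega]; exact ih
    have down : ∀ i ≤ k, g (k - i) ≤ g (k + 1) := by
      intro i
      induction i with
      | zero => intro _; simp [heq]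
      | succ i ih =>
        intro hi
        have := hlc (k - (i + 1)) 1 (i + 1)
        rw [show k - (i + 1) + 1 + (i + 1) = k + 1 by omega, show k - (i + 1) + (i +
            1) = k by omega,
          show k - (i + 1) + 1 = k - i by omega, ← heq] at this
        rw [← heq] at ih ⊢
        exact (le_of_mul_le_mul_right this hgpos).trans (ih (by omega))
    intro l
    rcases le_or_gt l k with h | h
    · have := down (k - l) (by omega); rwa [Nat.sub_sub_self h] at this
    · have := up (l - (k + 1)); rwa [Nat.add_sub_cancel' (by omega)] at this

end GirthSlices

/-! ### Dual solution of the occupancy linear program and the finite check -/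

namespace GirthSlices

open Finset

/-- A positive factor clearing the denominators of the dual solution. -/
def dualScale (x : ℝ) : ℝ := 6 + 63 * x + 264 * x ^ 2 + 573 * x ^ 3 + 708 * x ^ 4 + 522 * x ^ 5 +
    231 * x ^ 6 + 57 * x ^ 7 + 6 * x ^ 8

/-- The numerator of the occupancy fraction of the Heawood graph. -/
def occNum (x : ℝ) : ℝ := x + 10 * x ^ 2 + 33 * x ^ 3 + 42 * x ^ 4 + 20 * x ^ 5 + 6 * x ^ 6 + x ^ 7

/-- The dual variable for the number of uncovered neighbours, multiplied by
`dualScale x * heawoodPoly.eval x`. -/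
def dualVar (x : ℝ) : ℕ → ℝ
  | 1 => 3 * x ^ 3 + 54 * x ^ 4 + 383 * x ^ 5 + 1399 * x ^ 6 + 2857 * x ^ 7 + 3290 * x ^ 8 +
      1985 * x ^ 9 + 345 * x ^ 10 + (-325) * x ^ 11 + (-242) * x ^ 12 + (-67) * x ^ 13 +
          (-7) * x ^ 14
  | 2 => 9 * x ^ 3 + 147 * x ^ 4 + 980 * x ^ 5 + 3498 * x ^ 6 + 7395 * x ^ 7 + 9758 * x ^ 8 +
      8354 * x ^ 9 + 4810 * x ^ 10 + 1931 * x ^ 11 + 571 * x ^ 12 + 133 * x ^ 13 + 23 * x ^ 14 +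
          2 * x ^ 15
  | 3 => 15 * x ^ 3 + 228 * x ^ 4 + 1433 * x ^ 5 + 4896 * x ^ 6 + 10096 * x ^ 7 + 13314 * x ^ 8 +
      11762 * x ^ 9 + 7268 * x ^ 10 + 3231 * x ^ 11 + 1032 * x ^ 12 + 227 * x ^ 13 +
          31 * x ^ 14 + 2 * x ^ 15
  | _ => 0

/-- The dual slack carried by one neighbour `u` of the root, given the number `t` of free
neighbours of the root, whether `u` is free, and the number `r` of uncovered children of `u`. -/
noncomputable def slackTerm (x : ℝ) (t : ℕ) (f : Bool) (r : ℕ) : ℝ :=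
  dualScale x * (occNum x * (x + (1 + x) ^ t) - x * heawoodPoly.eval x) / 3
    - dualVar x t * (x + (1 + x) ^ t)
    + dualVar x r * ((1 + x) ^ t - (1 + x * f.toNat))
    + dualVar x (r + 1) * (x + (1 + x * f.toNat))

/-- The coefficients of `slackTerm x t f r / x ^ 2`. -/
def slackTable : ℕ → Bool → ℕ → List ℤ
  | 0, false, 0 => [-6, -114, -932, -4341, -12880, -25851, -36450, -37034, -27567, -15143, -6104,
      -1762, -344, -40, -2]
  | 0, false, 1 => [-6, -108, -833, -3651, -10184, -19214, -25444, -24197, -16733, -8422, -3035,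
      -749, -114, -8]
  | 0, false, 2 => [-6, -102, -746, -3117, -8333, -15115, -19187, -17233, -10867, -4664, -1274,
      -194, -12]
  | 0, true, 0 => [-6, -114, -929, -4287, -12497, -24452, -33593, -33744, -25582, -14798, -6429,
      -2004, -411, -47, -2]
  | 0, true, 1 => [-6, -108, -827, -3558, -9587, -17115, -20906, -17729, -10364, -3957, -779, 64,
      86, 22, 2]
  | 0, true, 2 => [-6, -102, -740, -3036, -7880, -13717, -16486, -13677, -7459, -2206, 26, 267,
      82, 8]
  | 1, false, 0 => [-4, -76, -628, -2984, -9073, -18541, -25939, -24787, -15887, -6540, -1528,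
      -111, 28, 5]
  | 1, false, 1 => [-4, -70, -526, -2240, -5994, -10505, -12076, -8660, -3068, 526, 1216, 660,
      191, 30, 2]
  | 1, false, 2 => [-4, -64, -433, -1613, -3546, -4307, -1281, 4772, 9167, 8749, 5233, 2028, 493,
      68, 4]
  | 1, true, 0 => [-4, -76, -625, -2930, -8690, -17142, -23082, -21497, -13902, -6195, -1853,
      -353, -39, -2]
  | 1, true, 1 => [-4, -70, -520, -2147, -5397, -8406, -7538, -2192, 3301, 4991, 3472, 1473, 391,
      60, 4]
  | 1, true, 2 => [-4, -64, -427, -1532, -3093, -2909, 1420, 8328, 12575, 11207, 6533, 2489, 587,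
      76, 4]
  | 2, false, 0 => [-2, -39, -337, -1711, -5673, -12818, -19896, -20918, -14395, -5927, -942,
      345, 225, 49, 4]
  | 2, false, 1 => [-2, -33, -232, -910, -2157, -3000, -1777, 1356, 3699, 3469, 1822, 549, 79, 0,
      -1]
  | 2, false, 2 => [-2, -27, -133, -184, 981, 5894, 15655, 25794, 28771, 22526, 12560, 4986,
      1394, 268, 33, 2]
  | 2, true, 0 => [-2, -39, -334, -1657, -5290, -11419, -17039, -17628, -12410, -5582, -1267,
      103, 158, 42, 4]
  | 2, true, 1 => [-2, -33, -226, -817, -1560, -901, 2761, 7824, 10068, 7934, 4078, 1362, 279,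
      30, 1]
  | 2, true, 2 => [-2, -27, -127, -103, 1434, 7292, 18356, 29350, 32179, 24984, 13860, 5447,
      1488, 276, 33, 2]
  | 3, false, 0 => [0, 0, -3, -54, -383, -1399, -2857, -3290, -1985, -345, 325, 242, 67, 7]
  | 3, false, 1 => [0, 6, 105, 807, 3627, 10638, 21300, 29387, 27531, 16656, 5439, -101, -955,
      -425, -86, -7]
  | 3, false, 2 => [0, 12, 210, 1638, 7554, 22918, 48065, 71468, 76446, 59384, 33732, 14126,
      4442, 1086, 210, 29, 2]
  | 3, true, 0 => []
  | 3, true, 1 => [0, 6, 111, 900, 4224, 12737, 25838, 35855, 33900, 21121, 7695, 712, -755,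
      -395, -84, -7]
  | 3, true, 2 => [0, 12, 216, 1719, 8007, 24316, 50766, 75024, 79854, 61842, 35032, 14587, 4536,
      1094, 210, 29, 2]
  | _, _, _ => []

/-- Evaluation of a polynomial given by its list of coefficients. -/
def evalList (x : ℝ) : List ℤ → ℝ
  | [] => 0
  | a :: l => a + x * evalList x l

/-- The dual variables are already cleared of denominators, so these are 24 polynomial identities
with integer coefficients. -/
theorem slackTerm_eq (x : ℝ) {t r : ℕ} (f : Bool) (ht : t ≤ 3) (hr : r ≤ 2) :
    slackTerm x t f r = x ^ 2 * evalList x (slackTable t f r) := by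
  rw [slackTerm, eval_heawoodPoly]
  interval_cases t <;> interval_cases r <;> cases f <;>
    simp only [slackTable, evalList, dualVar, dualScale, occNum, Bool.toNat_true, Bool.toNat_false,
      Nat.reduceAdd] <;> push_cast <;> ring

/-- The positive parts of a list of coefficients. -/
def posPart (l : List ℤ) : List ℕ := l.map Int.toNat

/-- The negative parts of a list of coefficients. -/
def negPart (l : List ℤ) : List ℕ := l.map fun a => (-a).toNat

/-- Evaluation of a polynomial with natural coefficients. -/
def evalNat (x : ℝ) : List ℕ → ℝ
  | [] => 0
  | a :: l => a + x * evalNat x l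

theorem evalList_eq_sub (x : ℝ) (l : List ℤ) :
    evalList x l = evalNat x (posPart l) - evalNat x (negPart l) := by
  induction l with
  | nil => simp [evalList, evalNat, posPart, negPart]
  | cons a l ih =>
    have h : (a : ℝ) = (a.toNat : ℝ) - ((-a).toNat : ℝ) := by
      exact_mod_cast (Int.toNat_sub_toNat_neg a).symm
    simp only [posPart, negPart, List.map_cons, evalNat, evalList] at ih ⊢
    rw [ih, h]; ring

theorem evalNat_nonneg {x : ℝ} (hx : 0 ≤ x) (l : List ℕ) : 0 ≤ evalNat x l := by
  induction l with
  | nil => simp [evalNat]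
  | cons a l ih => simp only [evalNat]; positivity

/-- Coefficientwise addition. -/
def addList : List ℕ → List ℕ → List ℕ
  | [], l => l
  | a :: l, [] => a :: l
  | a :: l, b :: l' => (a + b) :: addList l l'

theorem evalNat_addList (x : ℝ) (l l' : List ℕ) :
    evalNat x (addList l l') = evalNat x l + evalNat x l' := by
  induction l generalizing l' with
  | nil => simp [addList, evalNat]
  | cons a l ih =>
    cases l' with
    | nil => simp [addList, evalNat]
    | cons b l' => simp only [addList, evalNat, ih]; push_cast; ring

theorem evalNat_replicate_append (x : ℝ) (n : ℕ) (l : List ℕ) :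
    evalNat x (List.replicate n 0 ++ l) = x ^ n * evalNat x l := by
  induction n with
  | zero => simp
  | succ n ih => simp only [List.replicate_succ, List.cons_append, evalNat, ih]; push_cast; ring

/-- The base used to pack coefficients into a natural number. -/
def packBase : ℕ := 67108864

/-- The natural number whose digits in base `packBase` are the given coefficients. -/
def pack : List ℕ → ℕ
  | [] => 0
  | a :: l => Nat.add a (Nat.mul packBase (pack l))

theorem pack_cons (a : ℕ) (l : List ℕ) : pack (a :: l) = a + packBase * pack l := rfl

theorem pack_addList (l l' : List ℕ) : pack (addList l l') = pack l + pack l' := by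
  induction l generalizing l' with
  | nil => simp [addList, pack]
  | cons a l ih =>
    cases l' with
    | nil => simp [addList, pack]
    | cons b l' => simp only [addList, pack_cons, ih]; ring

theorem pack_replicate_append (n : ℕ) (l : List ℕ) :
    pack (List.replicate n 0 ++ l) = packBase ^ n * pack l := by
  induction n with
  | zero => simp
  | succ n ih => simp only [List.replicate_succ, List.cons_append, pack_cons, ih]; ring

/-- Digitwise comparison in base `packBase`. -/
def digitsLe : ℕ → ℕ → ℕ → Bool
  | 0, _, b => Nat.beq b 0
  | n + 1, a, b => Nat.ble (Nat.mod b packBase) (Nat.mod a packBase) &&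
      digitsLe n (Nat.div a packBase) (Nat.div b packBase)

theorem evalNat_eq_zero_of_pack {x : ℝ} {l : List ℕ} (h : pack l = 0) : evalNat x l = 0 := by
  induction l with
  | nil => rfl
  | cons a l ih =>
    rw [pack_cons] at h
    have h1 : a = 0 := by omega
    have h2 : pack l = 0 := by
      rcases Nat.mul_eq_zero.1 (show packBase * pack l = 0 by omega) with h | h
      · exact absurd h (by decide)
      · exact h
    simp [evalNat, h1, ih h2]

/-- Entries below the base produce no carries, so digits are coefficients, and coefficientwise
comparison gives comparison of values for x ≥ 0. After n digits only the smaller side has to be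
exhausted. -/
theorem evalNat_le_of_digitsLe {x : ℝ} (hx : 0 ≤ x) (n : ℕ) (l l' : List ℕ)
    (hl : ∀ a ∈ l, a < packBase) (hl' : ∀ a ∈ l', a < packBase)
    (h : digitsLe n (pack l) (pack l') = true) : evalNat x l' ≤ evalNat x l := by
  induction n generalizing l l' with
  | zero =>
    rw [evalNat_eq_zero_of_pack (Nat.eq_of_beq_eq_true h)]
    exact evalNat_nonneg hx l
  | succ n ih =>
    simp only [digitsLe, Bool.and_eq_true] at h
    obtain ⟨h1, h2⟩ := h
    have h1 : pack l' % packBase ≤ pack l % packBase := Nat.le_of_ble_eq_true h1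
    have h2 : digitsLe n (pack l / packBase) (pack l' / packBase) = true := h2
    have hB : 0 < packBase := by decide
    have key : ∀ L : List ℕ, (∀ a ∈ L, a < packBase) → ∃ (a : ℕ) (t : List ℕ),
        evalNat x L = a + x * evalNat x t ∧ pack L % packBase = a ∧ pack L / packBase = pack t ∧
          ∀ a ∈ t, a < packBase := by
      intro L hL
      cases L with
      | nil => exact ⟨0, [], by simp [evalNat], by simp [pack], by simp [pack], by simp⟩
      | cons a t =>
        have ha : a < packBase := hL a (by simp)
        refine ⟨a, t, rfl, ?_, ?_, fun b hb => hL b (by simp [hb])⟩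
        · rw [pack_cons, Nat.add_mul_mod_self_left, Nat.mod_eq_of_lt ha]
        · rw [pack_cons, Nat.add_mul_div_left _ _ hB, Nat.div_eq_of_lt ha, zero_add]
    obtain ⟨a, t, e1, e2, e3, e4⟩ := key l hl
    obtain ⟨a', t', e1', e2', e3', e4'⟩ := key l' hl'
    rw [e2, e2'] at h1
    rw [e3, e3'] at h2
    have := ih t t' e4 e4' h2
    rw [e1, e1']
    gcongr

theorem addList_le {k k' : ℕ} {l l' : List ℕ} (h : ∀ a ∈ l, a ≤ k) (h' : ∀ a ∈ l', a ≤ k') :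
    ∀ a ∈ addList l l', a ≤ k + k' := by
  induction l generalizing l' with
  | nil => intro a ha; exact (h' a ha).trans (by omega)
  | cons b l ih =>
    cases l' with
    | nil => intro a ha; exact (h a ha).trans (by omega)
    | cons b' l' =>
      intro a ha
      rw [addList, List.mem_cons] at ha
      rcases ha with rfl | ha
      · exact Nat.add_le_add (h b (by simp)) (h' b' (by simp))
      · exact ih (fun a ha => h a (by simp [ha])) (fun a ha => h' a (by simp [ha])) a ha

/-- This size bound excludes carries once the contributions of all 64 subsets are added. -/
theorem slackTable_le (t : ℕ) (f : Bool) (r : ℕ) (a : ℤ) (ha : a ∈ slackTable t f r) :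
    |a| ≤ 80000 := by
  have h : ∀ t < 4, ∀ f : Bool, ∀ r < 3, ∀ a ∈ slackTable t f r, |a| ≤ 80000 := by decide +kernel
  by_cases ht : t < 4 ∧ r < 3
  · exact h t ht.1 f r ht.2 a ha
  · rw [slackTable] at ha
    · simp at ha
    all_goals (intros; subst_vars; omega)

theorem posPart_slackTable_le (t : ℕ) (f : Bool) (r : ℕ) :
    ∀ a ∈ posPart (slackTable t f r), a ≤ 80000 := by
  intro a ha
  obtain ⟨b, hb, rfl⟩ := List.mem_map.1 ha
  have := abs_le.1 (slackTable_le t f r b hb)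
  omega

theorem negPart_slackTable_le (t : ℕ) (f : Bool) (r : ℕ) :
    ∀ a ∈ negPart (slackTable t f r), a ≤ 80000 := by
  intro a ha
  obtain ⟨b, hb, rfl⟩ := List.mem_map.1 ha
  have := abs_le.1 (slackTable_le t f r b hb)
  omega

/-- The packed positive part of `slackTable`. -/
def packPos : ℕ → Bool → ℕ → ℕ
  | 0, false, 0 => pack (posPart (slackTable 0 false 0))
  | 0, false, 1 => pack (posPart (slackTable 0 false 1))
  | 0, false, 2 => pack (posPart (slackTable 0 false 2))
  | 0, true, 0 => pack (posPart (slackTable 0 true 0))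
  | 0, true, 1 => pack (posPart (slackTable 0 true 1))
  | 0, true, 2 => pack (posPart (slackTable 0 true 2))
  | 1, false, 0 => pack (posPart (slackTable 1 false 0))
  | 1, false, 1 => pack (posPart (slackTable 1 false 1))
  | 1, false, 2 => pack (posPart (slackTable 1 false 2))
  | 1, true, 0 => pack (posPart (slackTable 1 true 0))
  | 1, true, 1 => pack (posPart (slackTable 1 true 1))
  | 1, true, 2 => pack (posPart (slackTable 1 true 2))
  | 2, false, 0 => pack (posPart (slackTable 2 false 0))
  | 2, false, 1 => pack (posPart (slackTable 2 false 1))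
  | 2, false, 2 => pack (posPart (slackTable 2 false 2))
  | 2, true, 0 => pack (posPart (slackTable 2 true 0))
  | 2, true, 1 => pack (posPart (slackTable 2 true 1))
  | 2, true, 2 => pack (posPart (slackTable 2 true 2))
  | 3, false, 0 => pack (posPart (slackTable 3 false 0))
  | 3, false, 1 => pack (posPart (slackTable 3 false 1))
  | 3, false, 2 => pack (posPart (slackTable 3 false 2))
  | 3, true, 0 => pack (posPart (slackTable 3 true 0))
  | 3, true, 1 => pack (posPart (slackTable 3 true 1))
  | 3, true, 2 => pack (posPart (slackTable 3 true 2))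
  | _, _, _ => 0

/-- The packed negative part of `slackTable`. -/
def packNeg : ℕ → Bool → ℕ → ℕ
  | 0, false, 0 => pack (negPart (slackTable 0 false 0))
  | 0, false, 1 => pack (negPart (slackTable 0 false 1))
  | 0, false, 2 => pack (negPart (slackTable 0 false 2))
  | 0, true, 0 => pack (negPart (slackTable 0 true 0))
  | 0, true, 1 => pack (negPart (slackTable 0 true 1))
  | 0, true, 2 => pack (negPart (slackTable 0 true 2))
  | 1, false, 0 => pack (negPart (slackTable 1 false 0))
  | 1, false, 1 => pack (negPart (slackTable 1 false 1))
  | 1, false, 2 => pack (negPart (slackTable 1 false 2))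
  | 1, true, 0 => pack (negPart (slackTable 1 true 0))
  | 1, true, 1 => pack (negPart (slackTable 1 true 1))
  | 1, true, 2 => pack (negPart (slackTable 1 true 2))
  | 2, false, 0 => pack (negPart (slackTable 2 false 0))
  | 2, false, 1 => pack (negPart (slackTable 2 false 1))
  | 2, false, 2 => pack (negPart (slackTable 2 false 2))
  | 2, true, 0 => pack (negPart (slackTable 2 true 0))
  | 2, true, 1 => pack (negPart (slackTable 2 true 1))
  | 2, true, 2 => pack (negPart (slackTable 2 true 2))
  | 3, false, 0 => pack (negPart (slackTable 3 false 0))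
  | 3, false, 1 => pack (negPart (slackTable 3 false 1))
  | 3, false, 2 => pack (negPart (slackTable 3 false 2))
  | 3, true, 0 => pack (negPart (slackTable 3 true 0))
  | 3, true, 1 => pack (negPart (slackTable 3 true 1))
  | 3, true, 2 => pack (negPart (slackTable 3 true 2))
  | _, _, _ => 0

theorem packPos_eq {t r : ℕ} (f : Bool) (ht : t ≤ 3) (hr : r ≤ 2) :
    packPos t f r = pack (posPart (slackTable t f r)) := by
  interval_cases t <;> interval_cases r <;> cases f <;> rfl

theorem packNeg_eq {t r : ℕ} (f : Bool) (ht : t ≤ 3) (hr : r ≤ 2) :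
    packNeg t f r = pack (negPart (slackTable t f r)) := by
  interval_cases t <;> interval_cases r <;> cases f <;> rfl

/-- Whether the binary digit of weight `b` of `m` is `1`. -/
def hasBit (m b : ℕ) : Bool := Bool.not (Nat.beq (Nat.land m b) 0)

/-- Whether `n` and `m` have no binary digit `1` in common. -/
def disjointBits (n m : ℕ) : Bool := Nat.beq (Nat.land n m) 0

/-- The number of binary digits `1` among the last six. -/
def popSix (m : ℕ) : ℕ :=
  Nat.add (hasBit m 1).toNat (Nat.add (hasBit m 2).toNat (Nat.add (hasBit m 4).toNat
    (Nat.add (hasBit m 8).toNat (Nat.add (hasBit m 16).toNat (hasBit m 32).toNat))))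

/-- Whether the vertex of weight `b`, with neighbourhood `n`, is unblocked and uncovered. -/
def uncovBit (mb n b m : ℕ) : ℕ := (hasBit mb b && disjointBits n m).toNat

/-- Whether `m` encodes an independent set of unblocked vertices. -/
def okMask (mb n0 n1 n2 n3 n4 n5 m : ℕ) : Bool :=
  Nat.beq (Nat.land m mb) m && ((disjointBits m 1 || disjointBits n0 m) &&
    ((disjointBits m 2 || disjointBits n1 m) && ((disjointBits m 4 || disjointBits n2 m) &&
    ((disjointBits m 8 || disjointBits n3 m) && ((disjointBits m 16 || disjointBits n4 m) &&
    (disjointBits m 32 || disjointBits n5 m))))))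

/-- The contribution of the independent set `m` to the slack of a configuration. -/
def maskTerm (tab : ℕ → Bool → ℕ → ℕ) (mb n0 n1 n2 n3 n4 n5 m : ℕ) : ℕ :=
  let f0 := disjointBits m 3
  let f1 := disjointBits m 12
  let f2 := disjointBits m 48
  let t := Nat.add f0.toNat (Nat.add f1.toNat f2.toNat)
  Nat.mul (Nat.pow packBase (popSix m))
    (Nat.add (tab t f0 (Nat.add (uncovBit mb n0 1 m) (uncovBit mb n1 2 m)))
      (Nat.add (tab t f1 (Nat.add (uncovBit mb n2 4 m) (uncovBit mb n3 8 m)))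
        (tab t f2 (Nat.add (uncovBit mb n4 16 m) (uncovBit mb n5 32 m)))))

/-- The packed slack of a configuration, divided by `x ^ 2`. -/
def maskSum (tab : ℕ → Bool → ℕ → ℕ) (mb n0 n1 n2 n3 n4 n5 : ℕ) : ℕ :=
  (List.range 64).foldr (fun m acc =>
    bif okMask mb n0 n1 n2 n3 n4 n5 m then Nat.add (maskTerm tab mb n0 n1 n2 n3 n4 n5 m) acc
    else acc) 0

/-- The four-bit codes of the partial matchings between two pairs. -/
def matchings : List ℕ := [0, 1, 2, 4, 8, 6, 9]

/-- Row `i` of a four-bit code. -/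
def row (c i : ℕ) : ℕ := Nat.land (Nat.shiftRight c (2 * i)) 3

/-- Column `i` of a four-bit code. -/
def col (c i : ℕ) : ℕ :=
  Nat.add (Nat.land (Nat.shiftRight c i) 1) (2 * Nat.land (Nat.shiftRight c (2 + i)) 1)

/-- Coefficientwise nonnegativity of the slack, strict at `x ^ 7` for nontrivial configurations. -/
def checkSlack (mb n0 n1 n2 n3 n4 n5 : ℕ) (nontrivial : Bool) : Bool :=
  digitsLe 30 (maskSum packPos mb n0 n1 n2 n3 n4 n5)
    (Nat.add (bif nontrivial then Nat.pow packBase 7 else 0)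
      (maskSum packNeg mb n0 n1 n2 n3 n4 n5))

/-- Whether the edges between two pairs coded by `c` avoid the blocked vertices; the vertices of
the pairs have weights `p`, `2 * p` and `q`, `2 * q`. -/
def compat (mb p q c : ℕ) : Bool :=
  (disjointBits c 3 || hasBit mb p) && (disjointBits c 12 || hasBit mb (2 * p)) &&
  (disjointBits c 5 || hasBit mb q) && (disjointBits c 10 || hasBit mb (2 * q))

/-- Whether three matchings contain a triangle. -/
def hasTriangle (c01 c02 c12 : ℕ) : Bool :=
  [0, 1].any fun a => [0, 1].any fun b => [0, 1].any fun d =>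
    c01.testBit (2 * a + b) && c02.testBit (2 * a + d) && c12.testBit (2 * b + d)

/-- The check for the configuration with unblocked vertices `mb` and given matchings. -/
def checkConfig (mb c01 c02 c12 : ℕ) : Bool :=
  hasTriangle c01 c02 c12 ||
    checkSlack mb (4 * row c01 0 + 16 * row c02 0) (4 * row c01 1 + 16 * row c02 1)
      (col c01 0 + 16 * row c12 0) (col c01 1 + 16 * row c12 1)
      (col c02 0 + 4 * col c12 0) (col c02 1 + 4 * col c12 1)
      (Nat.ble 4 (popSix mb) && !(Nat.beq mb 63 && Nat.beq (c01 + c02 + c12) 0))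

/-- The check for all configurations. -/
def checkAll : Bool :=
  (List.range 64).all fun mb =>
    (matchings.filter (compat mb 1 4)).all fun c01 =>
      (matchings.filter (compat mb 1 16)).all fun c02 =>
        (matchings.filter (compat mb 4 16)).all fun c12 => checkConfig mb c01 c02 c12

/-- The computational core of the occupancy bound. Packing each polynomial into one natural number
turns the comparison for a configuration into a few operations on large numbers. -/
theorem checkAll_eq_true : checkAll = true := by decide +kernel

end GirthSlices

/-! ### From bit masks to configurations of second neighbours -/

namespace GirthSlices

open Finset

/-- The positions of the second neighbours of a vertex: two children for each of three
neighbours. -/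
abbrev Pos := Fin 3 × Fin 2

/-- The index of a position. -/
def Pos.idx (p : Pos) : ℕ := 2 * p.1 + p.2

/-- The set of positions encoded by the last six binary digits. -/
def maskSet (m : ℕ) : Finset Pos := univ.filter fun p => m.testBit p.idx

/-- The neighbour `i` has no occupied child. -/
def IsFreeAt (T : Finset Pos) (i : Fin 3) : Prop := ∀ j, (i, j) ∉ T

instance (T : Finset Pos) (i : Fin 3) : Decidable (IsFreeAt T i) :=
  inferInstanceAs (Decidable (∀ j, (i, j) ∉ T))

/-- The number of neighbours with no occupied child. -/
def freeCount (T : Finset Pos) : ℕ := #{i | IsFreeAt T i}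

open Classical in
/-- The number of uncovered children of the neighbour `i`. -/
noncomputable def uncovCount (W : Finset Pos) (E : Pos → Pos → Prop) (T : Finset Pos)
    (i : Fin 3) : ℕ := #{j | (i, j) ∈ W ∧ ∀ b ∈ T, ¬ E (i, j) b}

open Classical in
/-- The slack of the configuration with unblocked positions `W` and edges `E`. -/
noncomputable def localSlack (x : ℝ) (W : Finset Pos) (E : Pos → Pos → Prop) : ℝ :=
  ∑ T : Finset Pos with T ⊆ W ∧ ∀ a ∈ T, ∀ b ∈ T, ¬ E a b,
    x ^ #T * ∑ i, slackTerm x (freeCount T) (decide (IsFreeAt T i)) (uncovCount W E T i)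

theorem mem_maskSet {m : ℕ} {p : Pos} : p ∈ maskSet m ↔ m.testBit p.idx = true := by
  simp [maskSet]

theorem idx_lt (p : Pos) : p.idx < 6 := by
  have := p.1.2; have := p.2.2; simp only [Pos.idx]; omega

theorem exists_idx {k : ℕ} (hk : k < 6) : ∃ p : Pos, p.idx = k :=
  ⟨(⟨k / 2, by omega⟩, ⟨k % 2, by omega⟩), by simp only [Pos.idx]; omega⟩

theorem lt_six_of_testBit {m k : ℕ} (hm : m < 64) (h : m.testBit k = true) : k < 6 := by
  by_contra hk
  rw [Nat.testBit_lt_two_pow (hm.trans_le (show 2 ^ 6 ≤ 2 ^ k from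
    Nat.pow_le_pow_right (by norm_num) (not_lt.1 hk)))] at h
  exact absurd h (by simp)

theorem eq_of_maskSet_eq {m m' : ℕ} (hm : m < 64) (hm' : m' < 64) (h : maskSet m = maskSet m') :
    m = m' := by
  refine Nat.eq_of_testBit_eq fun k => ?_
  rw [Bool.eq_iff_iff]
  have key : ∀ p : Pos, m.testBit p.idx = true ↔ m'.testBit p.idx = true := fun p => by
    rw [← mem_maskSet, ← mem_maskSet, h]
  constructor <;> intro hk
  · obtain ⟨p, rfl⟩ := exists_idx (lt_six_of_testBit hm hk); exact (key p).1 hk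
  · obtain ⟨p, rfl⟩ := exists_idx (lt_six_of_testBit hm' hk); exact (key p).2 hk

theorem image_maskSet : (range 64).image maskSet = univ := by
  refine eq_univ_of_card _ ?_
  rw [card_image_of_injOn]
  · simp [Pos]
  · intro m hm m' hm' h
    exact eq_of_maskSet_eq (by simpa using hm) (by simpa using hm') h

theorem exists_maskSet (T : Finset Pos) : ∃ m < 64, maskSet m = T := by
  have : T ∈ (range 64).image maskSet := by rw [image_maskSet]; exact mem_univ T
  simpa using this

theorem sum_finset_pos (F : Finset Pos → ℝ) : ∑ T, F T = ∑ m ∈ range 64, F (maskSet m) := by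
  rw [← image_maskSet, sum_image]
  intro m hm m' hm' h
  exact eq_of_maskSet_eq (by simpa using hm) (by simpa using hm') h

theorem disjointBits_iff {n m : ℕ} :
    disjointBits n m = true ↔ ∀ k, n.testBit k = true → m.testBit k = false := by
  rw [disjointBits, Nat.beq_eq]
  change n &&& m = 0 ↔ _
  constructor
  · intro h k hk
    have := congrArg (fun a => a.testBit k) h
    simpa [hk] using this
  · intro h
    refine Nat.eq_of_testBit_eq fun k => ?_
    rw [Nat.testBit_and, Nat.zero_testBit]
    cases hk : n.testBit k
    · rfl
    · simp [h k hk]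

theorem disjointBits_two_pow (m k : ℕ) : disjointBits m (2 ^ k) = !m.testBit k := by
  rw [Bool.eq_iff_iff, disjointBits_iff]
  constructor
  · intro h
    cases hk : m.testBit k
    · rfl
    · have := h k hk; simp at this
  · intro h j hj
    rw [Nat.testBit_two_pow]
    have : ¬ k = j := by rintro rfl; simp [hj] at h
    simp [this]

theorem hasBit_two_pow (m k : ℕ) : hasBit m (2 ^ k) = m.testBit k := by
  have := disjointBits_two_pow m k
  rw [disjointBits] at this
  rw [hasBit, this]; simp

theorem land_eq_iff {m mb : ℕ} (hm : m < 64) :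
    Nat.beq (Nat.land m mb) m = true ↔ maskSet m ⊆ maskSet mb := by
  rw [Nat.beq_eq]
  change m &&& mb = m ↔ _
  constructor
  · intro h p hp
    rw [mem_maskSet] at *
    have := congrArg (fun a => a.testBit p.idx) h
    simpa [hp] using this
  · intro h
    refine Nat.eq_of_testBit_eq fun k => ?_
    rw [Nat.testBit_and]
    cases hk : m.testBit k
    · rfl
    · obtain ⟨p, rfl⟩ := exists_idx (lt_six_of_testBit hm hk)
      simpa using mem_maskSet.1 (h (mem_maskSet.2 hk))

theorem disjointBits_iff_forall {n m : ℕ} (hm : m < 64) :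
    disjointBits n m = true ↔ ∀ b ∈ maskSet m, ¬ n.testBit b.idx = true := by
  rw [disjointBits_iff]
  constructor
  · intro h b hb hn
    have := h _ hn
    rw [mem_maskSet, this] at hb
    exact absurd hb (by simp)
  · intro h k hk
    by_contra hmk
    rw [Bool.not_eq_false] at hmk
    obtain ⟨p, rfl⟩ := exists_idx (lt_six_of_testBit hm hmk)
    exact h p (mem_maskSet.2 hmk) hk

section Encoding

variable {mb : ℕ} {n : Pos → ℕ} {E : Pos → Pos → Prop}

theorem okMask_iff (hE : ∀ p q, E p q ↔ (n p).testBit q.idx = true) {m : ℕ} (hm : m < 64) :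
    okMask mb (n (0, 0)) (n (0, 1)) (n (1, 0)) (n (1, 1)) (n (2, 0)) (n (2, 1)) m = true ↔
      maskSet m ⊆ maskSet mb ∧ ∀ a ∈ maskSet m, ∀ b ∈ maskSet m, ¬ E a b := by
  have h : ∀ (k : ℕ) (p : Pos), p.idx = k →
      ((disjointBits m (2 ^ k) || disjointBits (n p) m) = true ↔
      (p ∈ maskSet m → ∀ b ∈ maskSet m, ¬ E p b)) := by
    rintro k p rfl
    rw [Bool.or_eq_true, disjointBits_two_pow, disjointBits_iff_forall hm, mem_maskSet]
    simp only [hE]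
    cases m.testBit p.idx <;> simp
  have h0 := h 0 (0, 0) rfl
  have h1 := h 1 (0, 1) rfl
  have h2 := h 2 (1, 0) rfl
  have h3 := h 3 (1, 1) rfl
  have h4 := h 4 (2, 0) rfl
  have h5 := h 5 (2, 1) rfl
  simp only [Nat.reducePow] at h0 h1 h2 h3 h4 h5
  simp only [okMask, Bool.and_eq_true, land_eq_iff hm, h0, h1, h2, h3, h4, h5]
  refine and_congr_right fun _ => ⟨?_, fun H => ⟨H _, H _, H _, H _, H _, H _⟩⟩
  rintro ⟨a0, a1, a2, a3, a4, a5⟩ ⟨i, j⟩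
  fin_cases i <;> fin_cases j <;> assumption

theorem uncovCount_eq (hE : ∀ p q, E p q ↔ (n p).testBit q.idx = true) {m : ℕ} (hm : m < 64)
    (i : Fin 3) : uncovCount (maskSet mb) E (maskSet m) i =
      Nat.add (uncovBit mb (n (i, 0)) (2 ^ (2 * (i : ℕ))) m)
        (uncovBit mb (n (i, 1)) (2 ^ (2 * (i : ℕ) + 1)) m) := by
  classical
  have h : ∀ (k : ℕ) (p : Pos), p.idx = k → uncovBit mb (n p) (2 ^ k) m =
      if p ∈ maskSet mb ∧ ∀ b ∈ maskSet m, ¬ E p b then 1 else 0 := by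
    rintro k p rfl
    have e : (hasBit mb (2 ^ p.idx) && disjointBits (n p) m) = true ↔
        p ∈ maskSet mb ∧ ∀ b ∈ maskSet m, ¬ E p b := by
      rw [Bool.and_eq_true, hasBit_two_pow, disjointBits_iff_forall hm, mem_maskSet]
      simp only [hE]
    rw [uncovBit]
    split_ifs with hc
    · rw [e.2 hc]; rfl
    · rw [Bool.eq_false_iff.2 (mt e.1 hc)]; rfl
  rw [h _ (i, 0) (by simp [Pos.idx]), h _ (i, 1) (by simp [Pos.idx]), uncovCount, card_filter,
    Fin.sum_univ_two]
  rfl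

theorem uncovCount_le (W : Finset Pos) (E : Pos → Pos → Prop) (T : Finset Pos) (i : Fin 3) :
    uncovCount W E T i ≤ 2 := (card_le_univ _).trans (by simp)

theorem freeCount_le (T : Finset Pos) : freeCount T ≤ 3 := (card_le_univ _).trans (by simp)

theorem card_maskSet : ∀ m < 64, #(maskSet m) = popSix m := by decide +kernel

theorem isFreeAt_maskSet : ∀ m < 64, decide (IsFreeAt (maskSet m) 0) = disjointBits m 3 ∧
    decide (IsFreeAt (maskSet m) 1) = disjointBits m 12 ∧
    decide (IsFreeAt (maskSet m) 2) = disjointBits m 48 := by decide +kernel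

theorem freeCount_maskSet {m : ℕ} (hm : m < 64) : freeCount (maskSet m) =
    Nat.add (disjointBits m 3).toNat
      (Nat.add (disjointBits m 12).toNat (disjointBits m 48).toNat) := by
  obtain ⟨h0, h1, h2⟩ := isFreeAt_maskSet m hm
  rw [← h0, ← h1, ← h2, freeCount, card_filter, Fin.sum_univ_three, Nat.add_assoc]
  simp only [Bool.toNat, Bool.cond_decide]
  rfl

/-- The list of coefficients underlying `maskTerm`. -/
def maskTermList (part : List ℤ → List ℕ) (mb n0 n1 n2 n3 n4 n5 m : ℕ) : List ℕ :=
  let f0 := disjointBits m 3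
  let f1 := disjointBits m 12
  let f2 := disjointBits m 48
  let t := Nat.add f0.toNat (Nat.add f1.toNat f2.toNat)
  List.replicate (popSix m) 0 ++
    addList (part (slackTable t f0 (Nat.add (uncovBit mb n0 1 m) (uncovBit mb n1 2 m))))
      (addList (part (slackTable t f1 (Nat.add (uncovBit mb n2 4 m) (uncovBit mb n3 8 m))))
        (part (slackTable t f2 (Nat.add (uncovBit mb n4 16 m) (uncovBit mb n5 32 m)))))

/-- The list of coefficients underlying `maskSum`, restricted to the sets in `ms`. -/
def maskSumList (part : List ℤ → List ℕ) (mb n0 n1 n2 n3 n4 n5 : ℕ) (ms : List ℕ) : List ℕ :=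
  ms.foldr (fun m acc =>
    bif okMask mb n0 n1 n2 n3 n4 n5 m then addList (maskTermList part mb n0 n1 n2 n3 n4 n5 m) acc
    else acc) []

theorem uncovBit_le (mb n b m : ℕ) : uncovBit mb n b m ≤ 1 := Bool.toNat_le _

theorem pack_maskTermList {part : List ℤ → List ℕ} {tab : ℕ → Bool → ℕ → ℕ}
    (h : ∀ {t r : ℕ} (f : Bool), t ≤ 3 → r ≤ 2 → tab t f r = pack (part (slackTable t f r)))
    (mb n0 n1 n2 n3 n4 n5 m : ℕ) : pack (maskTermList part mb n0 n1 n2 n3 n4 n5 m) =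
      maskTerm tab mb n0 n1 n2 n3 n4 n5 m := by
  have ht : Nat.add (disjointBits m 3).toNat
      (Nat.add (disjointBits m 12).toNat (disjointBits m 48).toNat) ≤ 3 :=
    Nat.add_le_add (Bool.toNat_le _) (Nat.add_le_add (Bool.toNat_le _) (Bool.toNat_le _))
  have hu : ∀ a b c d, Nat.add (uncovBit mb a b m) (uncovBit mb c d m) ≤ 2 := fun a b c d =>
    Nat.add_le_add (uncovBit_le mb a b m) (uncovBit_le mb c d m)
  simp only [maskTermList, maskTerm, pack_replicate_append, pack_addList, h _ ht (hu _ _ _ _)]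
  rfl

theorem pack_maskSumList {part : List ℤ → List ℕ} {tab : ℕ → Bool → ℕ → ℕ}
    (h : ∀ {t r : ℕ} (f : Bool), t ≤ 3 → r ≤ 2 → tab t f r = pack (part (slackTable t f r)))
    (mb n0 n1 n2 n3 n4 n5 : ℕ) : pack (maskSumList part mb n0 n1 n2 n3 n4 n5 (List.range 64)) =
      maskSum tab mb n0 n1 n2 n3 n4 n5 := by
  unfold maskSumList maskSum
  induction List.range 64 with
  | nil => rfl
  | cons m ms ih =>
    rw [List.foldr_cons, List.foldr_cons]
    cases okMask mb n0 n1 n2 n3 n4 n5 m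
    · exact ih
    · simp only [cond_true, pack_addList, pack_maskTermList h, ih]
      rfl

theorem maskSumList_le {part : List ℤ → List ℕ}
    (h : ∀ t f r, ∀ a ∈ part (slackTable t f r), a ≤ 80000) (mb n0 n1 n2 n3 n4 n5 : ℕ)
    (ms : List ℕ) : ∀ a ∈ maskSumList part mb n0 n1 n2 n3 n4 n5 ms, a ≤ 240000 * ms.length := by
  induction ms with
  | nil => simp [maskSumList]
  | cons m ms ih =>
    rw [maskSumList, List.foldr_cons]
    cases okMask mb n0 n1 n2 n3 n4 n5 m
    · intro a ha
      exact (ih a ha).trans (Nat.mul_le_mul_left _ (by simp))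
    · intro a ha
      rw [cond_true] at ha
      have h1 : ∀ a ∈ maskTermList part mb n0 n1 n2 n3 n4 n5 m, a ≤ 240000 := by
        intro a ha
        rw [maskTermList, List.mem_append] at ha
        rcases ha with ha | ha
        · rw [List.eq_of_mem_replicate ha]; norm_num
        · exact addList_le (h _ _ _) (addList_le (h _ _ _) (h _ _ _)) a ha
      have := addList_le h1 ih a ha
      rw [List.length_cons]; omega

theorem evalNat_maskSumList (x : ℝ) (part : List ℤ → List ℕ) (mb n0 n1 n2 n3 n4 n5 N : ℕ) :
    evalNat x (maskSumList part mb n0 n1 n2 n3 n4 n5 (List.range N)) =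
      ∑ m ∈ range N, if okMask mb n0 n1 n2 n3 n4 n5 m = true then
        evalNat x (maskTermList part mb n0 n1 n2 n3 n4 n5 m) else 0 := by
  rw [Finset.sum_eq_multiset_sum, range_val, Multiset.range, Multiset.map_coe, Multiset.sum_coe]
  unfold maskSumList
  induction List.range N with
  | nil => rfl
  | cons m ms ih =>
    rw [List.foldr_cons, List.map_cons, List.sum_cons, ← ih]
    cases okMask mb n0 n1 n2 n3 n4 n5 m <;> simp [evalNat_addList]

/-- Subsets of the six positions correspond to masks below 64. Separating positive and negative
coefficients makes the slack a difference of polynomials over ℕ, which can be packed. -/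
theorem localSlack_eq (hE : ∀ p q, E p q ↔ (n p).testBit q.idx = true) (x : ℝ) :
    localSlack x (maskSet mb) E = x ^ 2 *
      (evalNat x (maskSumList posPart mb (n (0, 0)) (n (0, 1)) (n (1, 0)) (n (1, 1)) (n (2, 0))
        (n (2, 1)) (List.range 64)) -
      evalNat x (maskSumList negPart mb (n (0, 0)) (n (0, 1)) (n (1, 0)) (n (1, 1)) (n (2, 0))
        (n (2, 1)) (List.range 64))) := by
  classical
  rw [localSlack, sum_filter, sum_finset_pos, evalNat_maskSumList, evalNat_maskSumList,
    ← sum_sub_distrib, mul_sum]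
  refine sum_congr rfl fun m hm => ?_
  have hm : m < 64 := mem_range.1 hm
  by_cases hok : okMask mb (n (0, 0)) (n (0, 1)) (n (1, 0)) (n (1, 1)) (n (2, 0)) (n (2, 1)) m
  · rw [if_pos ((okMask_iff hE hm).1 hok), if_pos hok, if_pos hok]
    simp only [slackTerm_eq x _ (freeCount_le _) (uncovCount_le _ _ _ _), Fin.sum_univ_three]
    obtain ⟨h0, h1, h2⟩ := isFreeAt_maskSet m hm
    have u0 := uncovCount_eq (mb := mb) hE hm 0
    have u1 := uncovCount_eq (mb := mb) hE hm 1
    have u2 := uncovCount_eq (mb := mb) hE hm 2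
    norm_num at u0 u1 u2
    simp only [maskTermList, evalNat_replicate_append, evalNat_addList, u0, u1, u2, h0, h1, h2,
      freeCount_maskSet hm, card_maskSet m hm, evalList_eq_sub]
    simp only [Nat.add_eq]
    ring
  · rw [if_neg (mt (okMask_iff hE hm).2 hok), if_neg hok, if_neg hok]; simp

theorem localSlack_of_checkSlack (hE : ∀ p q, E p q ↔ (n p).testBit q.idx = true) {x : ℝ}
    (hx : 0 ≤ x) {s : Bool} (h : checkSlack mb (n (0, 0)) (n (0, 1)) (n (1, 0)) (n (1, 1))
      (n (2, 0)) (n (2, 1)) s = true) :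
    (if s then x ^ 9 else 0) ≤ localSlack x (maskSet mb) E := by
  rw [localSlack_eq hE, ← sub_nonneg]
  set P := maskSumList posPart mb (n (0, 0)) (n (0, 1)) (n (1, 0)) (n (1, 1)) (n (2, 0))
        (n (2, 1)) (List.range 64) with hP
  set N := maskSumList negPart mb (n (0, 0)) (n (0, 1)) (n (1, 0)) (n (1, 1)) (n (2, 0))
        (n (2, 1)) (List.range 64) with hN
  have bP : ∀ a ∈ P, a ≤ 240000 * 64 :=
    maskSumList_le posPart_slackTable_le _ _ _ _ _ _ _ (List.range 64)
  have bN : ∀ a ∈ N, a ≤ 240000 * 64 :=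
    maskSumList_le negPart_slackTable_le _ _ _ _ _ _ _ (List.range 64)
  set S : List ℕ := List.replicate 7 0 ++ [s.toNat] with hS
  have bS : ∀ a ∈ S, a ≤ 1 := by cases s <;> simp [hS]
  have pS : pack S = bif s then Nat.pow packBase 7 else 0 := by
    rw [hS, pack_replicate_append]; cases s <;> simp [pack]
  have key : evalNat x (addList S N) ≤ evalNat x P := by
    -- Entries are at most 3 · 80000 · 64 + 1, which is below the base 2^26.
    refine evalNat_le_of_digitsLe hx 30 _ _ (fun a ha => ?_) (fun a ha => ?_) ?_
    · have := bP a ha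
      unfold packBase; omega
    · have := addList_le bS bN a ha
      unfold packBase; omega
    · rw [pack_addList, pS, hP, hN, pack_maskSumList packPos_eq, pack_maskSumList packNeg_eq]
      exact h
  rw [evalNat_addList, hS, evalNat_replicate_append] at key
  have h2 : x ^ 2 * (x ^ 7 * evalNat x [s.toNat]) ≤ x ^ 2 * (evalNat x P - evalNat x N) := by
    gcongr; linarith
  have h3 : x ^ 2 * (x ^ 7 * evalNat x [s.toNat]) = if s then x ^ 9 else 0 := by
    cases s <;> simp [evalNat]; ring
  linarith

end Encoding

end GirthSlices

/-! ### Every configuration allowed by girth five is covered by the check -/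

namespace GirthSlices

open Finset

/-- The four-bit code of the bipartite graph between two pairs. -/
def code (a b c d : Bool) : ℕ := a.toNat + 2 * b.toNat + 4 * c.toNat + 8 * d.toNat

theorem row_code : ∀ a b c d, row (code a b c d) 0 = a.toNat + 2 * b.toNat ∧
    row (code a b c d) 1 = c.toNat + 2 * d.toNat := by decide

theorem col_code : ∀ a b c d, col (code a b c d) 0 = a.toNat + 2 * c.toNat ∧
    col (code a b c d) 1 = b.toNat + 2 * d.toNat := by decide

theorem testBit_code : ∀ a b c d, (code a b c d).testBit 0 = a ∧ (code a b c d).testBit 1 = b ∧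
    (code a b c d).testBit 2 = c ∧ (code a b c d).testBit 3 = d := by decide

theorem code_mem_matchings : ∀ a b c d : Bool, ¬ (a = true ∧ b = true) → ¬ (c = true ∧ d = true) →
    ¬ (a = true ∧ c = true) → ¬ (b = true ∧ d = true) → code a b c d ∈ matchings := by decide

theorem code_eq_zero : ∀ a b c d : Bool, code a b c d = 0 →
    a = false ∧ b = false ∧ c = false ∧ d = false := by decide

theorem compat_code (mb p q : ℕ) (a b c d : Bool) (h0 : a = true ∨ b = true → hasBit mb p = true)
    (h1 : c = true ∨ d = true → hasBit mb (2 * p) = true)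
    (h2 : a = true ∨ c = true → hasBit mb q = true)
    (h3 : b = true ∨ d = true → hasBit mb (2 * q) = true) :
    compat mb p q (code a b c d) = true := by
  have e : ∀ a b c d, disjointBits (code a b c d) 3 = (!(a || b)) ∧
    disjointBits (code a b c d) 12 = (!(c || d)) ∧ disjointBits (code a b c d) 5 = (!(a || c)) ∧
    disjointBits (code a b c d) 10 = (!(b || d)) := by decide
  obtain ⟨e0, e1, e2, e3⟩ := e a b c d
  rw [compat, e0, e1, e2, e3]
  revert h0 h1 h2 h3
  generalize hasBit mb p = A
  generalize hasBit mb (2 * p) = B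
  generalize hasBit mb q = C
  generalize hasBit mb (2 * q) = D
  revert a b c d A B C D
  decide

theorem testBit_shift : ∀ a b c d : Bool,
    (∀ k < 6, (4 * (a.toNat + 2 * b.toNat) + 16 * (c.toNat + 2 * d.toNat)).testBit k =
      [false, false, a, b, c, d].getD k false) ∧
    (∀ k < 6, ((a.toNat + 2 * b.toNat) + 16 * (c.toNat + 2 * d.toNat)).testBit k =
      [a, b, false, false, c, d].getD k false) ∧
    (∀ k < 6, ((a.toNat + 2 * b.toNat) + 4 * (c.toNat + 2 * d.toNat)).testBit k =
      [a, b, c, d, false, false].getD k false) := by decide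

/-- The constraints on the edges between second neighbours imposed by girth at least five. -/
structure IsConfig (W : Finset Pos) (E : Pos → Pos → Prop) : Prop where
  symm : ∀ p q, E p q → E q p
  mem : ∀ p q, E p q → p ∈ W
  not_pair : ∀ i j j', ¬ E (i, j) (i, j')
  matching : ∀ p i, ¬ (E p (i, 0) ∧ E p (i, 1))
  no_triangle : ∀ p q r, E p q → E p r → ¬ E q r

/-- The edges between two sibling pairs form a partial matching on unblocked positions, so each of
the three codes survives the filters of the enumeration. -/
theorem IsConfig.checkConfig {W : Finset Pos} {E : Pos → Pos → Prop} (h : IsConfig W E) {mb : ℕ}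
    (hmb : mb < 64) (hW : maskSet mb = W) (e : Pos → Pos → Bool) (he : ∀ p q, e p q ↔ E p q) :
    checkConfig mb (code (e (0, 0) (1, 0)) (e (0, 0) (1, 1)) (e (0, 1) (1, 0)) (e (0, 1) (1, 1)))
      (code (e (0, 0) (2, 0)) (e (0, 0) (2, 1)) (e (0, 1) (2, 0)) (e (0, 1) (2, 1)))
      (code (e (1, 0) (2, 0)) (e (1, 0) (2, 1)) (e (1, 1) (2, 0)) (e (1, 1) (2, 1))) = true := by
  have hcol : ∀ p i, ¬ (E (i, 0) p ∧ E (i, 1) p) := fun p i hh =>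
    h.matching p i ⟨h.symm _ _ hh.1, h.symm _ _ hh.2⟩
  have hmem : ∀ i k, code (e (i, 0) (k, 0)) (e (i, 0) (k, 1)) (e (i, 1) (k, 0)) (e (i, 1) (k, 1)) ∈
      matchings := by
    intro i k
    apply code_mem_matchings <;> simp only [he]
    exacts [h.matching _ _, h.matching _ _, hcol _ _, hcol _ _]
  have hbit : ∀ p q, (e p q = true → hasBit mb (2 ^ p.idx) = true) ∧
      (e q p = true → hasBit mb (2 ^ p.idx) = true) := by
    intro p q
    rw [hasBit_two_pow, ← mem_maskSet, hW, he, he]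
    exact ⟨h.mem p q, fun hh => h.mem p q (h.symm _ _ hh)⟩
  have hcompat : ∀ i k : Fin 3, compat mb (2 ^ (2 * (i : ℕ))) (2 ^ (2 * (k : ℕ)))
      (code (e (i, 0) (k, 0)) (e (i, 0) (k, 1)) (e (i, 1) (k, 0)) (e (i, 1) (k, 1))) = true := by
    intro i k
    apply compat_code <;> rintro (hh | hh)
    · exact (hbit (i, 0) _).1 hh
    · exact (hbit (i, 0) _).1 hh
    · rw [← pow_succ']; exact (hbit (i, 1) _).1 hh
    · rw [← pow_succ']; exact (hbit (i, 1) _).1 hh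
    · exact (hbit (k, 0) _).2 hh
    · exact (hbit (k, 0) _).2 hh
    · rw [← pow_succ']; exact (hbit (k, 1) _).2 hh
    · rw [← pow_succ']; exact (hbit (k, 1) _).2 hh
  have hall := checkAll_eq_true
  rw [checkAll, List.all_eq_true] at hall
  have h1 := hall mb (List.mem_range.2 hmb)
  rw [List.all_eq_true] at h1
  have h2 := h1 _ (List.mem_filter.2 ⟨hmem 0 1, hcompat 0 1⟩)
  rw [List.all_eq_true] at h2
  have h3 := h2 _ (List.mem_filter.2 ⟨hmem 0 2, hcompat 0 2⟩)
  rw [List.all_eq_true] at h3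
  exact h3 _ (List.mem_filter.2 ⟨hmem 1 2, hcompat 1 2⟩)

theorem IsConfig.not_hasTriangle {W : Finset Pos} {E : Pos → Pos → Prop} (h : IsConfig W E)
    (e : Pos → Pos → Bool) (he : ∀ p q, e p q ↔ E p q) :
    hasTriangle (code (e (0, 0) (1, 0)) (e (0, 0) (1, 1)) (e (0, 1) (1, 0)) (e (0, 1) (1, 1)))
      (code (e (0, 0) (2, 0)) (e (0, 0) (2, 1)) (e (0, 1) (2, 0)) (e (0, 1) (2, 1)))
      (code (e (1, 0) (2, 0)) (e (1, 0) (2, 1)) (e (1, 1) (2, 0)) (e (1, 1) (2, 1))) = false := by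
  have ht : ∀ p q r, (e p q && e p r && e q r) = false := by
    intro p q r
    rw [Bool.eq_false_iff]
    simp only [ne_eq, Bool.and_eq_true, he]
    rintro ⟨⟨h1, h2⟩, h3⟩
    exact h.no_triangle p q r h1 h2 h3
  simp only [hasTriangle, List.any_cons, List.any_nil, Nat.reduceMul, Nat.reduceAdd, testBit_code,
    ht, Bool.or_self]

/-- The slack of every configuration is nonnegative, and bounded below for those that do not occur
in the Heawood graph and have at least four unblocked positions. -/
theorem IsConfig.localSlack_ge {W : Finset Pos} {E : Pos → Pos → Prop} (h : IsConfig W E) {x : ℝ}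
    (hx : 0 ≤ x) : 0 ≤ localSlack x W E ∧
      (4 ≤ #W → (W ≠ univ ∨ ∃ p q, E p q) → x ^ 9 ≤ localSlack x W E) := by
  classical
  obtain ⟨mb, hmb, hW⟩ := exists_maskSet W
  set e : Pos → Pos → Bool := fun p q => decide (E p q) with hedef
  have he : ∀ p q, e p q ↔ E p q := fun p q => by simp [hedef]
  have hsymm : ∀ p q, e p q = e q p := fun p q => by
    rw [Bool.eq_iff_iff, he, he]; exact ⟨h.symm p q, h.symm q p⟩
  have hpair : ∀ i j j', e (i, j) (i, j') = false := fun i j j' => by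
    rw [Bool.eq_false_iff, ne_eq, he]; exact h.not_pair i j j'
  have hc := h.checkConfig hmb hW e he
  rw [GirthSlices.checkConfig, h.not_hasTriangle e he, Bool.false_or] at hc
  set c01 := code (e (0, 0) (1, 0)) (e (0, 0) (1, 1)) (e (0, 1) (1, 0)) (e (0, 1) (1, 1)) with h01
  set c02 := code (e (0, 0) (2, 0)) (e (0, 0) (2, 1)) (e (0, 1) (2, 0)) (e (0, 1) (2, 1)) with h02
  set c12 := code (e (1, 0) (2, 0)) (e (1, 0) (2, 1)) (e (1, 1) (2, 0)) (e (1, 1) (2, 1)) with h12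
  set n : Pos → ℕ := fun p => ![
    ![4 * row c01 0 + 16 * row c02 0, 4 * row c01 1 + 16 * row c02 1],
    ![col c01 0 + 16 * row c12 0, col c01 1 + 16 * row c12 1],
    ![col c02 0 + 4 * col c12 0, col c02 1 + 4 * col c12 1]] p.1 p.2 with hn
  -- The codes store each pair of sibling pairs in one direction only; the other direction comes
  -- from symmetry, and the bits within a pair are zero.
  have hE : ∀ p q, E p q ↔ (n p).testBit q.idx = true := by
    intro p q
    rw [← he, ← Bool.eq_iff_iff]
    have hq := idx_lt q
    obtain ⟨i, j⟩ := p
    have s1 := fun a b c d => (testBit_shift a b c d).1 _ hq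
    have s2 := fun a b c d => (testBit_shift a b c d).2.1 _ hq
    have s3 := fun a b c d => (testBit_shift a b c d).2.2 _ hq
    fin_cases i <;> fin_cases j <;>
      simp only [hn, h01, h02, h12, row_code, col_code, s1, s2, s3, Fin.zero_eta, Fin.mk_one,
        Fin.isValue, Fin.reduceFinMk, Matrix.cons_val_zero, Matrix.cons_val_one, Matrix.cons_val]
    all_goals
      obtain ⟨i', j'⟩ := q
      fin_cases i' <;> fin_cases j' <;> simp [Pos.idx, hpair]
    all_goals exact hsymm _ _
  have hmain := localSlack_of_checkSlack (mb := mb) (n := n) hE hx hc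
  rw [hW] at hmain
  refine ⟨le_trans (by split_ifs <;> positivity) hmain, fun h4 hne => ?_⟩
  refine le_trans (le_of_eq (if_pos ?_).symm) hmain
  rw [Bool.and_eq_true, ← card_maskSet mb hmb, hW]
  refine ⟨Nat.ble_eq_true_of_le h4, ?_⟩
  rw [Bool.not_eq_true', Bool.and_eq_false_iff]
  by_contra! hcon
  obtain ⟨k1, k2⟩ := hcon
  have k1 : mb = 63 := Nat.eq_of_beq_eq_true (by simpa using k1)
  have k2 : c01 + c02 + c12 = 0 := Nat.eq_of_beq_eq_true (by simpa using k2)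
  rcases hne with hne | ⟨p, q, hpq⟩
  · apply hne
    rw [← hW, k1]; decide +kernel
  · have a1 := code_eq_zero _ _ _ _ (show c01 = 0 by omega)
    have a2 := code_eq_zero _ _ _ _ (show c02 = 0 by omega)
    have a3 := code_eq_zero _ _ _ _ (show c12 = 0 by omega)
    have : ∀ p q, e p q = false := by
      rintro ⟨i, j⟩ ⟨i', j'⟩
      fin_cases i <;> fin_cases i' <;> fin_cases j <;> fin_cases j' <;>
        first
        | exact hpair _ _ _
        | (simp [a1, a2, a3]; done)
        | (rw [hsymm]; simp [a1, a2, a3])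
    rw [← he, this] at hpq
    exact absurd hpq (by simp)

end GirthSlices

/-! ### The hard-core model and summing out a star -/

namespace GirthSlices

open Finset
open scoped Classical

universe u

variable {V : Type u} [Fintype V] (G : SimpleGraph V)

/-- The neighbourhood of a vertex. -/
noncomputable def nbhd (v : V) : Finset V := univ.filter fun u => G.Adj v u

/-- A finite set of vertices spanning no edge. -/
def Indep (I : Finset V) : Prop := ∀ a ∈ I, ∀ b ∈ I, ¬ G.Adj a b

/-- The independent sets of a finite graph. -/
noncomputable def indepSets : Finset (Finset V) := univ.filter fun I => Indep G I

/-- The hard-core partition function. -/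
noncomputable def hardCore (x : ℝ) : ℝ := ∑ I ∈ indepSets G, x ^ #I

/-- The number of neighbours of `v` not covered by a vertex of `I` other than `v`. -/
noncomputable def uncov (v : V) (I : Finset V) : ℕ := #{u ∈ nbhd G v | ∀ y ∈ I, G.Adj u y → y = v}

/-- Three-regular graphs without cycles of length three and four. -/
structure IsCubicGirthFive : Prop where
  card_nbhd : ∀ v, #(nbhd G v) = 3
  no_triangle : ∀ {a b c}, G.Adj a b → G.Adj a c → ¬ G.Adj b c
  no_square : ∀ {a b c d}, G.Adj a c → G.Adj b c → G.Adj a d → G.Adj b d → a = b ∨ c = d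

variable {G}

@[simp] theorem mem_nbhd {v u : V} : u ∈ nbhd G v ↔ G.Adj v u := by simp [nbhd]

@[simp] theorem mem_indepSets {I : Finset V} : I ∈ indepSets G ↔ Indep G I := by simp [indepSets]

theorem Indep.mono {I J : Finset V} (hJ : Indep G J) (h : I ⊆ J) : Indep G I :=
  fun a ha b hb => hJ a (h ha) b (h hb)

theorem indep_union_iff {I J : Finset V} : Indep G (J ∪ I) ↔
    Indep G J ∧ Indep G I ∧ ∀ a ∈ I, ∀ b ∈ J, ¬ G.Adj a b := by
  constructor
  · intro h
    exact ⟨h.mono subset_union_left, h.mono subset_union_right,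
      fun a ha b hb => h a (mem_union_right _ ha) b (mem_union_left _ hb)⟩
  · rintro ⟨h1, h2, h3⟩ a ha b hb hab
    rcases mem_union.1 ha with ha | ha <;> rcases mem_union.1 hb with hb | hb
    · exact h1 a ha b hb hab
    · exact h3 b hb a ha hab.symm
    · exact h3 a ha b hb hab
    · exact h2 a ha b hb hab

/-- Summing over independent sets by first fixing the part outside a set `B`. -/
theorem sum_indepSets_fiber (B : Finset V) (F : Finset V → ℝ) :
    ∑ I ∈ indepSets G, F I = ∑ J ∈ indepSets G with Disjoint J B,
      ∑ S ∈ B.powerset with Indep G (J ∪ S), F (J ∪ S) := by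
  rw [← sum_fiberwise_of_maps_to (s := indepSets G)
    (t := (indepSets G).filter fun J => Disjoint J B) (g := fun I => I \ B)]
  · refine sum_congr rfl fun J hJ => ?_
    rw [mem_filter, mem_indepSets] at hJ
    refine sum_bij' (fun I _ => I ∩ B) (fun S _ => J ∪ S) ?_ ?_ ?_ ?_ ?_
    · intro I hI
      rw [mem_filter, mem_indepSets] at hI
      obtain ⟨hI, rfl⟩ := hI
      rw [mem_filter, mem_powerset, sdiff_union_inter]
      exact ⟨inter_subset_right, hI⟩
    · intro S hS
      rw [mem_filter, mem_powerset] at hS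
      rw [mem_filter, mem_indepSets]
      refine ⟨hS.2, ?_⟩
      rw [union_sdiff_distrib, sdiff_eq_empty_iff_subset.2 hS.1, union_empty,
        sdiff_eq_self_of_disjoint hJ.2]
    · intro I hI
      obtain ⟨-, rfl⟩ := mem_filter.1 hI
      exact sdiff_union_inter I B
    · intro S hS
      rw [mem_filter, mem_powerset] at hS
      rw [union_inter_distrib_right, disjoint_iff_inter_eq_empty.1 hJ.2, empty_union,
        inter_eq_left.2 hS.1]
    · intro I hI
      obtain ⟨-, rfl⟩ := mem_filter.1 hI
      rw [sdiff_union_inter]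
  · intro I hI
    rw [mem_indepSets] at hI
    rw [mem_filter, mem_indepSets]
    exact ⟨hI.mono sdiff_subset, sdiff_disjoint⟩

theorem sum_powerset_pow (F : Finset V) (x : ℝ) : ∑ A ∈ F.powerset, x ^ #A = (1 + x) ^ #F := by
  have := sum_pow_mul_eq_add_pow x 1 F
  simpa [add_comm] using this

/-- Forgetting the constraints on the part inside X can only add terms. Hence a random independent
set avoids X with probability at least (1 + x)^(-#X). -/
theorem hardCore_le_mul (X : Finset V) {x : ℝ} (hx : 0 ≤ x) :
    hardCore G x ≤ (1 + x) ^ #X * ∑ J ∈ indepSets G with Disjoint J X, x ^ #J := by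
  rw [hardCore, sum_indepSets_fiber X, mul_sum]
  refine sum_le_sum fun J hJ => ?_
  have hJ := (mem_filter.1 hJ).2
  calc ∑ S ∈ X.powerset with Indep G (J ∪ S), x ^ #(J ∪ S)
      ≤ ∑ S ∈ X.powerset, x ^ #(J ∪ S) :=
        sum_le_sum_of_subset_of_nonneg (filter_subset _ _) fun _ _ _ => by positivity
    _ = ∑ S ∈ X.powerset, x ^ #J * x ^ #S := by
        refine sum_congr rfl fun S hS => ?_
        rw [card_union_of_disjoint (hJ.mono_right (mem_powerset.1 hS)), pow_add]
    _ = _ := by rw [← mul_sum, sum_powerset_pow, mul_comm]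

/-- The neighbours of `v` with no neighbour in `J`. -/
noncomputable def freeNbrs (G : SimpleGraph V) (v : V) (J : Finset V) : Finset V :=
  {u ∈ nbhd G v | ∀ y ∈ J, ¬ G.Adj u y}

/-- The number of neighbours of `u`, other than `v`, with no neighbour in `J`. -/
noncomputable def uncovChildren (G : SimpleGraph V) (v u : V) (J : Finset V) : ℕ :=
  #{w ∈ (nbhd G u).erase v | ∀ y ∈ J, ¬ G.Adj w y}

/-- The slack of the dual constraint carried by the vertex `v` in the independent set `I`. -/
noncomputable def vertexSlack (G : SimpleGraph V) (x : ℝ) (v : V) (I : Finset V) : ℝ :=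
  dualScale x * occNum x - dualScale x * heawoodPoly.eval x * (if v ∈ I then 1 else 0)
    - 3 * dualVar x (uncov G v I) + ∑ u ∈ nbhd G v, dualVar x (uncov G u I)

section Step

variable {v : V} {J : Finset V}

/-- Without triangles the neighbourhood of v is independent, so once v is left out its free
neighbours can be chosen arbitrarily. -/
theorem filter_indep_union (hG : IsCubicGirthFive G) (hJ : Indep G J)
    (hd : Disjoint J (insert v (nbhd G v))) :
    ((insert v (nbhd G v)).powerset.filter fun S => Indep G (J ∪ S)) =
      insert {v} (freeNbrs G v J).powerset := by
  have hJv : ∀ b ∈ J, ¬ G.Adj v b := fun b hb h =>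
    disjoint_left.1 hd hb (mem_insert_of_mem (mem_nbhd.2 h))
  ext S
  rw [mem_filter, mem_powerset, mem_insert, mem_powerset, indep_union_iff]
  constructor
  · rintro ⟨hS, -, h2, h3⟩
    by_cases hv : v ∈ S
    · left
      refine eq_singleton_iff_unique_mem.2 ⟨hv, fun y hy => ?_⟩
      rcases mem_insert.1 (hS hy) with h | h
      · exact h
      · exact absurd (mem_nbhd.1 h) (h2 v hv y hy)
    · right
      intro y hy
      rcases mem_insert.1 (hS hy) with rfl | h
      · exact absurd hy hv
      · exact mem_filter.2 ⟨h, h3 y hy⟩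
  · rintro (rfl | hS)
    · refine ⟨by simp, hJ, ?_, ?_⟩
      · intro a ha b hb
        rw [mem_singleton] at ha hb
        subst ha; subst hb; exact G.irrefl
      · intro a ha b hb
        rw [mem_singleton] at ha
        subst ha; exact hJv b hb
    · refine ⟨fun y hy => mem_insert_of_mem (mem_filter.1 (hS hy)).1, hJ, ?_, ?_⟩
      · intro a ha b hb
        exact hG.no_triangle (mem_nbhd.1 (mem_filter.1 (hS ha)).1)
          (mem_nbhd.1 (mem_filter.1 (hS hb)).1)
      · intro a ha b hb
        exact (mem_filter.1 (hS ha)).2 b hb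

theorem uncov_self_union {S : Finset V} (hd : Disjoint J (insert v (nbhd G v)))
    (hS : ∀ y ∈ S, ∀ u, G.Adj v u → G.Adj u y → y = v) :
    uncov G v (J ∪ S) = #(freeNbrs G v J) := by
  unfold uncov freeNbrs
  congr 1
  refine filter_congr fun u hu => ?_
  constructor
  · intro h y hy hadj
    have := h y (mem_union_left _ hy) hadj
    subst this
    exact disjoint_left.1 hd hy (mem_insert_self _ _)
  · intro h y hy hadj
    rcases mem_union.1 hy with hy | hy
    · exact absurd hadj (h y hy)
    · exact hS y hy u (mem_nbhd.1 hu) hadj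

/-- The neighbours of u are its two children and v. By `hS` only J can cover a child, while v can be
covered only from S; v accounts for the final summand. -/
theorem uncov_nbr_union {u : V} (hu : G.Adj v u) {S : Finset V}
    (hd : Disjoint J (insert v (nbhd G v)))
    (hS : ∀ y ∈ S, ∀ w, w ≠ v → G.Adj u w → G.Adj w y → y = u) :
    uncov G u (J ∪ S) = uncovChildren G v u J + if ∀ y ∈ S, G.Adj v y → y = u then 1 else 0 := by
  have hv : v ∈ nbhd G u := mem_nbhd.2 hu.symm
  have huJ : u ∉ J := fun h => disjoint_left.1 hd h (mem_insert_of_mem (mem_nbhd.2 hu))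
  unfold uncov uncovChildren
  rw [← insert_erase hv, filter_insert, erase_insert (notMem_erase v _)]
  have hv' : (∀ y ∈ J ∪ S, G.Adj v y → y = u) ↔ ∀ y ∈ S, G.Adj v y → y = u := by
    refine ⟨fun h y hy => h y (mem_union_right _ hy), fun h y hy hadj => ?_⟩
    rcases mem_union.1 hy with hy | hy
    · exact absurd hy fun hy => disjoint_left.1 hd hy (mem_insert_of_mem (mem_nbhd.2 hadj))
    · exact h y hy hadj
  have hc : ((nbhd G u).erase v).filter (fun w => ∀ y ∈ J ∪ S, G.Adj w y → y = u) =
      ((nbhd G u).erase v).filter (fun w => ∀ y ∈ J, ¬ G.Adj w y) := by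
    refine filter_congr fun w hw => ?_
    obtain ⟨hwv, hw⟩ := mem_erase.1 hw
    constructor
    · intro h y hy hadj
      have := h y (mem_union_left _ hy) hadj
      subst this; exact huJ hy
    · intro h y hy hadj
      rcases mem_union.1 hy with hy | hy
      · exact absurd hadj (h y hy)
      · exact hS y hy w hwv (mem_nbhd.1 hw) hadj
  rw [hc]
  split_ifs with h1 h2 h2
  · rw [card_insert_of_notMem (fun h => notMem_erase v _ (mem_filter.1 h).1)]
  · exact absurd (hv'.1 h1) h2
  · exact absurd (hv'.2 h2) h1
  · rw [add_zero]

/-- The subsets of F contained in {u} have total weight 1 + x or 1, according to whether u lies in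
F. -/
theorem sum_powerset_ite (F : Finset V) (u : V) (x a b : ℝ) :
    ∑ A ∈ F.powerset, x ^ #A * (if ∀ y ∈ A, y = u then b else a) =
      a * ((1 + x) ^ #F - (1 + x * (decide (u ∈ F)).toNat)) +
        b * (1 + x * (decide (u ∈ F)).toNat) := by
  have h1 : ∀ A : Finset V, x ^ #A * (if ∀ y ∈ A, y = u then b else a) =
      a * x ^ #A + (b - a) * (if ∀ y ∈ A, y = u then x ^ #A else 0) := by
    intro A; split_ifs <;> ring
  have h2 : F.powerset.filter (fun A => ∀ y ∈ A, y = u) = (F ∩ {u}).powerset := by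
    ext A
    simp only [mem_filter, mem_powerset, subset_inter_iff, subset_singleton_iff']
  have h3 : (1 + x) ^ #(F ∩ {u}) = 1 + x * (decide (u ∈ F)).toNat := by
    by_cases h : u ∈ F <;> simp [h]
  simp only [h1, sum_add_distrib, ← mul_sum]
  rw [← sum_filter, h2, sum_powerset_pow, sum_powerset_pow, h3]
  ring

/-- Summing out the closed neighbourhood of `v`. -/
theorem sum_vertexSlack_star (hG : IsCubicGirthFive G) (x : ℝ) (hJ : Indep G J)
    (hd : Disjoint J (insert v (nbhd G v))) :
    ∑ S ∈ (insert v (nbhd G v)).powerset with Indep G (J ∪ S),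
        x ^ #(J ∪ S) * vertexSlack G x v (J ∪ S) =
      x ^ #J * ∑ u ∈ nbhd G v, slackTerm x #(freeNbrs G v J) (decide (u ∈ freeNbrs G v J))
        (uncovChildren G v u J) := by
  set F := freeNbrs G v J with hF
  have hvJ : v ∉ J := fun h => disjoint_left.1 hd h (mem_insert_self _ _)
  have hFv : ∀ A ⊆ F, ∀ y ∈ A, G.Adj v y := fun A hA y hy =>
    mem_nbhd.1 (mem_filter.1 (hA hy)).1
  have hnot : {v} ∉ F.powerset := by
    intro h
    exact G.irrefl (hFv {v} (mem_powerset.1 h) v (mem_singleton_self v))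
  rw [filter_indep_union hG hJ hd, sum_insert hnot]
  have hcard : ∀ A ⊆ F, #(J ∪ A) = #J + #A := fun A hA =>
    card_union_of_disjoint (hd.mono_right fun y hy =>
        mem_insert_of_mem (mem_nbhd.2 (hFv A hA y hy)))
  have e1 : vertexSlack G x v (J ∪ {v}) = dualScale x * occNum x
      - dualScale x * heawoodPoly.eval x - 3 * dualVar x #F
      + ∑ u ∈ nbhd G v, dualVar x (uncovChildren G v u J + 1) := by
    rw [vertexSlack, if_pos (by simp), mul_one, uncov_self_union hd]
    · congr 1
      refine sum_congr rfl fun u hu => ?_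
      rw [uncov_nbr_union (mem_nbhd.1 hu) hd, if_pos]
      · intro y hy h
        rw [mem_singleton] at hy
        subst hy; exact absurd h G.irrefl
      · intro y hy w hw h1 h2
        rw [mem_singleton] at hy
        subst hy
        exact absurd h2.symm (hG.no_triangle (mem_nbhd.1 hu).symm h1)
    · intro y hy _ _ _; exact mem_singleton.1 hy
  have e2 : ∀ A ∈ F.powerset, vertexSlack G x v (J ∪ A) = dualScale x * occNum x
      - 3 * dualVar x #F + ∑ u ∈ nbhd G v, (if ∀ y ∈ A, y = u then
        dualVar x (uncovChildren G v u J + 1) else dualVar x (uncovChildren G v u J)) := by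
    intro A hA
    have hA := mem_powerset.1 hA
    have hvA : v ∉ A := fun h => G.irrefl (hFv A hA v h)
    rw [vertexSlack, if_neg (by simp [hvA, hvJ]), mul_zero, sub_zero, uncov_self_union hd]
    · congr 1
      refine sum_congr rfl fun u hu => ?_
      rw [uncov_nbr_union (mem_nbhd.1 hu) hd]
      · have : (∀ y ∈ A, G.Adj v y → y = u) ↔ ∀ y ∈ A, y = u :=
          ⟨fun h y hy => h y hy (hFv A hA y hy), fun h y hy _ => h y hy⟩
        simp only [this]
        split_ifs <;> rfl
      · intro y hy w hw h1 h2
        -- A neighbour y ≠ u of v covering a child w of u would close the 4-cycle v, u, w, y.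
        rcases hG.no_square (hFv A hA y hy) h2 (mem_nbhd.1 hu) h1.symm with h | h
        · exact absurd h.symm hw
        · exact h
    · intro y hy u h1 h2
      exact absurd h2 (hG.no_triangle h1 (hFv A hA y hy))
  have e3 : ∑ A ∈ F.powerset, x ^ #(J ∪ A) * vertexSlack G x v (J ∪ A) =
      x ^ #J * ((dualScale x * occNum x - 3 * dualVar x #F) * (1 + x) ^ #F +
        ∑ u ∈ nbhd G v, ∑ A ∈ F.powerset, x ^ #A * (if ∀ y ∈ A, y = u then
        dualVar x (uncovChildren G v u J + 1) else dualVar x (uncovChildren G v u J))) := by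
    rw [sum_comm, ← sum_powerset_pow, mul_sum, ← sum_add_distrib, mul_sum]
    refine sum_congr rfl fun A hA => ?_
    rw [e2 A hA, hcard A (mem_powerset.1 hA), pow_add, ← mul_sum]
    ring
  have hcv : #(J ∪ {v}) = #J + 1 := by
    rw [card_union_of_disjoint (by simpa using hvJ), card_singleton]
  rw [e3, e1, hcv]
  simp only [sum_powerset_ite, slackTerm]
  -- The contribution of the root is spread evenly over its three neighbours, which explains the
  -- division by 3 in `slackTerm`.
  have hsplit : ∀ c : ℝ, c = ∑ _u ∈ nbhd G v, c / 3 := by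
    intro c; rw [sum_const, hG.card_nbhd]; simp; ring
  rw [pow_succ, mul_assoc, ← mul_add]
  congr 1
  rw [hsplit ((dualScale x * occNum x - 3 * dualVar x #F) * (1 + x) ^ #F), ← sum_add_distrib,
    mul_add, mul_sum, hsplit (x * (dualScale x * occNum x - dualScale x * heawoodPoly.eval x -
      3 * dualVar x #F)), ← sum_add_distrib, ← sum_add_distrib]
  refine sum_congr rfl fun u _ => ?_
  ring

end Step

end GirthSlices

/-! ### The ball of radius two and the sum of all slacks -/

namespace GirthSlices

open Finset
open scoped Classical

universe u

variable {V : Type u} [Fintype V] {G : SimpleGraph V}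

/-- A labelling of the first and second neighbours of a vertex. -/
structure Labelling (G : SimpleGraph V) (v : V) where
  nbr : Fin 3 → V
  child : Pos → V
  nbr_injective : Function.Injective nbr
  child_injective : Function.Injective child
  nbhd_root : nbhd G v = univ.image nbr
  nbhd_nbr : ∀ i, (nbhd G (nbr i)).erase v = {child (i, 0), child (i, 1)}
  adj_root : ∀ i, G.Adj v (nbr i)
  adj_nbr : ∀ p, G.Adj (nbr p.1) (child p)
  child_ne_root : ∀ p, child p ≠ v
  child_not_adj : ∀ p, ¬ G.Adj v (child p)

theorem exists_labelling (hG : IsCubicGirthFive G) (v : V) : Nonempty (Labelling G v) := by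
  obtain ⟨u, hu⟩ : ∃ u : Fin 3 → V, Function.Injective u ∧ univ.image u = nbhd G v := by
    let e := (nbhd G v).equivFinOfCardEq (hG.card_nbhd v)
    refine ⟨fun i => (e.symm i : V), fun i j h => e.symm.injective (Subtype.ext h), ?_⟩
    ext y
    simp only [mem_image, mem_univ, true_and]
    exact ⟨by rintro ⟨i, rfl⟩; exact (e.symm i).2, fun hy => ⟨e ⟨y, hy⟩, by simp⟩⟩
  have hadj : ∀ i, G.Adj v (u i) := fun i => by
    rw [← mem_nbhd, ← hu.2]; exact mem_image_of_mem _ (mem_univ _)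
  have hc : ∀ i, ∃ w : Fin 2 → V, Function.Injective w ∧
      univ.image w = (nbhd G (u i)).erase v := by
    intro i
    have hcard : #((nbhd G (u i)).erase v) = 2 := by
      rw [card_erase_of_mem (mem_nbhd.2 (hadj i).symm), hG.card_nbhd]
    let e := ((nbhd G (u i)).erase v).equivFinOfCardEq hcard
    refine ⟨fun i => (e.symm i : V), fun i j h => e.symm.injective (Subtype.ext h), ?_⟩
    ext y
    simp only [mem_image, mem_univ, true_and]
    exact ⟨by rintro ⟨i, rfl⟩; exact (e.symm i).2, fun hy => ⟨e ⟨y, hy⟩, by simp⟩⟩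
  choose w hw using hc
  have hmem : ∀ i j, w i j ∈ (nbhd G (u i)).erase v := fun i j => by
    rw [← (hw i).2]; exact mem_image_of_mem _ (mem_univ _)
  have hwadj : ∀ i j, G.Adj (u i) (w i j) := fun i j => mem_nbhd.1 (mem_erase.1 (hmem i j)).2
  have hwne : ∀ i j, w i j ≠ v := fun i j => (mem_erase.1 (hmem i j)).1
  refine ⟨⟨u, fun p => w p.1 p.2, hu.1, ?_, hu.2.symm, ?_, hadj, fun p => hwadj _ _,
    fun p => hwne _ _, ?_⟩⟩
  · rintro ⟨i, j⟩ ⟨i', j'⟩ h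
    simp only at h
    -- A child shared by two neighbours of v would close a 4-cycle through v.
    have hi : i = i' := by
      have h2 : G.Adj (w i j) (u i') := by rw [h]; exact (hwadj i' j').symm
      rcases hG.no_square (hadj i) (hwadj i j).symm (hadj i') h2 with h | h
      · exact absurd h.symm (hwne i j)
      · exact hu.1 h
    subst hi
    rw [(hw i).1 h]
  · intro i
    rw [← (hw i).2]
    ext y; simp [Fin.exists_fin_two, eq_comm]
  · intro p h
    exact hG.no_triangle (hadj p.1).symm (hwadj p.1 p.2) h

namespace Labelling

variable {v : V} (l : Labelling G v)

/-- The second neighbourhood. -/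
noncomputable def children : Finset V := univ.image l.child

/-- The ball of radius two. -/
noncomputable def ball : Finset V := insert v (nbhd G v) ∪ l.children

/-- The positions not adjacent to `J`. -/
noncomputable def unblocked (J : Finset V) : Finset Pos := {p | ∀ y ∈ J, ¬ G.Adj (l.child p) y}

/-- Adjacency of unblocked positions. -/
def edge (J : Finset V) (p q : Pos) : Prop :=
  G.Adj (l.child p) (l.child q) ∧ p ∈ l.unblocked J ∧ q ∈ l.unblocked J

theorem adj_nbr_iff {i : Fin 3} {y : V} :
    G.Adj (l.nbr i) y ↔ y = v ∨ y = l.child (i, 0) ∨ y = l.child (i, 1) := by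
  constructor
  · intro h
    by_cases hy : y = v
    · exact Or.inl hy
    · have : y ∈ (nbhd G (l.nbr i)).erase v := mem_erase.2 ⟨hy, mem_nbhd.2 h⟩
      rw [l.nbhd_nbr] at this
      simpa using Or.inr this
  · rintro (rfl | rfl | rfl)
    exacts [(l.adj_root i).symm, l.adj_nbr (i, 0), l.adj_nbr (i, 1)]

theorem child_mem_children (p : Pos) : l.child p ∈ l.children :=
  mem_image_of_mem _ (mem_univ p)

theorem child_mem_ball (p : Pos) : l.child p ∈ l.ball :=
  mem_union_right _ (l.child_mem_children p)

theorem child_ne_nbr (p : Pos) (i : Fin 3) : l.child p ≠ l.nbr i :=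
  fun h => l.child_not_adj p (h ▸ l.adj_root i)

theorem disjoint_children : Disjoint l.children (insert v (nbhd G v)) := by
  rw [disjoint_left]
  intro y hy hy'
  obtain ⟨p, -, rfl⟩ := mem_image.1 hy
  rcases mem_insert.1 hy' with h | h
  · exact l.child_ne_root p h
  · exact l.child_not_adj p (mem_nbhd.1 h)

/-- Adjacent siblings form a triangle with their parent, and a vertex adjacent to both siblings
forms a 4-cycle with it. -/
theorem isConfig (hG : IsCubicGirthFive G) (J : Finset V) :
    IsConfig (l.unblocked J) (l.edge J) where
  symm p q h := ⟨h.1.symm, h.2.2, h.2.1⟩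
  mem p q h := h.2.1
  not_pair i j j' h := hG.no_triangle (l.adj_nbr (i, j)) (l.adj_nbr (i, j')) h.1
  matching p i h := by
    rcases hG.no_square h.1.1 (l.adj_nbr (i, 0)) h.2.1 (l.adj_nbr (i, 1)) with h' | h'
    · exact l.child_ne_nbr p i h'
    · exact absurd (l.child_injective h') (by simp)
  no_triangle p q r h1 h2 h3 := hG.no_triangle h1.1 h2.1 h3.1

theorem indep_union_image_iff {J : Finset V} (hJ : Indep G J) (T : Finset Pos) :
    Indep G (J ∪ T.image l.child) ↔
      T ⊆ l.unblocked J ∧ ∀ a ∈ T, ∀ b ∈ T, ¬ l.edge J a b := by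
  rw [indep_union_iff]
  constructor
  · rintro ⟨-, h2, h3⟩
    refine ⟨fun p hp => ?_, fun a ha b hb h => ?_⟩
    · simp only [unblocked, mem_filter, mem_univ, true_and]
      exact h3 _ (mem_image_of_mem _ hp)
    · exact h2 _ (mem_image_of_mem _ ha) _ (mem_image_of_mem _ hb) h.1
  · rintro ⟨h1, h2⟩
    refine ⟨hJ, ?_, ?_⟩
    · intro a ha b hb h
      obtain ⟨p, hp, rfl⟩ := mem_image.1 ha
      obtain ⟨q, hq, rfl⟩ := mem_image.1 hb
      exact h2 p hp q hq ⟨h, h1 hp, h1 hq⟩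
    · intro a ha b hb
      obtain ⟨p, hp, rfl⟩ := mem_image.1 ha
      exact (mem_filter.1 (h1 hp)).2 b hb

/-- All neighbours of a first neighbour lie in the ball, which J avoids, so only T can block it. -/
theorem mem_freeNbrs_iff {J : Finset V} (hd : Disjoint J l.ball) (T : Finset Pos) (i : Fin 3) :
    l.nbr i ∈ freeNbrs G v (J ∪ T.image l.child) ↔ IsFreeAt T i := by
  rw [freeNbrs, mem_filter, mem_nbhd]
  constructor
  · rintro ⟨-, h⟩ j hj
    exact h _ (mem_union_right _ (mem_image_of_mem _ hj)) (l.adj_nbr (i, j))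
  · intro h
    refine ⟨l.adj_root i, fun y hy hadj => ?_⟩
    rcases mem_union.1 hy with hy | hy
    · refine disjoint_left.1 hd hy ?_
      rcases l.adj_nbr_iff.1 hadj with rfl | rfl | rfl
      · exact mem_union_left _ (mem_insert_self _ _)
      · exact l.child_mem_ball _
      · exact l.child_mem_ball _
    · obtain ⟨p, hp, rfl⟩ := mem_image.1 hy
      rcases l.adj_nbr_iff.1 hadj with h' | h' | h'
      · exact l.child_ne_root p h'
      · rw [l.child_injective h'] at hp; exact h 0 hp
      · rw [l.child_injective h'] at hp; exact h 1 hp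

theorem card_freeNbrs {J : Finset V} (hd : Disjoint J l.ball) (T : Finset Pos) :
    #(freeNbrs G v (J ∪ T.image l.child)) = freeCount T := by
  have : freeNbrs G v (J ∪ T.image l.child) =
      ({i | IsFreeAt T i} : Finset (Fin 3)).image l.nbr := by
    ext y
    constructor
    · intro hy
      have hy' : y ∈ nbhd G v := (mem_filter.1 hy).1
      rw [l.nbhd_root] at hy'
      obtain ⟨i, -, rfl⟩ := mem_image.1 hy'
      exact mem_image_of_mem _ (mem_filter.2 ⟨mem_univ _, (l.mem_freeNbrs_iff hd T i).1 hy⟩)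
    · intro hy
      obtain ⟨i, hi, rfl⟩ := mem_image.1 hy
      exact (l.mem_freeNbrs_iff hd T i).2 (mem_filter.1 hi).2
  rw [this, card_image_of_injective _ l.nbr_injective, freeCount]

theorem uncovChildren_eq {J : Finset V} {T : Finset Pos} (hT : T ⊆ l.unblocked J) (i : Fin 3) :
    uncovChildren G v (l.nbr i) (J ∪ T.image l.child) =
      uncovCount (l.unblocked J) (l.edge J) T i := by
  have key : ∀ p, (∀ y ∈ J ∪ T.image l.child, ¬ G.Adj (l.child p) y) ↔
      p ∈ l.unblocked J ∧ ∀ b ∈ T, ¬ l.edge J p b := by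
    intro p
    constructor
    · intro h
      have hp : p ∈ l.unblocked J :=
        mem_filter.2 ⟨mem_univ _, fun y hy => h y (mem_union_left _ hy)⟩
      exact ⟨hp, fun b hb hE => h _ (mem_union_right _ (mem_image_of_mem _ hb)) hE.1⟩
    · rintro ⟨h1, h2⟩ y hy hadj
      rcases mem_union.1 hy with hy | hy
      · exact (mem_filter.1 h1).2 y hy hadj
      · obtain ⟨b, hb, rfl⟩ := mem_image.1 hy
        exact h2 b hb ⟨hadj, h1, hT hb⟩
  have h01 : l.child (i, 0) ≠ l.child (i, 1) := fun h => by
    simpa using l.child_injective h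
  unfold uncovChildren uncovCount
  rw [l.nbhd_nbr]
  have : ({w ∈ ({l.child (i, 0), l.child (i, 1)} : Finset V) |
      ∀ y ∈ J ∪ T.image l.child, ¬ G.Adj w y}) =
      ({j | (i, j) ∈ l.unblocked J ∧ ∀ b ∈ T, ¬ l.edge J (i, j) b} : Finset (Fin 2)).image
        fun j => l.child (i, j) := by
    ext y
    simp only [mem_filter, mem_insert, mem_singleton, mem_image, mem_univ, true_and]
    constructor
    · rintro ⟨rfl | rfl, h⟩
      · exact ⟨0, (key _).1 h, rfl⟩
      · exact ⟨1, (key _).1 h, rfl⟩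
    · rintro ⟨j, hj, rfl⟩
      refine ⟨?_, (key _).2 hj⟩
      fin_cases j <;> simp
  rw [this, card_image_of_injective]
  intro j j' h
  simpa using l.child_injective h

/-- Summing out the ball of radius two. -/
theorem sum_vertexSlack (hG : IsCubicGirthFive G) (x : ℝ) :
    ∑ I ∈ indepSets G, x ^ #I * vertexSlack G x v I =
      ∑ J ∈ indepSets G with Disjoint J l.ball,
        x ^ #J * localSlack x (l.unblocked J) (l.edge J) := by
  -- The star is summed out first. The remaining sets avoid it and are regrouped by their part
  -- outside the ball, leaving a choice of children.
  rw [sum_indepSets_fiber (insert v (nbhd G v)),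
    sum_congr rfl fun J hJ => sum_vertexSlack_star hG x (mem_indepSets.1 (mem_filter.1 hJ).1)
      (mem_filter.1 hJ).2, sum_filter, sum_indepSets_fiber l.ball]
  refine sum_congr rfl fun J hJ => ?_
  obtain ⟨hJ, hd⟩ := mem_filter.1 hJ
  rw [mem_indepSets] at hJ
  have hd1 : Disjoint J (insert v (nbhd G v)) := hd.mono_right subset_union_left
  have hd2 : Disjoint J l.children := hd.mono_right subset_union_right
  rw [← sum_filter, filter_filter, localSlack, mul_sum]
  symm
  refine sum_bij (fun T _ => T.image l.child) ?_ ?_ ?_ ?_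
  · intro T hT
    have hT := (mem_filter.1 hT).2
    have hsub : T.image l.child ⊆ l.children := image_subset_image (subset_univ _)
    rw [mem_filter, mem_powerset]
    refine ⟨hsub.trans subset_union_right, (l.indep_union_image_iff hJ T).2 hT, ?_⟩
    exact disjoint_union_left.2 ⟨hd1, l.disjoint_children.mono_left hsub⟩
  · intro T _ T' _ h
    exact image_injective l.child_injective h
  · intro S hS
    rw [mem_filter, mem_powerset] at hS
    obtain ⟨hS, hi, hdis⟩ := hS
    have hsub : S ⊆ l.children := fun y hy => by
      rcases mem_union.1 (hS hy) with h | h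
      · exact absurd h (disjoint_left.1 hdis (mem_union_right _ hy))
      · exact h
    obtain ⟨T, -, rfl⟩ := subset_image_iff.1 hsub
    exact ⟨T, mem_filter.2 ⟨mem_univ _, (l.indep_union_image_iff hJ T).1 hi⟩, rfl⟩
  · intro T hT
    have hT := (mem_filter.1 hT).2
    have hsub : T.image l.child ⊆ l.children := image_subset_image (subset_univ _)
    rw [card_union_of_disjoint (hd2.mono_right hsub), card_image_of_injective _ l.child_injective,
      pow_add, mul_assoc]
    congr 2
    rw [sum_congr rfl (fun u hu => rfl), l.nbhd_root,
      sum_image fun a _ b _ h => l.nbr_injective h]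
    refine sum_congr rfl fun i _ => ?_
    rw [l.card_freeNbrs hd, l.uncovChildren_eq hT.1]
    congr 1
    exact decide_eq_decide.2 (l.mem_freeNbrs_iff hd T i).symm

end Labelling

/-- Each vertex is a neighbour of exactly three others. This is the identity that cancels the dual
variables in the total slack. -/
theorem sum_sum_nbhd (hG : IsCubicGirthFive G) (f : V → ℝ) :
    ∑ v, ∑ u ∈ nbhd G v, f u = 3 * ∑ v, f v := by
  simp only [nbhd, sum_filter]
  rw [sum_comm, mul_sum]
  refine sum_congr rfl fun u _ => ?_
  rw [← sum_filter, sum_const, nsmul_eq_mul]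
  have : (univ.filter fun v => G.Adj v u) = nbhd G u := by ext v; simp [G.adj_comm]
  rw [this, hG.card_nbhd]; norm_num

/-- The deficit of the expected size of an independent set is the sum of the vertex slacks. -/
theorem sum_sum_vertexSlack (hG : IsCubicGirthFive G) (x : ℝ) :
    ∑ v, ∑ I ∈ indepSets G, x ^ #I * vertexSlack G x v I =
      dualScale x * (Fintype.card V * occNum x * hardCore G x -
        heawoodPoly.eval x * ∑ I ∈ indepSets G, #I * x ^ #I) := by
  rw [sum_comm]
  have key : ∀ I : Finset V, ∑ v, vertexSlack G x v I =
      dualScale x * (Fintype.card V * occNum x) - dualScale x * heawoodPoly.eval x * #I := by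
    intro I
    simp only [vertexSlack, sum_add_distrib, sum_sub_distrib, ← mul_sum,
      sum_sum_nbhd hG fun u => dualVar x (uncov G u I)]
    simp
  simp only [← mul_sum, key, hardCore]
  rw [mul_sum, mul_sum, ← sum_sub_distrib, mul_sum]
  exact sum_congr rfl fun I _ => by ring

end GirthSlices

/-! ### Occupancy bound, its strict form, and integration in x -/

namespace GirthSlices

open Finset
open scoped Classical

universe u

variable {V : Type u} [Fintype V] {G : SimpleGraph V} {v : V}

namespace Labelling

variable (l : Labelling G v)

/-- The ball of radius three is that of the Heawood graph. -/
def Good : Prop := (∀ p q, ¬ G.Adj (l.child p) (l.child q)) ∧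
  ∀ z ∉ l.ball, ∀ p, G.Adj z (l.child p) → ∀ y, G.Adj z y → y ∈ l.children

theorem card_ball_le (hG : IsCubicGirthFive G) : #l.ball ≤ 10 := by
  have h1 : #l.children ≤ 6 := card_image_le.trans (by simp [Pos])
  have h2 : #(insert v (nbhd G v)) ≤ 4 := (card_insert_le _ _).trans (by rw [hG.card_nbhd])
  exact (card_union_le _ _).trans (by omega)

/-- The ball of radius two together with all neighbours of the second neighbours. -/
noncomputable def outerBall : Finset V := l.ball ∪ l.children.biUnion (nbhd G)

theorem card_outerBall_le (hG : IsCubicGirthFive G) : #l.outerBall ≤ 28 := by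
  have h1 : #l.children ≤ 6 := card_image_le.trans (by simp [Pos])
  have h2 : #(l.children.biUnion (nbhd G)) ≤ #l.children * 3 :=
    card_biUnion_le_card_mul _ _ _ fun w _ => (hG.card_nbhd w).le
  have := l.card_ball_le hG
  exact (card_union_le _ _).trans (by omega)

theorem sum_vertexSlack_nonneg (l : Labelling G v) (hG : IsCubicGirthFive G) {x : ℝ} (hx : 0 ≤ x) :
    0 ≤ ∑ I ∈ indepSets G, x ^ #I * vertexSlack G x v I := by
  rw [l.sum_vertexSlack hG]
  exact sum_nonneg fun J _ => mul_nonneg (by positivity) ((l.isConfig hG J).localSlack_ge hx).1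

theorem not_adj_of_disjoint_outerBall {J : Finset V} (hJ : Disjoint J l.outerBall) (p : Pos) :
    ∀ y ∈ J, ¬ G.Adj (l.child p) y := fun _ hy h =>
  disjoint_left.1 hJ hy (mem_union_right _
    (mem_biUnion.2 ⟨_, l.child_mem_children p, mem_nbhd.2 h⟩))

/-- Sets avoiding X carry at least a (1 + x)^(-32) share of the partition function, and φ sends them
injectively to boundary conditions with slack at least x^9. Adding c ≤ 1 vertices costs at most one
more factor x, as x ≤ 1. -/
theorem gap_of_embedding (hG : IsCubicGirthFive G) {x : ℝ} (hx0 : 0 ≤ x) (hx1 : x ≤ 1)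
    (X : Finset V) (hX : #X ≤ 32) (φ : Finset V → Finset V) (c : ℕ) (hc : c ≤ 1)
    (hφ : ∀ J, Indep G J → Disjoint J X → Indep G (φ J) ∧ Disjoint (φ J) l.ball ∧
      #(φ J) = #J + c ∧ x ^ 9 ≤ localSlack x (l.unblocked (φ J)) (l.edge (φ J)))
    (hinj : Set.InjOn φ {J | Disjoint J X}) :
    x ^ 10 * hardCore G x ≤
      (1 + x) ^ 32 * ∑ I ∈ indepSets G, x ^ #I * vertexSlack G x v I := by
  rw [l.sum_vertexSlack hG]
  have h1 : ∑ J ∈ indepSets G with Disjoint J X, x ^ (#J + 10) ≤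
      ∑ J ∈ indepSets G with Disjoint J l.ball,
        x ^ #J * localSlack x (l.unblocked J) (l.edge J) := by
    calc _ ≤ ∑ J ∈ indepSets G with Disjoint J X,
          x ^ #(φ J) * localSlack x (l.unblocked (φ J)) (l.edge (φ J)) := by
          refine sum_le_sum fun J hJ => ?_
          obtain ⟨hJ, hd⟩ := mem_filter.1 hJ
          obtain ⟨-, -, h3, h4⟩ := hφ J (mem_indepSets.1 hJ) hd
          calc x ^ (#J + 10) ≤ x ^ (#(φ J) + 9) := pow_le_pow_of_le_one hx0 hx1 (by omega)
            _ = x ^ #(φ J) * x ^ 9 := pow_add _ _ _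
            _ ≤ _ := by gcongr
      _ = ∑ J ∈ ((indepSets G).filter fun J => Disjoint J X).image φ,
          x ^ #J * localSlack x (l.unblocked J) (l.edge J) := by
          rw [sum_image]
          intro J hJ J' hJ' h
          exact hinj (mem_filter.1 hJ).2 (mem_filter.1 hJ').2 h
      _ ≤ _ := by
          refine sum_le_sum_of_subset_of_nonneg ?_ fun J _ _ =>
            mul_nonneg (by positivity) ((l.isConfig hG J).localSlack_ge hx0).1
          intro J hJ
          obtain ⟨K, hK, rfl⟩ := mem_image.1 hJ
          obtain ⟨hK, hd⟩ := mem_filter.1 hK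
          obtain ⟨h1, h2, -, -⟩ := hφ K (mem_indepSets.1 hK) hd
          exact mem_filter.2 ⟨mem_indepSets.2 h1, h2⟩
  calc x ^ 10 * hardCore G x
      ≤ x ^ 10 * ((1 + x) ^ #X * ∑ J ∈ indepSets G with Disjoint J X, x ^ #J) := by
        gcongr; exact hardCore_le_mul X hx0
    _ ≤ x ^ 10 * ((1 + x) ^ 32 * ∑ J ∈ indepSets G with Disjoint J X, x ^ #J) := by
        have : (1 + x) ^ #X ≤ (1 + x) ^ 32 := pow_le_pow_right₀ (by linarith) hX
        have h2 : 0 ≤ ∑ J ∈ indepSets G with Disjoint J X, x ^ #J :=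
          sum_nonneg fun _ _ => by positivity
        gcongr
    _ = (1 + x) ^ 32 * ∑ J ∈ indepSets G with Disjoint J X, x ^ (#J + 10) := by
        rw [mul_left_comm, mul_sum]
        exact congrArg _ (sum_congr rfl fun J _ => by rw [pow_add, mul_comm])
    _ ≤ _ := by gcongr

/-- A vertex whose ball is not that of the Heawood graph has large expected slack. -/
theorem gap_of_not_good (hG : IsCubicGirthFive G) (hl : ¬ l.Good) {x : ℝ} (hx0 : 0 ≤ x)
    (hx1 : x ≤ 1) : x ^ 10 * hardCore G x ≤
      (1 + x) ^ 32 * ∑ I ∈ indepSets G, x ^ #I * vertexSlack G x v I := by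
  by_cases hE : ∃ p q, G.Adj (l.child p) (l.child q)
  -- If J avoids the outer ball, nothing is blocked and the edge between children is present in the
  -- configuration.
  · obtain ⟨p, q, hpq⟩ := hE
    refine l.gap_of_embedding hG hx0 hx1 l.outerBall
      ((l.card_outerBall_le hG).trans (by norm_num)) id 0 (by norm_num) ?_ (fun _ _ _ _ h => h)
    intro J hJ hd
    have hu : l.unblocked J = univ := filter_eq_self.2 fun p _ =>
      l.not_adj_of_disjoint_outerBall hd p
    refine ⟨hJ, hd.mono_right subset_union_left, rfl, ?_⟩
    refine ((l.isConfig hG J).localSlack_ge hx0).2 ?_ (Or.inr ⟨p, q, hpq, ?_, ?_⟩)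
    · rw [hu]; simp [Pos]
    · rw [hu]; exact mem_univ _
    · rw [hu]; exact mem_univ _
  · push Not at hE
    have : ∃ z ∉ l.ball, ∃ p, G.Adj z (l.child p) ∧ ∃ y, G.Adj z y ∧ y ∉ l.children := by
      by_contra! h
      exact hl ⟨hE, fun z hz p hp y hy => h z hz p hp y hy⟩
    obtain ⟨z, hz, p, hp, y, hy, hyc⟩ := this
    have hz0 : ∀ q, q ∈ l.unblocked {z} ↔ ¬ G.Adj (l.child q) z := by
      intro q; simp [unblocked]
    -- Occupying z blocks at least one child and, since its neighbour y is not a child, at most two.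
    -- At least four but not all positions stay unblocked.
    refine l.gap_of_embedding hG hx0 hx1 (l.outerBall ∪ insert z (nbhd G z)) ?_ (insert z) 1 le_rfl
      ?_ ?_
    · have h1 := l.card_outerBall_le hG
      have h2 : #(insert z (nbhd G z)) ≤ 4 := (card_insert_le _ _).trans (by rw [hG.card_nbhd])
      exact (card_union_le _ _).trans (by omega)
    · intro J hJ hd
      have hd1 : Disjoint J l.outerBall := hd.mono_right subset_union_left
      have hd2 : Disjoint J (insert z (nbhd G z)) := hd.mono_right subset_union_right
      have hzJ : z ∉ J := fun h => disjoint_left.1 hd2 h (mem_insert_self _ _)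
      have hzn : ∀ b ∈ J, ¬ G.Adj z b := fun b hb h =>
        disjoint_left.1 hd2 hb (mem_insert_of_mem (mem_nbhd.2 h))
      have hu : ∀ q, q ∈ l.unblocked (insert z J) ↔ ¬ G.Adj (l.child q) z := by
        intro q
        simp only [unblocked, mem_filter, mem_univ, true_and, mem_insert, forall_eq_or_imp]
        exact ⟨fun h => h.1, fun h => ⟨h, l.not_adj_of_disjoint_outerBall hd1 q⟩⟩
      refine ⟨?_, ?_, card_insert_of_notMem hzJ, ?_⟩
      · intro a ha b hb hab
        rcases mem_insert.1 ha with ha' | ha' <;> rcases mem_insert.1 hb with hb' | hb'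
        · rw [ha', hb'] at hab; exact G.irrefl hab
        · rw [ha'] at hab; exact hzn b hb' hab
        · rw [hb'] at hab; exact hzn a ha' hab.symm
        · exact hJ a ha' b hb' hab
      · exact disjoint_insert_left.2 ⟨hz, hd1.mono_right subset_union_left⟩
      · refine ((l.isConfig hG _).localSlack_ge hx0).2 ?_ (Or.inl ?_)
        · have h1 : #((l.unblocked (insert z J))ᶜ.image l.child) ≤ #((nbhd G z).erase y) := by
            refine card_le_card fun w hw => ?_
            obtain ⟨q, hq, rfl⟩ := mem_image.1 hw
            rw [mem_compl, hu, not_not] at hq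
            refine mem_erase.2 ⟨?_, mem_nbhd.2 hq.symm⟩
            rintro rfl
            exact hyc (l.child_mem_children q)
          rw [card_image_of_injective _ l.child_injective, card_compl,
            card_erase_of_mem (mem_nbhd.2 hy), hG.card_nbhd] at h1
          have h2 : Fintype.card Pos = 6 := by simp [Pos]
          omega
        · intro h
          have : p ∈ l.unblocked (insert z J) := by rw [h]; exact mem_univ _
          exact (hu p).1 this hp.symm
    · intro J hJ J' hJ' h
      have hzJ : ∀ K : Finset V, Disjoint K (l.outerBall ∪ insert z (nbhd G z)) → z ∉ K :=
        fun K hK hzK => disjoint_left.1 hK hzK (mem_union_right _ (mem_insert_self _ _))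
      rw [← erase_insert (hzJ J hJ), ← erase_insert (hzJ J' hJ')]
      exact congrArg (fun K => K.erase z) h

end Labelling

theorem dualScale_pos {x : ℝ} (hx : 0 ≤ x) : 0 < dualScale x := by
  unfold dualScale; positivity

theorem dualScale_mono {x y : ℝ} (hx : 0 ≤ x) (hxy : x ≤ y) : dualScale x ≤ dualScale y := by
  unfold dualScale; gcongr

theorem hardCore_pos {x : ℝ} (hx : 0 ≤ x) : 0 < hardCore G x := by
  refine sum_pos' (fun _ _ => by positivity) ⟨∅, ?_, by simp⟩
  rw [mem_indepSets]; intro a ha; simp at ha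

/-- All expected vertex slacks are nonnegative, and in their sum the dual variables cancel. -/
theorem occupancy_le (hG : IsCubicGirthFive G) {x : ℝ} (hx : 0 ≤ x) :
    heawoodPoly.eval x * ∑ I ∈ indepSets G, #I * x ^ #I ≤
      Fintype.card V * occNum x * hardCore G x := by
  have h := sum_sum_vertexSlack hG x
  have h0 : 0 ≤ ∑ v, ∑ I ∈ indepSets G, x ^ #I * vertexSlack G x v I :=
    sum_nonneg fun v _ => (exists_labelling hG v).some.sum_vertexSlack_nonneg hG hx
  rw [h] at h0
  have := nonneg_of_mul_nonneg_right h0 (dualScale_pos hx)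
  linarith

theorem occupancy_gap (hG : IsCubicGirthFive G) (hbad : ∀ v, ∀ l : Labelling G v, ¬ l.Good)
    {x : ℝ} (hx0 : 0 ≤ x) (hx1 : x ≤ 1) :
    Fintype.card V * (x ^ 10 * hardCore G x) ≤ (1 + x) ^ 32 * (dualScale x *
      (Fintype.card V * occNum x * hardCore G x -
        heawoodPoly.eval x * ∑ I ∈ indepSets G, #I * x ^ #I)) := by
  rw [← sum_sum_vertexSlack hG x, mul_sum]
  calc (Fintype.card V : ℝ) * (x ^ 10 * hardCore G x) = ∑ _v : V, x ^ 10 * hardCore G x := by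
        simp
    _ ≤ _ := sum_le_sum fun v _ => by
        have l := (exists_labelling hG v).some
        exact l.gap_of_not_good hG (hbad v l) hx0 hx1

theorem hasDerivAt_hardCore {x : ℝ} : HasDerivAt (hardCore G)
    (∑ I ∈ indepSets G, #I * x ^ (#I - 1)) x := by
  unfold hardCore
  refine HasDerivAt.fun_sum fun I _ => ?_
  exact hasDerivAt_pow _ _

/-- Identifies `occNum` divided by P as the occupancy fraction x P' / (14 P) of the Heawood graph.
-/
theorem mul_deriv_heawoodPoly (x : ℝ) :
    x * (Polynomial.derivative heawoodPoly).eval x = 14 * occNum x := by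
  simp [heawoodPoly, occNum, Polynomial.derivative_pow]
  ring

/-- The logarithmic comparison function. -/
noncomputable def logDeficit (G : SimpleGraph V) (x : ℝ) : ℝ :=
  Fintype.card V * Real.log (heawoodPoly.eval x) - 14 * Real.log (hardCore G x)

theorem hasDerivAt_logDeficit {x : ℝ} (hx : 0 ≤ x) : HasDerivAt (logDeficit G)
    (Fintype.card V * ((Polynomial.derivative heawoodPoly).eval x / heawoodPoly.eval x) -
      14 * ((∑ I ∈ indepSets G, #I * x ^ (#I - 1)) / hardCore G x)) x := by
  refine HasDerivAt.sub (HasDerivAt.const_mul _ ?_) (HasDerivAt.const_mul _ ?_)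
  · exact (heawoodPoly.hasDerivAt x).log (eval_heawoodPoly_pos hx).ne'
  · exact hasDerivAt_hardCore.log (hardCore_pos hx).ne'

theorem mul_deriv_logDeficit {x : ℝ} (hx : 0 < x) : x * deriv (logDeficit G) x =
    14 * ((Fintype.card V * occNum x * hardCore G x -
        heawoodPoly.eval x * ∑ I ∈ indepSets G, #I * x ^ #I) /
        (heawoodPoly.eval x * hardCore G x)) := by
  rw [(hasDerivAt_logDeficit hx.le).deriv]
  have h1 := eval_heawoodPoly_pos hx.le
  have h2 : 0 < hardCore G x := hardCore_pos hx.le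
  have h3 : x * ∑ I ∈ indepSets G, (#I : ℝ) * x ^ (#I - 1) =
      ∑ I ∈ indepSets G, #I * x ^ #I := by
    rw [mul_sum]
    refine sum_congr rfl fun I _ => ?_
    rcases Nat.eq_zero_or_pos #I with h | h
    · simp [h]
    · obtain ⟨k, hk⟩ : ∃ k, #I = k + 1 := ⟨#I - 1, by omega⟩
      rw [hk, pow_succ, Nat.add_sub_cancel]; ring
  rw [← h3]
  have h4 := mul_deriv_heawoodPoly x
  have e : occNum x = x * (Polynomial.derivative heawoodPoly).eval x / 14 := by linarith
  rw [e]
  field_simp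

/-- The derivative is, up to a positive factor, the deficit in the occupancy bound. -/
theorem monotoneOn_logDeficit (hG : IsCubicGirthFive G) :
    MonotoneOn (logDeficit G) (Set.Ici 0) := by
  refine monotoneOn_of_deriv_nonneg (convex_Ici 0) ?_ ?_ ?_
  · exact fun x hx => (hasDerivAt_logDeficit hx).continuousAt.continuousWithinAt
  · intro x hx
    rw [interior_Ici] at hx
    exact (hasDerivAt_logDeficit (le_of_lt hx)).differentiableAt.differentiableWithinAt
  · intro x hx
    rw [interior_Ici] at hx
    have hx : 0 < x := hx
    have h := mul_deriv_logDeficit (G := G) hx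
    have h1 := eval_heawoodPoly_pos hx.le
    have h2 : 0 < hardCore G x := hardCore_pos hx.le
    have h3 := occupancy_le hG hx.le
    refine nonneg_of_mul_nonneg_right (h ▸ ?_) hx
    have : 0 ≤ Fintype.card V * occNum x * hardCore G x -
        heawoodPoly.eval x * ∑ I ∈ indepSets G, #I * x ^ #I := by linarith
    positivity

theorem logDeficit_zero : logDeficit G 0 = 0 := by
  have h1 : heawoodPoly.eval 0 = 1 := by rw [eval_heawoodPoly]; norm_num
  have h2 : hardCore G 0 = 1 := by
    unfold hardCore
    rw [sum_eq_single ∅]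
    · simp
    · intro I _ hI
      rw [zero_pow (card_ne_zero.2 (nonempty_iff_ne_empty.2 hI))]
    · intro h
      exact absurd (mem_indepSets.2 fun a ha => by simp at ha) h
  simp [logDeficit, h1, h2]

/-- Graphs without Heawood components have exponentially smaller partition functions. -/
theorem exists_gap (ε : ℝ) (hε : 0 < ε) (hε1 : ε ≤ 1) : ∃ γ : ℝ, 0 < γ ∧
    ∀ (V : Type u) [Fintype V] (G : SimpleGraph V), IsCubicGirthFive G →
      (∀ v, ∀ l : Labelling G v, ¬ l.Good) → ∀ r : ℕ, Fintype.card V = 14 * r → ∀ x ≥ ε,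
        hardCore G x ≤ heawoodPoly.eval x ^ r * Real.exp (-(γ * r)) := by
  -- The smallest derivative per vertex on [ε/2, ε] guaranteed by the gap: numerator at the left
  -- endpoint, denominator at the right. One of the ten powers of x is lost to the logarithmic
  -- derivative.
  set δ : ℝ := 14 * (ε / 2) ^ 9 / ((1 + ε) ^ 32 * (dualScale ε * heawoodPoly.eval ε)) with hδ
  have hR := dualScale_pos hε.le
  have hQ := eval_heawoodPoly_pos hε.le
  have hδ0 : 0 < δ := by positivity
  refine ⟨δ * (ε / 2), by positivity, ?_⟩
  intro V _ G hG hbad r hr x hx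
  have hx0 : 0 < x := hε.trans_le hx
  have hder : ∀ y ∈ interior (Set.Icc (ε / 2) ε), Fintype.card V * δ ≤ deriv (logDeficit G) y := by
    intro y hy
    rw [interior_Icc] at hy
    obtain ⟨hy1, hy2⟩ := hy
    have hy0 : 0 < y := by linarith
    have h := mul_deriv_logDeficit (G := G) hy0
    have h1 := eval_heawoodPoly_pos hy0.le
    have h2 : 0 < hardCore G y := hardCore_pos hy0.le
    have h3 := occupancy_gap hG hbad hy0.le (hy2.le.trans hε1)
    have h4 := dualScale_pos hy0.le
    set D := Fintype.card V * occNum y * hardCore G y -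
        heawoodPoly.eval y * ∑ I ∈ indepSets G, #I * y ^ #I
    have h5 : deriv (logDeficit G) y = 14 * D / (y * (heawoodPoly.eval y * hardCore G y)) := by
      field_simp at h ⊢; linarith
    have h6 : Fintype.card V * y ^ 10 * hardCore G y / ((1 + y) ^ 32 * dualScale y) ≤ D := by
      rw [div_le_iff₀ (by positivity)]; linarith
    have h7 : δ ≤ 14 * y ^ 9 / ((1 + y) ^ 32 * (dualScale y * heawoodPoly.eval y)) := by
      rw [hδ]
      have a1 := dualScale_mono hy0.le hy2.le
      have a2 := eval_heawoodPoly_mono hy0.le hy2.le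
      gcongr
    calc (Fintype.card V : ℝ) * δ
        ≤ Fintype.card V * (14 * y ^ 9 / ((1 + y) ^ 32 * (dualScale y * heawoodPoly.eval y))) := by
          gcongr
      _ = 14 * (Fintype.card V * y ^ 10 * hardCore G y / ((1 + y) ^ 32 * dualScale y)) /
          (y * (heawoodPoly.eval y * hardCore G y)) := by
          field_simp
      _ ≤ 14 * D / (y * (heawoodPoly.eval y * hardCore G y)) := by gcongr
      _ = _ := h5.symm
  -- The gain is collected on [ε/2, ε] only; monotonicity preserves it for every larger x, so γ does
  -- not depend on x.
  have hgain := Convex.mul_sub_le_image_sub_of_le_deriv (convex_Icc (ε / 2) ε)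
    (fun y hy => (hasDerivAt_logDeficit (by linarith [hy.1])).continuousAt.continuousWithinAt)
    (fun y hy => by
      rw [interior_Icc] at hy
      exact (hasDerivAt_logDeficit (by linarith [hy.1])).differentiableAt.differentiableWithinAt)
    hder (ε / 2) (by constructor <;> linarith) ε (by constructor <;> linarith) (by linarith)
  have hmono := monotoneOn_logDeficit hG
  have m1 : logDeficit G 0 ≤ logDeficit G (ε / 2) :=
    hmono (Set.mem_Ici.2 le_rfl) (Set.mem_Ici.2 (by linarith)) (by linarith)
  have m2 : logDeficit G ε ≤ logDeficit G x := hmono hε.le hx0.le hx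
  rw [logDeficit_zero] at m1
  have hfin : (Fintype.card V : ℝ) * δ * (ε / 2) ≤ logDeficit G x := by
    have : ε - ε / 2 = ε / 2 := by ring
    rw [this] at hgain
    linarith
  rw [logDeficit, hr] at hfin
  push_cast at hfin
  have hQx := eval_heawoodPoly_pos hx0.le
  have hlog : Real.log (hardCore G x) ≤ r * Real.log (heawoodPoly.eval x) - δ * (ε / 2) * r := by
    nlinarith
  rw [← Real.exp_log (hardCore_pos (G := G) hx0.le)]
  calc _ ≤ Real.exp (r * Real.log (heawoodPoly.eval x) - δ * (ε / 2) * r) :=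
        Real.exp_le_exp.2 hlog
    _ = _ := by
        rw [sub_eq_add_neg, Real.exp_add, Real.exp_nat_mul, Real.exp_log hQx]

end GirthSlices

/-! ### Independence polynomials and disjoint unions -/

namespace GirthSlices

open Finset Polynomial
open scoped Classical

universe u w

variable {V : Type u} [Fintype V] {W : Type w} [Fintype W]

/-- The independence polynomial. -/
noncomputable def indepPoly (G : SimpleGraph V) : ℝ[X] := ∑ I ∈ indepSets G, X ^ #I

theorem eval_indepPoly (G : SimpleGraph V) (x : ℝ) : (indepPoly G).eval x = hardCore G x := by
  simp [indepPoly, hardCore, eval_finsetSum]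

theorem coeff_indepPoly (G : SimpleGraph V) (k : ℕ) :
    (indepPoly G).coeff k = indepCount G k := by
  have h : {s : Finset V | G.IsNIndepSet k s} =
      ((indepSets G).filter fun I => k = #I : Finset (Finset V)) := by
    ext s
    simp only [Set.mem_ofPred_eq, coe_filter, mem_indepSets, SimpleGraph.isNIndepSet_iff,
      SimpleGraph.isIndepSet_iff]
    refine and_congr ⟨fun h a ha b hb hab => h ha hb hab.ne hab, fun h a ha b hb _ => h a ha b hb⟩
      eq_comm
  rw [indepCount, h, Set.ncard_coe_finset, indepPoly, finsetSum_coeff]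
  simp [coeff_X_pow]

theorem coeff_indepPoly_nonneg (G : SimpleGraph V) (k : ℕ) : 0 ≤ (indepPoly G).coeff k := by
  rw [coeff_indepPoly]; positivity

theorem indepPoly_congr {G : SimpleGraph V} {H : SimpleGraph W} (e : G ≃g H) :
    indepPoly G = indepPoly H := by
  refine sum_bij' (fun I _ => I.map e.toEquiv.toEmbedding)
    (fun I _ => I.map e.symm.toEquiv.toEmbedding) ?_ ?_ ?_ ?_ ?_
  · intro I hI
    rw [mem_indepSets] at hI ⊢
    intro a ha b hb
    obtain ⟨a, ha', rfl⟩ := mem_map.1 ha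
    obtain ⟨b, hb', rfl⟩ := mem_map.1 hb
    exact fun h => hI a ha' b hb' (e.map_adj_iff.1 h)
  · intro I hI
    rw [mem_indepSets] at hI ⊢
    intro a ha b hb
    obtain ⟨a, ha', rfl⟩ := mem_map.1 ha
    obtain ⟨b, hb', rfl⟩ := mem_map.1 hb
    exact fun h => hI a ha' b hb' (e.symm.map_adj_iff.1 h)
  · intro I _
    rw [Finset.map_map]
    convert map_refl
    ext y; simp
  · intro I _
    rw [Finset.map_map]
    convert map_refl
    ext y; simp
  · intro I _
    simp

theorem indepPoly_sum (G : SimpleGraph V) (H : SimpleGraph W) :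
    indepPoly (G ⊕g H) = indepPoly G * indepPoly H := by
  rw [indepPoly, indepPoly, indepPoly, sum_mul_sum, ← sum_product']
  refine (sum_bij' (fun p _ => p.1.disjSum p.2) (fun I _ => (I.toLeft, I.toRight))
    ?_ ?_ ?_ ?_ ?_).symm
  · rintro ⟨I, J⟩ h
    rw [mem_product, mem_indepSets, mem_indepSets] at h
    rw [mem_indepSets]
    intro a ha b hb
    rcases a with a | a <;> rcases b with b | b
    · simpa using h.1 a (by simpa using ha) b (by simpa using hb)
    · simp
    · simp
    · simpa using h.2 a (by simpa using ha) b (by simpa using hb)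
  · intro I h
    rw [mem_indepSets] at h
    rw [mem_product, mem_indepSets, mem_indepSets]
    constructor
    · intro a ha b hb
      simpa using h _ (mem_toLeft.1 ha) _ (mem_toLeft.1 hb)
    · intro a ha b hb
      simpa using h _ (mem_toRight.1 ha) _ (mem_toRight.1 hb)
  · simp
  · intro I _
    exact toLeft_disjSum_toRight
  · simp [pow_add]

theorem indepPoly_of_isEmpty [IsEmpty V] (G : SimpleGraph V) : indepPoly G = 1 := by
  have : indepSets G = {∅} := by
    ext I
    simp [Subsingleton.elim I ∅, Indep]
  simp [indepPoly, this]

/-- Splitting off one copy. -/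
def disjointCopiesSuccIso (m : ℕ) (G : SimpleGraph V) :
    disjointCopies (m + 1) G ≃g G ⊕g disjointCopies m G where
  toFun p := Fin.cases (Sum.inl p.2) (fun i => Sum.inr (i, p.2)) p.1
  invFun := Sum.elim (fun a => (0, a)) fun q => (q.1.succ, q.2)
  left_inv := by
    rintro ⟨i, a⟩
    refine Fin.cases ?_ (fun i => ?_) i <;> simp
  right_inv := by rintro (a | ⟨i, a⟩) <;> simp
  map_rel_iff' := by
    rintro ⟨i, a⟩ ⟨j, b⟩
    refine Fin.cases ?_ (fun i => ?_) i <;> refine Fin.cases ?_ (fun j => ?_) j <;>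
      simp [disjointCopies, Fin.succ_ne_zero, (Fin.succ_ne_zero _).symm]

theorem indepPoly_disjointCopies (m : ℕ) (G : SimpleGraph V) :
    indepPoly (disjointCopies m G) = indepPoly G ^ m := by
  induction m with
  | zero => rw [pow_zero, indepPoly_of_isEmpty]
  | succ m ih => rw [indepPoly_congr (disjointCopiesSuccIso m G), indepPoly_sum, ih, pow_succ']

/-- The neighbours of a vertex of the Heawood graph. -/
def heawoodNbr (i : Fin 14) : Finset (Fin 14) :=
  if i.val % 2 = 0 then {i + 1, i + 13, i + 5} else {i + 1, i + 13, i + 9}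

/-- One side of the bipartition of the Heawood graph. -/
def evenPart : Finset (Fin 14) := {0, 2, 4, 6, 8, 10, 12}

end GirthSlices

/-! ### The independence polynomial of the Heawood graph -/

namespace GirthSlices

open Finset

theorem heawood_adj_iff (i j : Fin 14) : heawood.Adj i j ↔ j ∈ heawoodNbr i := by
  rw [heawood, SimpleGraph.fromRel_adj]
  revert i j
  simp only [heawoodNbr]
  decide +kernel

theorem card_heawoodNbr : ∀ i, #(heawoodNbr i) = 3 := by decide +kernel

/-- The joint distribution of the size of an even set and its number of odd non-neighbours. -/
theorem evenPart_powerset_map :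
    evenPart.powerset.val.map (fun J => (#J, #(evenPartᶜ \ J.biUnion heawoodNbr))) =
      {(0, 7)} + .replicate 7 (1, 4) + .replicate 21 (2, 2) + .replicate 7 (3, 0) +
        .replicate 28 (3, 1) + .replicate 28 (4, 0) + .replicate 7 (4, 1) +
        .replicate 21 (5, 0) + .replicate 7 (6, 0) + {(7, 0)} := by
  decide +kernel

theorem heawoodNbr_disjoint_of_mem : ∀ i ∈ evenPart, Disjoint (heawoodNbr i) evenPart := by
  decide +kernel

theorem heawoodNbr_subset_of_not_mem : ∀ i ∉ evenPart, heawoodNbr i ⊆ evenPart := by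
  decide +kernel

theorem sum_evenPart_powerset (x : ℝ) :
    ∑ J ∈ evenPart.powerset, x ^ #J * (1 + x) ^ #(evenPartᶜ \ J.biUnion heawoodNbr) =
      heawoodPoly.eval x := by
  have h := congrArg (fun s => (s.map fun p : ℕ × ℕ => x ^ p.1 * (1 + x) ^ p.2).sum)
    evenPart_powerset_map
  simp only [Multiset.map_map, Function.comp_def] at h
  rw [Finset.sum, h, eval_heawoodPoly]
  simp only [Multiset.map_add, Multiset.map_replicate, Multiset.map_singleton, Multiset.sum_add,
    Multiset.sum_replicate, Multiset.sum_singleton, nsmul_eq_mul]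
  push_cast
  ring

end GirthSlices

namespace GirthSlices

open Finset Polynomial
open scoped Classical

section Bipartite

variable {V : Type*} [Fintype V] {G : SimpleGraph V} {E : Finset V} {N : V → Finset V}

theorem indep_union_iff_of_bipartite (hadj : ∀ i j, G.Adj i j ↔ j ∈ N i)
    (hE : ∀ i ∈ E, Disjoint (N i) E) (hE' : ∀ i ∉ E, N i ⊆ E) {J S : Finset V}
    (hJ : J ⊆ E) (hS : S ⊆ Eᶜ) : Indep G (J ∪ S) ↔ S ⊆ Eᶜ \ J.biUnion N := by
  have hS' : ∀ a ∈ S, a ∉ E := fun a ha => mem_compl.1 (hS ha)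
  rw [indep_union_iff]
  constructor
  · rintro ⟨-, -, h⟩ a ha
    refine mem_sdiff.2 ⟨hS ha, fun hb => ?_⟩
    obtain ⟨b, hb, hab⟩ := mem_biUnion.1 hb
    exact h a ha b hb ((hadj b a).2 hab).symm
  · intro h
    refine ⟨fun a ha b hb hab => ?_, fun a ha b hb hab => ?_, fun a ha b hb hab => ?_⟩
    · exact disjoint_left.1 (hE a (hJ ha)) ((hadj a b).1 hab) (hJ hb)
    · exact hS' b hb (hE' a (hS' a ha) ((hadj a b).1 hab))
    · exact (mem_sdiff.1 (h ha)).2 (mem_biUnion.2 ⟨b, hb, (hadj b a).1 hab.symm⟩)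

/-- The partition function of a bipartite graph as a sum over the subsets of one side. -/
theorem hardCore_of_bipartite (hadj : ∀ i j, G.Adj i j ↔ j ∈ N i)
    (hE : ∀ i ∈ E, Disjoint (N i) E) (hE' : ∀ i ∉ E, N i ⊆ E) (x : ℝ) :
    hardCore G x = ∑ J ∈ E.powerset, x ^ #J * (1 + x) ^ #(Eᶜ \ J.biUnion N) := by
  have key := @indep_union_iff_of_bipartite V _ G E N hadj hE hE'
  rw [hardCore, sum_indepSets_fiber Eᶜ]
  have hset : (indepSets G).filter (fun J => Disjoint J Eᶜ) = E.powerset := by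
    ext J
    rw [mem_filter, mem_indepSets, mem_powerset, disjoint_compl_right_iff]
    refine ⟨fun h => h.2, fun h => ⟨?_, h⟩⟩
    simpa using (key h (empty_subset _)).2 (empty_subset _)
  rw [hset]
  refine sum_congr rfl fun J hJ => ?_
  rw [mem_powerset] at hJ
  have hfil : (Eᶜ.powerset.filter fun S => Indep G (J ∪ S)) = (Eᶜ \ J.biUnion N).powerset := by
    ext S
    rw [mem_filter, mem_powerset, mem_powerset]
    exact ⟨fun h => (key hJ h.1).1 h.2, fun h =>
      ⟨h.trans sdiff_subset, (key hJ (h.trans sdiff_subset)).2 h⟩⟩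
  rw [hfil, ← sum_powerset_pow, mul_sum]
  refine sum_congr rfl fun S hS => ?_
  rw [mem_powerset] at hS
  rw [card_union_of_disjoint, pow_add]
  exact (disjoint_compl_right.mono_left hJ).mono_right (hS.trans sdiff_subset)

end Bipartite

/-- Bipartiteness reduces the count to the 2^7 subsets of the even side, tabulated by their size and
their number of odd non-neighbours. -/
theorem indepPoly_heawood : indepPoly heawood = heawoodPoly := by
  refine Polynomial.funext fun x => ?_
  rw [eval_indepPoly, ← sum_evenPart_powerset, hardCore_of_bipartite heawood_adj_iff
    heawoodNbr_disjoint_of_mem heawoodNbr_subset_of_not_mem]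
  congr!

end GirthSlices

/-! ### Heawood-like surroundings determine a Heawood component -/

namespace GirthSlices

open Finset
open scoped Classical

universe u

variable {V : Type u} [Fintype V] {G : SimpleGraph V} {v : V}

namespace Labelling

variable (l : Labelling G v)

/-- A vertex at distance three from the root. -/
def Outer (z : V) : Prop := z ∉ l.ball ∧ ∃ p, G.Adj z (l.child p)

variable {l}

theorem Outer.ne_nbr {z : V} (hz : l.Outer z) (i : Fin 3) : z ≠ l.nbr i := fun h =>
  hz.1 (mem_union_left _ (mem_insert_of_mem (mem_nbhd.2 (h ▸ l.adj_root i))))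

theorem Outer.ne_child {z : V} (hz : l.Outer z) (p : Pos) : z ≠ l.child p := fun h =>
  hz.1 (h ▸ l.child_mem_ball p)

theorem Outer.ne_root {z : V} (hz : l.Outer z) : z ≠ v := fun h =>
  hz.1 (mem_union_left _ (h ▸ mem_insert_self _ _))

theorem Outer.eq_of_adj {z : V} (hz : l.Outer z) (hG : IsCubicGirthFive G) {i : Fin 3}
    {j j' : Fin 2} (h : G.Adj z (l.child (i, j))) (h' : G.Adj z (l.child (i, j'))) : j = j' := by
  rcases hG.no_square h (l.adj_nbr (i, j)) h' (l.adj_nbr (i, j')) with h | h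
  · exact absurd h (hz.ne_nbr i)
  · exact congrArg Prod.snd (l.child_injective h)

/-- All three neighbours of z are children, and two of them in one sibling pair would close a
4-cycle; so each of the three pairs contains one. -/
theorem Outer.exists_adj {z : V} (hz : l.Outer z) (hG : IsCubicGirthFive G) (hl : l.Good)
    (i : Fin 3) : ∃ j, G.Adj z (l.child (i, j)) := by
  obtain ⟨p₀, hp₀⟩ := hz.2
  have hmem : ∀ y ∈ nbhd G z, ∃ p, l.child p = y := fun y hy => by
    simpa [children] using hl.2 z hz.1 p₀ hp₀ y (mem_nbhd.1 hy)
  choose! p hp using hmem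
  have hadj : ∀ y ∈ nbhd G z, G.Adj z (l.child (p y)) := fun y hy => by
    rw [hp y hy]; exact mem_nbhd.1 hy
  have hinj : Set.InjOn (fun y => (p y).1) (nbhd G z) := by
    intro y hy y' hy' h
    have h1 : (p y).1 = (p y').1 := h
    have h2 := hadj y hy
    have h3 := hadj y' hy'
    have h4 : (p y).2 = (p y').2 := by
      refine hz.eq_of_adj hG (i := (p y).1) h2 ?_
      rw [h1]; exact h3
    rw [← hp y hy, ← hp y' hy', Prod.ext h1 h4]
  have huniv : (nbhd G z).image (fun y => (p y).1) = univ := by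
    rw [← card_eq_iff_eq_univ, card_image_of_injOn hinj, hG.card_nbhd, Fintype.card_fin]
  obtain ⟨y, hy, rfl⟩ := mem_image.1 (huniv ▸ mem_univ i)
  exact ⟨(p y).2, hadj y hy⟩

theorem Outer.adj_of_not_adj {z : V} (hz : l.Outer z) (hG : IsCubicGirthFive G) (hl : l.Good)
    {i : Fin 3} {j : Fin 2} (h : ¬ G.Adj z (l.child (i, j))) : G.Adj z (l.child (i, j + 1)) := by
  obtain ⟨j', hj'⟩ := hz.exists_adj hG hl i
  have : j' ≠ j := fun e => h (e ▸ hj')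
  rwa [(by decide : ∀ j j' : Fin 2, j' ≠ j → j + 1 = j') j j' this]

/-- A child has two neighbours besides its parent; they lie outside the ball because no two children
are adjacent. -/
theorem Good.exists_outer (hl : l.Good) (hG : IsCubicGirthFive G) (p : Pos) :
    ∃ a b, a ≠ b ∧ l.Outer a ∧ l.Outer b ∧ G.Adj a (l.child p) ∧ G.Adj b (l.child p) := by
  have hcard : #((nbhd G (l.child p)).erase (l.nbr p.1)) = 2 := by
    rw [card_erase_of_mem (mem_nbhd.2 (l.adj_nbr p).symm), hG.card_nbhd]
  obtain ⟨a, b, hab, hs⟩ := card_eq_two.1 hcard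
  have key : ∀ y ∈ (nbhd G (l.child p)).erase (l.nbr p.1), l.Outer y ∧ G.Adj y (l.child p) := by
    intro y hy
    rw [mem_erase, mem_nbhd] at hy
    refine ⟨⟨fun hb => ?_, p, hy.2.symm⟩, hy.2.symm⟩
    rcases mem_union.1 hb with hb | hb
    · rcases mem_insert.1 hb with rfl | hb
      · exact l.child_not_adj p hy.2.symm
      · rw [l.nbhd_root] at hb
        obtain ⟨i, -, rfl⟩ := mem_image.1 hb
        refine hy.1 (congrArg l.nbr ?_)
        rcases l.adj_nbr_iff.1 hy.2.symm with h | h | h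
        · exact absurd h (l.child_ne_root p)
        · rw [l.child_injective h]
        · rw [l.child_injective h]
    · obtain ⟨q, -, rfl⟩ := mem_image.1 hb
      exact hl.1 p q hy.2
  have ha := key a (by rw [hs]; simp)
  have hb := key b (by rw [hs]; simp)
  exact ⟨a, b, hab, ha.1, hb.1, ha.2, hb.2⟩

theorem Good.exists_other (hl : l.Good) (hG : IsCubicGirthFive G) (p : Pos) (z : V) :
    ∃ c, c ≠ z ∧ l.Outer c ∧ G.Adj c (l.child p) := by
  obtain ⟨a, b, hab, ha, hb, ha', hb'⟩ := hl.exists_outer hG p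
  by_cases h : a = z
  · exact ⟨b, fun e => hab (h.trans e.symm), hb, hb'⟩
  · exact ⟨a, h, ha, ha'⟩

/-- Two vertices with two common children would form a 4-cycle. Hence a vertex that shares one child
with a must differ from it at the others. -/
theorem not_adj_of_adj (hG : IsCubicGirthFive G) {a c : V} {p q : Pos} (hca : c ≠ a) (hpq : p ≠ q)
    (hap : G.Adj a (l.child p)) (hcp : G.Adj c (l.child p)) (haq : G.Adj a (l.child q)) :
    ¬ G.Adj c (l.child q) := fun hcq => by
  rcases hG.no_square hap hcp haq hcq with h | h
  · exact hca h.symm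
  · exact hpq (l.child_injective h)

/-- The vertices at distance three and their adjacencies. -/
theorem Good.exists_outer_pattern (hl : l.Good) (hG : IsCubicGirthFive G) :
    ∃ (w : Pos → V) (t : Fin 4 → V), Function.Injective w ∧ Function.Injective t ∧
      (∀ k, l.Outer (t k)) ∧ (∀ p, ∃ q : Pos, w p = l.child q ∧ q.1 = p.1) ∧
      (G.Adj (t 0) (w (0, 0)) ∧ G.Adj (t 0) (w (1, 0)) ∧ G.Adj (t 0) (w (2, 0))) ∧
      (G.Adj (t 1) (w (0, 0)) ∧ G.Adj (t 1) (w (1, 1)) ∧ G.Adj (t 1) (w (2, 1))) ∧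
      (G.Adj (t 2) (w (0, 1)) ∧ G.Adj (t 2) (w (1, 0)) ∧ G.Adj (t 2) (w (2, 1))) ∧
      (G.Adj (t 3) (w (0, 1)) ∧ G.Adj (t 3) (w (1, 1)) ∧ G.Adj (t 3) (w (2, 0))) := by
  -- An outer vertex picks one child from each pair, that is, a binary word of length three, and
  -- words of distinct vertices agree in at most one place. After relabelling children so that a is
  -- 000, the words are 000, 011, 101, 110.
  obtain ⟨a, b, hab, ha, hb, ha0, hb0⟩ := hl.exists_outer hG (0, 0)
  obtain ⟨α, haα⟩ := ha.exists_adj hG hl 1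
  obtain ⟨β, haβ⟩ := ha.exists_adj hG hl 2
  have hbα : G.Adj b (l.child (1, α + 1)) :=
    hb.adj_of_not_adj hG hl (not_adj_of_adj hG hab.symm (by simp) ha0 hb0 haα)
  have hbβ : G.Adj b (l.child (2, β + 1)) :=
    hb.adj_of_not_adj hG hl (not_adj_of_adj hG hab.symm (by simp) ha0 hb0 haβ)
  obtain ⟨c, hca, hc, hcα⟩ := hl.exists_other hG (1, α) a
  have hc0 : G.Adj c (l.child (0, 0 + 1)) :=
    hc.adj_of_not_adj hG hl (not_adj_of_adj hG hca (by simp) haα hcα ha0)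
  have hcβ : G.Adj c (l.child (2, β + 1)) :=
    hc.adj_of_not_adj hG hl (not_adj_of_adj hG hca (by simp) haα hcα haβ)
  obtain ⟨d, hdb, hd, hdα⟩ := hl.exists_other hG (1, α + 1) b
  have hd0 : G.Adj d (l.child (0, 0 + 1)) :=
    hd.adj_of_not_adj hG hl (not_adj_of_adj hG hdb (by simp) hbα hdα hb0)
  have hdβ : G.Adj d (l.child (2, β)) := by
    have h := hd.adj_of_not_adj hG hl (not_adj_of_adj hG hdb (by simp) hbα hdα hbβ)
    rwa [(by decide : ∀ β : Fin 2, β + 1 + 1 = β) β] at h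
  have hα : α ≠ α + 1 := (by decide : ∀ α : Fin 2, α ≠ α + 1) α
  have hne : ∀ {y z : V}, l.Outer y → G.Adj y (l.child (1, α)) →
      G.Adj z (l.child (1, α + 1)) → y ≠ z := fun hy h1 h2 e =>
    hα (hy.eq_of_adj hG h1 (e ▸ h2))
  have hbc : c ≠ b := hne hc hcα hbα
  have had : a ≠ d := hne ha haα hdα
  have hcd : c ≠ d := hne hc hcα hdα
  let s : Fin 3 → Fin 2 := ![0, α, β]
  let w : Pos → V := fun p => ![l.child (p.1, s p.1), l.child (p.1, s p.1 + 1)] p.2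
  have hw : ∀ p, w p = l.child (p.1, s p.1 + p.2) := by
    rintro ⟨i, j⟩
    fin_cases j
    · simp [w]
    · simp [w]
  refine ⟨w, ![a, b, c, d], ?_, ?_, ?_, fun p => ⟨_, hw p, rfl⟩, ⟨ha0, haα, haβ⟩, ⟨hb0, hbα, hbβ⟩,
    ⟨hc0, hcα, hcβ⟩, ⟨hd0, hdα, hdβ⟩⟩
  · rintro ⟨i, j⟩ ⟨i', j'⟩ h
    rw [hw, hw] at h
    have h' := l.child_injective h
    simp only [Prod.mk.injEq] at h'
    obtain ⟨rfl, h'⟩ := h'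
    rw [add_left_cancel h']
  · rw [← List.nodup_ofFn]
    simp [hab, hca.symm, had, hbc.symm, hdb.symm, hcd]
  · intro k
    fin_cases k
    exacts [ha, hb, hc, hd]

end Labelling

theorem heawood_hom_of_adj {V : Type*} {G : SimpleGraph V} {f : Fin 14 → V} (h1 : ∀ i,
    G.Adj (f i) (f (i + 1)))
    (h5 : ∀ i : Fin 14, Even i.val → G.Adj (f i) (f (i + 5))) {i j : Fin 14}
    (h : heawood.Adj i j) : G.Adj (f i) (f j) := by
  rw [heawood, SimpleGraph.fromRel_adj] at h
  rcases h.2 with (rfl | ⟨he, rfl⟩) | (rfl | ⟨he, rfl⟩)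
  exacts [h1 _, h5 _ he, (h1 _).symm, (h5 _ he).symm]

theorem Labelling.Good.exists_heawood_hom {l : Labelling G v} (hl : l.Good)
    (hG : IsCubicGirthFive G) : ∃ f : Fin 14 → V, Function.Injective f ∧
      ∀ i j, heawood.Adj i j → G.Adj (f i) (f j) := by
  obtain ⟨w, t, hw, ht, hto, hwl, h0, h1, h2, h3⟩ := hl.exists_outer_pattern hG
  have hwu : ∀ p : Pos, G.Adj (l.nbr p.1) (w p) := fun p => by
    obtain ⟨q, hq, hqp⟩ := hwl p
    rw [hq, ← hqp]; exact l.adj_nbr q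
  let g : Unit ⊕ Fin 3 ⊕ Pos ⊕ Fin 4 → V :=
    Sum.elim (fun _ => v) (Sum.elim l.nbr (Sum.elim w t))
  have hg : Function.Injective g := by
    refine Function.Injective.sumElim (fun _ _ _ => rfl)
      (Function.Injective.sumElim l.nbr_injective (Function.Injective.sumElim hw ht ?_) ?_) ?_
    · intro p k
      obtain ⟨q, hq, -⟩ := hwl p
      rw [hq]; exact ((hto k).ne_child q).symm
    · rintro i (p | k)
      · obtain ⟨q, hq, -⟩ := hwl p
        rw [Sum.elim_inl, hq]; exact (l.child_ne_nbr q i).symm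
      · exact ((hto k).ne_nbr i).symm
    · rintro - (i | p | k)
      · exact (l.adj_root i).ne
      · obtain ⟨q, hq, -⟩ := hwl p
        rw [Sum.elim_inr, Sum.elim_inl, hq]; exact (l.child_ne_root q).symm
      · exact (hto k).ne_root.symm
  -- A Hamiltonian cycle through the root, first neighbours, children and outer vertices, arranged
  -- so that the remaining edges are the chords from even i to i + 5.
  let σ : Fin 14 → Unit ⊕ Fin 3 ⊕ Pos ⊕ Fin 4 :=
    ![.inl (), .inr (.inl 0), .inr (.inr (.inl (0, 0))), .inr (.inr (.inr 0)),
      .inr (.inr (.inl (1, 0))), .inr (.inl 1), .inr (.inr (.inl (1, 1))), .inr (.inr (.inr 1)),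
      .inr (.inr (.inl (2, 1))), .inr (.inr (.inr 2)), .inr (.inr (.inl (0, 1))),
      .inr (.inr (.inr 3)), .inr (.inr (.inl (2, 0))), .inr (.inl 2)]
  have hσ : Function.Injective σ := by
    rw [← List.nodup_ofFn]
    simp [σ]
  refine ⟨g ∘ σ, hg.comp hσ, fun i j => heawood_hom_of_adj (fun i => ?_) fun i hi => ?_⟩
  · fin_cases i
    exacts [l.adj_root 0, hwu (0, 0), h0.1.symm, h0.2.1, (hwu (1, 0)).symm, hwu (1, 1), h1.2.1.symm,
      h1.2.2, h2.2.2.symm, h2.1, h3.1.symm, h3.2.2, (hwu (2, 0)).symm, (l.adj_root 2).symm]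
  · fin_cases i
    · exact l.adj_root 1
    · exact absurd hi (by decide)
    · exact h1.1.symm
    · exact absurd hi (by decide)
    · exact h2.2.1.symm
    · exact absurd hi (by decide)
    · exact h3.2.1.symm
    · exact absurd hi (by decide)
    · exact (hwu (2, 1)).symm
    · exact absurd hi (by decide)
    · exact (hwu (0, 1)).symm
    · exact absurd hi (by decide)
    · exact h0.2.2.symm
    · exact absurd hi (by decide)

/-- An injective homomorphism from the Heawood graph to a cubic graph covers a component. -/
theorem adj_iff_of_heawood_hom (hG : IsCubicGirthFive G) {f : Fin 14 → V}
    (hf : Function.Injective f) (hadj : ∀ i j, heawood.Adj i j → G.Adj (f i) (f j)) (i : Fin 14)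
    (y : V) : G.Adj (f i) y ↔ ∃ j, heawood.Adj i j ∧ f j = y := by
  have h : (heawoodNbr i).image f = nbhd G (f i) := by
    refine eq_of_subset_of_card_le (fun y hy => ?_) ?_
    · obtain ⟨j, hj, rfl⟩ := mem_image.1 hy
      exact mem_nbhd.2 (hadj i j ((heawood_adj_iff i j).2 hj))
    · rw [card_image_of_injective _ hf, hG.card_nbhd, card_heawoodNbr]
  rw [← mem_nbhd, ← h, mem_image]
  simp only [heawood_adj_iff]

end GirthSlices

/-! ### Splitting off Heawood components -/

namespace GirthSlices

open Finset
open scoped Classical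

universe u

variable {V : Type u} [Fintype V] {G : SimpleGraph V}

/-- Removing a union of components preserves regularity and girth. -/
theorem IsCubicGirthFive.induce (hG : IsCubicGirthFive G) {s : Set V} [Fintype s]
    (hs : ∀ a ∈ s, ∀ b, G.Adj a b → b ∈ s) : IsCubicGirthFive (G.induce s) where
  card_nbhd a := by
    have h : (nbhd (G.induce s) a).map (Function.Embedding.subtype _) = nbhd G a := by
      ext y
      simp only [mem_map, mem_nbhd, SimpleGraph.comap_adj, Function.Embedding.coe_subtype]
      constructor
      · rintro ⟨b, hb, rfl⟩
        exact hb
      · intro h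
        exact ⟨⟨y, hs a a.2 y h⟩, h, rfl⟩
    rw [← card_map, h, hG.card_nbhd]
  no_triangle h1 h2 h3 := hG.no_triangle h1 h2 h3
  no_square h1 h2 h3 h4 := (hG.no_square h1 h2 h3 h4).imp Subtype.ext Subtype.ext

/-- Splitting off a Heawood component. -/
theorem indepPoly_eq_heawoodPoly_mul {f : Fin 14 → V} (hf : Function.Injective f)
    (hadj : ∀ i y, G.Adj (f i) y ↔ ∃ j, heawood.Adj i j ∧ f j = y) :
    indepPoly G = heawoodPoly * indepPoly (G.induce (Set.range f)ᶜ) := by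
  have hff : ∀ i j, G.Adj (f i) (f j) ↔ heawood.Adj i j := fun i j => by
    rw [hadj]
    exact ⟨fun ⟨j', h, e⟩ => hf e ▸ h, fun h => ⟨j, h, rfl⟩⟩
  have hcross : ∀ i (y : ↥((Set.range f)ᶜ)), ¬ G.Adj (f i) y := fun i y h => by
    obtain ⟨j, -, e⟩ := (hadj i y).1 h
    exact y.2 ⟨j, e⟩
  let e : heawood ⊕g G.induce (Set.range f)ᶜ ≃g G :=
    { toEquiv := ((Equiv.ofInjective f hf).sumCongr (Equiv.refl _)).trans
        (Equiv.Set.sumCompl (Set.range f))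
      map_rel_iff' := by
        rintro (i | y) (j | z)
        · simpa using hff i j
        · simpa using hcross i z
        · simpa using fun h => hcross j y h.symm
        · simp }
  rw [← indepPoly_congr e, indepPoly_sum, indepPoly_heawood]

/-- Every cubic graph of girth at least five is a union of Heawood graphs and of a graph none of
whose balls looks like the Heawood graph. -/
theorem exists_heawood_factorization (n : ℕ) : ∀ (V : Type u) [Fintype V] (G : SimpleGraph V),
    Fintype.card V = n → IsCubicGirthFive G →
    ∃ (m : ℕ) (V' : Type u) (_ : Fintype V') (G' : SimpleGraph V'), IsCubicGirthFive G' ∧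
      (∀ v, ∀ l : Labelling G' v, ¬ l.Good) ∧ n = 14 * m + Fintype.card V' ∧
      indepPoly G = heawoodPoly ^ m * indepPoly G' := by
  induction n using Nat.strong_induction_on with
  | _ n ih =>
    intro V _ G hn hG
    by_cases hgood : ∀ v, ∀ l : Labelling G v, ¬ l.Good
    · exact ⟨0, V, inferInstance, G, hG, hgood, by simp [hn], by simp⟩
    · push Not at hgood
      obtain ⟨v, l, hl⟩ := hgood
      obtain ⟨f, hf, hom⟩ := hl.exists_heawood_hom hG
      have hadj := adj_iff_of_heawood_hom hG hf hom
      have hs : ∀ a ∈ (Set.range f)ᶜ, ∀ b, G.Adj a b → b ∈ (Set.range f)ᶜ := by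
        rintro a ha _ hab ⟨i, rfl⟩
        obtain ⟨j, -, e⟩ := (hadj i a).1 hab.symm
        exact ha ⟨j, e⟩
      have hcard : Fintype.card ↥((Set.range f)ᶜ) + 14 = n := by
        have h1 := Fintype.card_congr (Equiv.Set.sumCompl (Set.range f))
        rw [Fintype.card_sum, ← Fintype.card_congr (Equiv.ofInjective f hf), Fintype.card_fin,
          hn] at h1
        omega
      obtain ⟨m, V', hV', G', hG', hbad, hc, hp⟩ := ih _ (by omega) _ (G.induce (Set.range f)ᶜ) rfl
        (hG.induce hs)
      refine ⟨m + 1, V', hV', G', hG', hbad, by omega, ?_⟩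
      rw [indepPoly_eq_heawoodPoly_mul hf hadj, hp, pow_succ']
      ring

theorem isCubicGirthFive_of_egirth [DecidableRel G.Adj] (hreg : G.IsRegularOfDegree 3)
    (hgirth : 5 ≤ G.egirth) : IsCubicGirthFive G where
  card_nbhd v := by
    rw [← hreg v, ← SimpleGraph.card_neighborFinset_eq_degree]
    congr 1
    ext y; simp
  no_triangle := by
    intro a b c hab hac hbc
    have hc : (SimpleGraph.Walk.cons hab (.cons hbc (.cons hac.symm .nil))).IsCycle := by
      rw [SimpleGraph.Walk.isCycle_def]
      simp [SimpleGraph.Walk.isTrail_def, hab.ne, hab.ne', hac.ne, hac.ne', hbc.ne]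
    have := SimpleGraph.le_egirth.1 hgirth _ _ hc
    norm_num at this
  no_square := by
    intro a b c d hac hbc had hbd
    by_contra! h
    have hc : (SimpleGraph.Walk.cons hac
        (.cons hbc.symm (.cons hbd (.cons had.symm .nil)))).IsCycle := by
      rw [SimpleGraph.Walk.isCycle_def]
      simp [SimpleGraph.Walk.isTrail_def, hac.ne, hac.ne', hbc.ne', had.ne, had.ne', hbd.ne,
        h.1, h.2, h.1.symm]
    have := SimpleGraph.le_egirth.1 hgirth _ _ hc
    norm_num at this

end GirthSlices

/-! ### From partition functions to coefficients -/

namespace GirthSlices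

open Finset Polynomial Filter Topology

/-- Convolution with weights of total mass p(x) cannot raise the maximum by more than that mass. -/
theorem coeff_mul_mul_pow_le {p q : ℝ[X]} (hp : ∀ j, 0 ≤ p.coeff j) {x D : ℝ} (hx : 0 ≤ x)
    (hD : 0 ≤ D) (hq : ∀ i, q.coeff i * x ^ i ≤ D) (k : ℕ) :
    (q * p).coeff k * x ^ k ≤ D * p.eval x := by
  calc (q * p).coeff k * x ^ k
      = ∑ a ∈ antidiagonal k, (p.coeff a.1 * x ^ a.1) * (q.coeff a.2 * x ^ a.2) := by
        rw [mul_comm q, coeff_mul, sum_mul]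
        refine sum_congr rfl fun a ha => ?_
        rw [← mem_antidiagonal.1 ha, pow_add]
        ring
    _ ≤ ∑ a ∈ antidiagonal k, (p.coeff a.1 * x ^ a.1) * D :=
        sum_le_sum fun a _ => mul_le_mul_of_nonneg_left (hq _)
          (mul_nonneg (hp _) (pow_nonneg hx _))
    _ = (∑ j ∈ range (k + 1), p.coeff j * x ^ j) * D := by
        rw [← sum_mul, Finset.Nat.sum_antidiagonal_eq_sum_range_succ_mk]
    _ ≤ p.eval x * D := by
        refine mul_le_mul_of_nonneg_right ?_ hD
        rw [eval_eq_sum_range' (show p.natDegree < p.natDegree + (k + 1) by omega)]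
        exact sum_le_sum_of_subset_of_nonneg (range_subset_range.2 (by omega))
          fun j _ _ => mul_nonneg (hp _) (pow_nonneg hx _)
    _ = D * p.eval x := mul_comm _ _

theorem eval_heawoodPoly_pow_le {M : ℕ} {x B : ℝ}
    (hB : ∀ l, (heawoodPoly ^ M).coeff l * x ^ l ≤ B) :
    heawoodPoly.eval x ^ M ≤ (7 * M + 1) * B := by
  have hdeg : (heawoodPoly ^ M).natDegree < 7 * M + 1 := by
    have := natDegree_pow_le (p := heawoodPoly) (n := M)
    rw [natDegree_heawoodPoly] at this
    omega
  rw [← eval_pow, eval_eq_sum_range' hdeg]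
  refine (sum_le_sum fun l _ => hB l).trans_eq ?_
  simp

/-- For graphs with fewer than m₀ Heawood components: the exponential gain outweighs the number of
coefficients of P^M. -/
theorem exists_forall_mul_exp_le_one {γ : ℝ} (hγ : 0 < γ) (m₀ : ℕ) :
    ∃ M₁ : ℕ, ∀ M ≥ M₁, (7 * (M : ℝ) + 1) * Real.exp (-(γ * (M - m₀))) ≤ 1 := by
  have h1 := tendsto_rpow_mul_exp_neg_mul_atTop_nhds_zero 1 γ hγ
  have h0 := tendsto_rpow_mul_exp_neg_mul_atTop_nhds_zero 0 γ hγ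
  have h := (((h1.const_mul 7).add h0).const_mul (Real.exp (γ * m₀))).comp
    (tendsto_natCast_atTop_atTop (R := ℝ))
  have h' := h.eventually (eventually_le_nhds (b := 1) (by norm_num))
  obtain ⟨M₁, hM₁⟩ := eventually_atTop.1 h'
  refine ⟨M₁, fun M hM => le_trans (le_of_eq ?_) (hM₁ M hM)⟩
  simp only [Function.comp_apply, Real.rpow_one, Real.rpow_zero]
  rw [show -(γ * ((M : ℝ) - m₀)) = γ * m₀ + -γ * M by ring, Real.exp_add]
  ring

theorem eval_heawoodPoly_le {x : ℝ} (hx : 1 ≤ x) : heawoodPoly.eval x ≤ 458 * x ^ 7 := by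
  have h : ∀ l ∈ range 8, x ^ l ≤ x ^ 7 := fun l hl =>
    pow_le_pow_right₀ hx (by have := mem_range.1 hl; omega)
  have h0 := h 0 (by simp)
  have h1 := h 1 (by simp)
  have h2 := h 2 (by simp)
  have h3 := h 3 (by simp)
  have h4 := h 4 (by simp)
  have h5 := h 5 (by simp)
  have h6 := h 6 (by simp)
  rw [eval_heawoodPoly]
  linarith

/-- A polynomial with nonnegative coefficients dominated by `heawoodPoly ^ M` near infinity has
degree at most `7 * M`. -/
theorem coeff_eq_zero_of_eval_le {p : ℝ[X]} (hp : ∀ j, 0 ≤ p.coeff j) {M k : ℕ} (hk : 7 * M < k)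
    (h : ∀ x ≥ (1 : ℝ), p.eval x ≤ heawoodPoly.eval x ^ M) : p.coeff k = 0 := by
  by_contra hne
  have hpos : 0 < p.coeff k := lt_of_le_of_ne (hp k) (Ne.symm hne)
  have hb : ∀ x ≥ (1 : ℝ), p.coeff k * x ≤ 458 ^ M := fun x hx => by
    have hx0 : 0 < x := by linarith
    have h1 : p.coeff k * x * x ^ (7 * M) ≤ 458 ^ M * x ^ (7 * M) :=
      calc p.coeff k * x * x ^ (7 * M) = p.coeff k * x ^ (7 * M + 1) := by ring
        _ ≤ p.coeff k * x ^ k :=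
          mul_le_mul_of_nonneg_left (pow_le_pow_right₀ hx hk) hpos.le
        _ ≤ p.eval x := coeff_mul_pow_le_eval hp hx0.le k
        _ ≤ heawoodPoly.eval x ^ M := h x hx
        _ ≤ (458 * x ^ 7) ^ M :=
          pow_le_pow_left₀ (eval_heawoodPoly_pos hx0.le).le (eval_heawoodPoly_le hx) M
        _ = 458 ^ M * x ^ (7 * M) := by rw [mul_pow, ← pow_mul]
    exact le_of_mul_le_mul_right h1 (by positivity)
  have := hb (458 ^ M / p.coeff k + 1) (by
    have : (0 : ℝ) ≤ 458 ^ M / p.coeff k := by positivity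
    linarith)
  rw [mul_add, mul_div_cancel₀ _ hne] at this
  linarith

theorem indepPoly_heawoodUnion (n : ℕ) :
    indepPoly (heawoodUnion n) = heawoodPoly ^ (n / 14) := by
  rw [heawoodUnion, indepPoly_disjointCopies, indepPoly_heawood]

universe u

theorem exists_coeff_indepPoly_le (ε : ℝ) (hε : 0 < ε) (hε1 : ε ≤ 1) : ∃ M₁ : ℕ, ∀ M ≥ M₁,
    ∀ (V : Type u) [Fintype V] (G : SimpleGraph V), IsCubicGirthFive G →
      Fintype.card V = 14 * M → ∀ k : ℕ, ε * (14 * M) < k →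
        (indepPoly G).coeff k ≤ (heawoodPoly ^ M).coeff k := by
  obtain ⟨γ, hγ, hgap⟩ := exists_gap.{u} ε hε hε1
  obtain ⟨m₀, hm₀⟩ := coeff_pow_le_exp_mul_iterate γ ε hγ hε
  obtain ⟨M₁, hM₁⟩ := exists_forall_mul_exp_le_one hγ m₀
  refine ⟨M₁, fun M hM V _ G hG hcard k hk => ?_⟩
  obtain ⟨m, V', _, G', hG', hbad, hmV, hfac⟩ := exists_heawood_factorization _ V G hcard hG
  obtain ⟨r, rfl⟩ : ∃ r, M = m + r := ⟨M - m, by omega⟩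
  have hV' : Fintype.card V' = 14 * r := by omega
  have hQ : ∀ {x : ℝ}, ε ≤ x → 0 < heawoodPoly.eval x := fun hx =>
    eval_heawoodPoly_pos (hε.le.trans hx)
  have hZ : ∀ x ≥ ε, (indepPoly G').eval x ≤ heawoodPoly.eval x ^ r * Real.exp (-(γ * r)) :=
    fun x hx => by rw [eval_indepPoly]; exact hgap V' G' hG' hbad r hV' x hx
  have hZG : ∀ x ≥ ε, (indepPoly G).eval x ≤
      heawoodPoly.eval x ^ (m + r) * Real.exp (-(γ * r)) := fun x hx => by
    rw [hfac, eval_mul, eval_pow, pow_add, mul_assoc]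
    exact mul_le_mul_of_nonneg_left (hZ x hx) (pow_nonneg (hQ hx).le _)
  have hnn : ∀ p : ℕ, ∀ j, 0 ≤ (heawoodPoly ^ p).coeff j := fun p j =>
    coeff_pow_nonneg coeff_heawoodPoly_nonneg p j
  have hk0 : 0 < k := by
    have : (0 : ℝ) < k := lt_of_le_of_lt (by positivity) hk
    exact_mod_cast this
  -- Above 7M the right side vanishes, and the growth of Z_G at infinity shows that the left side
  -- does too.
  rcases lt_or_ge (7 * (m + r)) k with hk7 | hk7
  · rw [coeff_eq_zero_of_eval_le (coeff_indepPoly_nonneg G) hk7 fun x hx => ?_]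
    · exact hnn _ _
    · refine (hZG x (hε1.trans hx)).trans (mul_le_of_le_one_right ?_ ?_)
      · exact pow_nonneg (hQ (hε1.trans hx)).le _
      · exact Real.exp_le_one_iff.2 (neg_nonpos.2 (by positivity))
  -- The weight is tuned to k; the hypothesis k > εn enters through x ≥ ε.
  obtain ⟨x, hkx, hx0, hmode⟩ := exists_weight_mode hk0 hk7
  have hM0 : (0 : ℝ) < 14 * ((m + r : ℕ) : ℝ) := by
    have : 0 < m + r := by omega
    positivity
  have hxε : ε ≤ x := ((le_div_iff₀ hM0).2 hk.le).trans hkx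
  refine le_of_mul_le_mul_right (a := x ^ k) ?_ (pow_pos hx0 k)
  set B := (heawoodPoly ^ (m + r)).coeff k * x ^ k with hBdef
  have hB0 : 0 ≤ B := mul_nonneg (hnn _ _) (pow_nonneg hx0.le _)
  rcases le_or_gt m₀ m with hm | hm
  -- Many Heawood components: removing r factors of P costs e^(γr), exactly what the partition
  -- function of G' gains.
  · have hQr : 0 < heawoodPoly.eval x ^ r := pow_pos (hQ hxε) r
    have hD : ∀ i, (heawoodPoly ^ m).coeff i * x ^ i ≤
        Real.exp (γ * r) * B / heawoodPoly.eval x ^ r := fun i =>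
      (le_div_iff₀ hQr).2 (hm₀ m hm x hxε r B hmode i)
    have hD0 : 0 ≤ Real.exp (γ * r) * B / heawoodPoly.eval x ^ r := by positivity
    rw [hfac]
    refine (coeff_mul_mul_pow_le (coeff_indepPoly_nonneg G') hx0.le hD0 hD k).trans ?_
    refine (mul_le_mul_of_nonneg_left (hZ x hxε) hD0).trans_eq ?_
    rw [Real.exp_neg]
    field_simp
  -- Few Heawood components: a coefficient is bounded by the whole value, and the largest weighted
  -- coefficient B of P^M is at least P(x)^M / (7M + 1).
  · calc (indepPoly G).coeff k * x ^ k ≤ (indepPoly G).eval x :=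
          coeff_mul_pow_le_eval (coeff_indepPoly_nonneg G) hx0.le k
      _ ≤ heawoodPoly.eval x ^ (m + r) * Real.exp (-(γ * r)) := hZG x hxε
      _ ≤ ((7 * (m + r : ℕ) + 1) * B) * Real.exp (-(γ * ((m + r : ℕ) - m₀))) := by
          refine mul_le_mul (eval_heawoodPoly_pow_le hmode) (Real.exp_le_exp.2 ?_)
            (Real.exp_pos _).le (by positivity)
          have : (m : ℝ) ≤ m₀ := by exact_mod_cast hm.le
          push_cast
          exact neg_le_neg (mul_le_mul_of_nonneg_left (by linarith) hγ.le)
      _ = B * ((7 * (m + r : ℕ) + 1) * Real.exp (-(γ * ((m + r : ℕ) - m₀)))) := by ring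
      _ ≤ B := mul_le_of_le_one_right hB0 (hM₁ _ hM)

end GirthSlices

theorem theorem5 (ε : ℝ) (hε : 0 < ε) :
    ∃ N : ℕ, ∀ n : ℕ, N ≤ n → 14 ∣ n →
      ∀ (V : Type*) [Fintype V] (G : SimpleGraph V) [DecidableRel G.Adj],
        Fintype.card V = n → G.IsRegularOfDegree 3 → 5 ≤ G.egirth →
          ∀ k : ℕ, ε * (n : ℝ) < (k : ℝ) →
            GirthSlices.indepCount G k ≤
              GirthSlices.indepCount (GirthSlices.heawoodUnion n) k := by
  -- The gap estimate works at fugacities at most 1, hence the truncation; lowering ε only admits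
  -- more values of k.
  obtain ⟨M₁, hM₁⟩ := GirthSlices.exists_coeff_indepPoly_le (min ε 1) (lt_min hε one_pos)
    (min_le_right _ _)
  refine ⟨14 * M₁, ?_⟩
  rintro _ hn ⟨M, rfl⟩ V _ G _ hcard hreg hgirth k hk
  have h := hM₁ M (by omega) V G (GirthSlices.isCubicGirthFive_of_egirth hreg hgirth) hcard k (by
    push_cast at hk
    exact lt_of_le_of_lt (mul_le_mul_of_nonneg_right (min_le_left _ _) (by positivity)) hk)
  rw [show M = 14 * M / 14 by omega, ← GirthSlices.indepPoly_heawoodUnion,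
    GirthSlices.coeff_indepPoly, GirthSlices.coeff_indepPoly] at h
  exact_mod_cast h
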